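/- **Notation.** Let $d\ge 1$, $n\ge 0$ and $\kappa=(\kappa_1,\dots,\kappa_{d+1})$ with all $\kappa_i>-1$. For a vector $y=(y_1,\dots,y_k)$ put $|y|=y_1+\dots+y_k$, $|\mathbf y_j|=y_1+\dots+y_j$ and $|\mathbf y^j|=y_j+\dots+y_k$; empty sums are $0$. $(a)_m=a(a+1)\cdots(a+m-1)$ is the Pochhammer symbol. *Jacobi polynomials on the simplex.* Let $T^d=\{x\in\mathbb R^d: x_i\ge0,\ |x|\le1\}$ and $W_\kappa(x)=x_1^{\kappa_1}\cdots x_d^{\kappa_d}(1-|x|)^{\kappa_{d+1}}$, $$\langle f,g\rangle_{W_\kappa}=\frac{\Gamma(|\kappa|+d+1)}{\prod_{i=1}^{d+1}\Gamma(\kappa_i+1)}\int_{T^d}f\,g\,W_\kappa\,dx .$$ For $\nu\in\mathbb N_0^d$ let $P_\nu^\kappa$ be the polynomial $$P_\nu^\kappa(x)=\prod_{j=1}^d(1-|\mathbf x_{j-1}|)^{\nu_j}P_{\nu_j}^{(a_j,\kappa_j)}\Big(\frac{2x_j}{1-|\mathbf x_{j-1}|}-1\Big),\qquad a_j=\sum_{i=j+1}^{d+1}\kappa_i+2\sum_{i=j+1}^{d}\nu_i+d-j,$$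 where $P_m^{(\alpha,\beta)}$ are the classical Jacobi polynomials, and let $A_\nu(\kappa)=\langle P_\nu^\kappa,P_\nu^\kappa\rangle_{W_\kappa}$. *Connection coefficients.* Let $\tau$ be the cyclic permutation $(1\,2\,\dots\,d)$ of $\{1,\dots,d+1\}$, that is $1\mapsto2\mapsto\dots\mapsto d\mapsto1$ and $d+1\mapsto d+1$. It acts by $\tau\kappa=(\kappa_2,\dots,\kappa_d,\kappa_1,\kappa_{d+1})$ and $\tau x=(x_2,\dots,x_d,x_1)$. The connection coefficients $c_{\nu,\mu}^\tau(\kappa)$ and the normalized connection coefficients $\widehat c_{\nu,\mu}^{\,\tau}(\kappa)$, for $|\nu|=|\mu|=n$, are defined by $$P_\nu^{\tau\kappa}(\tau x)=\sum_{|\mu|=n}c_{\nu,\mu}^\tau(\kappa)P_\mu^\kappa(x)\quad(x\in\mathbb R^d),\qquad \widehat c_{\nu,\mu}^{\,\tau}(\kappa)=\sqrt{\frac{A_\mu(\kappa)}{A_\nu(\tau\kappa)}}\;c_{\nu,\mu}^\tau(\kappa).$$ *Racah polynomials in $D$ variables* (Tratnik), with parameters $\beta=(\beta_0,\dots,\beta_{D+1})$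 and $N\in\mathbb N_0$. On the grid $0=x_0\le x_1\le\dots\le x_D\le x_{D+1}=N$ of integer points, with indices $\nu\in\mathbb N_0^D$, let $$w_{\mathsf R}(x;\beta,N)=\prod_{j=0}^{D}\frac{(\beta_{j+1}-\beta_j)_{x_{j+1}-x_j}(\beta_{j+1})_{x_{j+1}+x_j}}{(x_{j+1}-x_j)!\,(\beta_j+1)_{x_{j+1}+x_j}}\prod_{j=1}^{D}\frac{((\beta_j+2)/2)_{x_j}}{(\beta_j/2)_{x_j}},$$ $$\mathsf R_\nu(x;\beta,N)=\prod_{j=1}^{D}(V_j)_{\nu_j}(W_j)_{\nu_j}(U_j)_{\nu_j}\;{}_4F_3\!\left(\begin{matrix}-\nu_j,\ \nu_j+2|\boldsymbol\nu_{j-1}|+\beta_{j+1}-\beta_0-1,\ |\boldsymbol\nu_{j-1}|-x_j,\ |\boldsymbol\nu_{j-1}|+\beta_j+x_j\\ V_j,\ W_j,\ U_j\end{matrix};1\right),$$ where $V_j=2|\boldsymbol\nu_{j-1}|+\beta_j-\beta_0$, $W_j=|\boldsymbol\nu_{j-1}|+\beta_{j+1}+x_{j+1}$, $U_j=|\boldsymbol\nu_{j-1}|-x_{j+1}$.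 The weight $w_{\mathsf R}$ is read as a rational function of $\beta$ in reduced form, $$w_{\mathsf R}(x;\beta,N)=\prod_{j=0}^{D}\frac{(\beta_{j+1}-\beta_j)_{x_{j+1}-x_j}}{(x_{j+1}-x_j)!}\cdot\frac{(\beta_{D+1})_{N+x_D}}{(\beta_0+1)_{x_1}}\prod_{j=1}^{D}\frac1{(\beta_j+x_{j-1}+x_j)_{x_j-x_{j-1}}\,(\beta_j+2x_j+1)_{x_{j+1}-x_j}},$$ and $(V)_m(W)_m(U)_m\,{}_4F_3(-m,\dots;V,W,U;1)$ is read as a polynomial in all its parameters. For a weight $w$ on the grid, the orthonormal Racah polynomials are $\widehat{\mathsf R}_\nu=\mathsf R_\nu/\|\mathsf R_\nu\|$ with $\|\mathsf R_\nu\|=\big(\sum_x w(x)\mathsf R_\nu(x)^2\big)^{1/2}$, the sum being over the grid; $w=w_{\mathsf R}$ unless stated otherwise. (For $D=0$ the grid is a single point and $\mathsf R=1$.) **Theorem.** The connection coefficients $c_{\nu,\mu}^\tau(\kappa)$ exist and are unique. Let $\nu,\mu\in\mathbb N_0^d$ with $|\nu|=|\mu|=n$. (i) Let $D=d-1$, $\hat\mu=(\mu_d,\mu_{d-1},\dots,\mu_2)$,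 $\hat\nu=(|\boldsymbol\nu^d|,|\boldsymbol\nu^{d-1}|,\dots,|\boldsymbol\nu^2|)$ and $\beta_j=\kappa_1+|\boldsymbol\kappa^{d+2-j}|+j$ for $j=0,\dots,d$. If $|\kappa|+d>0$ or $n=0$, then $$\widehat c_{\nu,\mu}^{\,\tau}(\kappa)=(-1)^{n+\nu_d}\sqrt{w_{\mathsf R}(\hat\nu;\beta,n)}\;\widehat{\mathsf R}_{\hat\mu}(\hat\nu;\beta,n).$$ If $|\kappa|+d<0$ and $n\ge1$, the same formula holds with $w_{\mathsf R}$ replaced by $-w_{\mathsf R}$, both under the square root and as the weight with respect to which $\widehat{\mathsf R}_{\hat\mu}$ is normalized. (ii) Let $D=d-1$, $\tilde\nu=(\nu_1,\dots,\nu_{d-1})$, $\tilde\mu=(|\boldsymbol\mu_1|,\dots,|\boldsymbol\mu_{d-1}|)$, $\tilde\beta_0=\kappa_1$ and $\tilde\beta_j=-|\boldsymbol\kappa^{j+1}|-2n-d+j$ for $j=1,\dots,d$. Then $$\widehat c_{\nu,\mu}^{\,\tau}(\kappa)=(-1)^{n+\nu_d}\sqrt{w_{\mathsf R}(\tilde\mu;\tilde\beta,n)}\;\widehat{\mathsf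 R}_{\tilde\nu}(\tilde\mu;\tilde\beta,n).$$ -/

import Mathlib

noncomputable section

namespace SimplexJacobi

/-- The Pochhammer symbol `(a)_n = a (a + 1) ⋯ (a + n - 1)`. -/
def poch (a : ℝ) (n : ℕ) : ℝ := (ascPochhammer ℝ n).eval a

theorem poch_zero (a : ℝ) : poch a 0 = 1 := by simp [poch]

theorem poch_add (a : ℝ) (m n : ℕ) : poch a (m + n) = poch a m * poch (a + m) n := by
  rw [poch, ← ascPochhammer_mul, Polynomial.eval_mul, Polynomial.eval_comp]
  simp [poch]

theorem poch_one (a : ℝ) : poch a 1 = a := by simp [poch]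

theorem poch_succ_left (a : ℝ) (n : ℕ) : poch a (n + 1) = a * poch (a + 1) n := by
  rw [add_comm n 1, poch_add, poch_one, Nat.cast_one]

theorem poch_succ_right (a : ℝ) (n : ℕ) : poch a (n + 1) = poch a n * (a + n) := by
  rw [poch_add, poch_one]

/-- `y_1 + ⋯ + y_j`, the sum of the first `j` entries of `y` (numbered from `1`). -/
def headSum {M : Type*} [AddCommMonoid M] {k : ℕ} (y : Fin k → M) (j : ℕ) : M :=
  ∑ i : Fin k, if (i : ℕ) + 1 ≤ j then y i else 0

/-- `y_j + ⋯ + y_k`, the sum of the entries of `y` from the `j`-th one on (numbered from `1`). -/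
def tailSum {M : Type*} [AddCommMonoid M] {k : ℕ} (y : Fin k → M) (j : ℕ) : M :=
  ∑ i : Fin k, if j ≤ (i : ℕ) + 1 then y i else 0

/-! ### Jacobi polynomials on the simplex -/

/-- The Jacobi polynomial `P_n^{(α, β)}(t)`. -/
def jacobi (n : ℕ) (α β t : ℝ) : ℝ :=
  poch (α + 1) n / (n.factorial : ℝ) *
    ∑ k ∈ Finset.range (n + 1),
      poch (-(n : ℝ)) k * poch (n + α + β + 1) k / (poch (α + 1) k * (k.factorial : ℝ)) *
        ((1 - t) / 2) ^ k

/-- The polynomial `s ^ n * P_n^{(α, β)}(2 t / s - 1)` in the two variables `s` and `t`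
(see `jacobiHom_eq`). -/
def jacobiHom (n : ℕ) (α β s t : ℝ) : ℝ :=
  poch (α + 1) n / (n.factorial : ℝ) *
    ∑ k ∈ Finset.range (n + 1),
      poch (-(n : ℝ)) k * poch (n + α + β + 1) k / (poch (α + 1) k * (k.factorial : ℝ)) *
        ((s - t) ^ k * s ^ (n - k))

theorem jacobiHom_eq (n : ℕ) (α β s t : ℝ) (hs : s ≠ 0) :
    jacobiHom n α β s t = s ^ n * jacobi n α β (2 * t / s - 1) := by
  unfold jacobiHom jacobi
  rw [mul_left_comm, Finset.mul_sum (a := s ^ n)]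
  congr 1
  refine Finset.sum_congr rfl fun k hk => ?_
  have hk' : k ≤ n := Nat.lt_succ_iff.mp (Finset.mem_range.mp hk)
  have h1 : (1 - (2 * t / s - 1)) / 2 = (s - t) / s := by field_simp; ring
  have h2 : s ^ n = s ^ k * s ^ (n - k) := by rw [← pow_add, Nat.add_sub_cancel' hk']
  rw [h1, h2, div_pow]
  field_simp

/-- `a_j = |κ^{j+1}| + 2 |ν^{j+1}| + d - j` for `1 ≤ j ≤ d`. -/
def aParam {d : ℕ} (κ : Fin (d + 1) → ℝ) (ν : Fin d → ℕ) (j : ℕ) : ℝ :=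
  tailSum κ (j + 1) + 2 * ((tailSum ν (j + 1) : ℕ) : ℝ) + d - j

/-- The Jacobi polynomial `P_ν^κ(x)` on the simplex: the product over `j = 1, …, d` of
`(1 - |x_{j-1}|)^{ν_j} P_{ν_j}^{(a_j, κ_j)}(2 x_j / (1 - |x_{j-1}|) - 1)`, where
`|x_{j-1}| = x_1 + ⋯ + x_{j-1}`; here `j = i + 1`. -/
def simplexJacobi {d : ℕ} (κ : Fin (d + 1) → ℝ) (ν : Fin d → ℕ) (x : Fin d → ℝ) : ℝ :=
  ∏ i : Fin d, jacobiHom (ν i) (aParam κ ν ((i : ℕ) + 1)) (κ i.castSucc) (1 - headSum x (i : ℕ)) (x i)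

/-- The simplex `T^d`. -/
def simplex (d : ℕ) : Set (Fin d → ℝ) := {x | (∀ i, 0 ≤ x i) ∧ ∑ i, x i ≤ 1}

/-- The Jacobi weight `W_κ` on the simplex. -/
def jacobiWeight {d : ℕ} (κ : Fin (d + 1) → ℝ) (x : Fin d → ℝ) : ℝ :=
  (∏ i : Fin d, x i ^ κ i.castSucc) * (1 - ∑ i, x i) ^ κ (Fin.last d)

/-- The inner product `⟨f, g⟩` with respect to the normalized weight `W_κ`. -/
def jacobiInner {d : ℕ} (κ : Fin (d + 1) → ℝ) (f g : (Fin d → ℝ) → ℝ) : ℝ :=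
  Real.Gamma ((∑ i, κ i) + d + 1) / (∏ i, Real.Gamma (κ i + 1)) *
    ∫ x in simplex d, f x * g x * jacobiWeight κ x

/-- The squared norm `A_ν(κ) = ⟨P_ν^κ, P_ν^κ⟩`. -/
def normSq {d : ℕ} (κ : Fin (d + 1) → ℝ) (ν : Fin d → ℕ) : ℝ :=
  jacobiInner κ (simplexJacobi κ ν) (simplexJacobi κ ν)

/-! ### Permutations and connection coefficients -/

/-- `τ x`: the first `d` coordinates of `τ X`, where `X = (x_1, …, x_d, 1 - |x|)` and
`(τ X)_i = X_{τ i}`. -/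
def permPoint {d : ℕ} (τ : Equiv.Perm (Fin (d + 1))) (x : Fin d → ℝ) : Fin d → ℝ :=
  fun i => (Fin.snoc x (1 - ∑ l, x l) : Fin (d + 1) → ℝ) (τ i.castSucc)

/-- `τ κ`, that is `(τ κ)_i = κ_{τ i}`. -/
def permParam {d : ℕ} (τ : Equiv.Perm (Fin (d + 1))) (κ : Fin (d + 1) → ℝ) : Fin (d + 1) → ℝ :=
  fun i => κ (τ i)

/-- The multi-indices `ν ∈ ℕ^d` with `|ν| = n`. -/
def multiIdx (d n : ℕ) : Finset (Fin d → ℕ) := Finset.piAntidiag Finset.univ n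

/-- `c` is the array of connection coefficients in degree `n`: for `|ν| = n`,
`P_ν^{τκ}(τ x) = ∑_{|μ| = n} c_{ν, μ} P_μ^κ(x)`. -/
def IsConnectionCoeff {d : ℕ} (τ : Equiv.Perm (Fin (d + 1))) (κ : Fin (d + 1) → ℝ) (n : ℕ)
    (c : (Fin d → ℕ) → (Fin d → ℕ) → ℝ) : Prop :=
  ∀ ν ∈ multiIdx d n, ∀ x : Fin d → ℝ,
    simplexJacobi (permParam τ κ) ν (permPoint τ x) =
      ∑ μ ∈ multiIdx d n, c ν μ * simplexJacobi κ μ x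

/-- The normalized coefficients `√(A_μ(κ) / A_ν(τκ)) c_{ν, μ}`. -/
def normalizedCoeff {d : ℕ} (τ : Equiv.Perm (Fin (d + 1))) (κ : Fin (d + 1) → ℝ)
    (c : (Fin d → ℕ) → (Fin d → ℕ) → ℝ) (ν μ : Fin d → ℕ) : ℝ :=
  √(normSq κ μ / normSq (permParam τ κ) ν) * c ν μ

/-- The cyclic permutation `1 ↦ 2 ↦ ⋯ ↦ d ↦ 1`, `d + 1 ↦ d + 1`, for `d = m + 1`. -/
def cyclicPerm (m : ℕ) : Equiv.Perm (Fin (m + 1 + 1)) :=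
  Fin.cycleRange (Fin.castSucc (Fin.last m))

/-! ### Tratnik's Racah polynomials in `D` variables

The parameters are `β_0, …, β_{D+1}`; the values `β j` for `j > D + 1` are never used. -/

/-- The sequence `x_0 = 0, x_1, …, x_D, x_{D+1} = N`. -/
def padded {D : ℕ} (N : ℕ) (x : Fin D → ℕ) (j : ℕ) : ℕ :=
  if j = 0 then 0 else if h : j - 1 < D then x ⟨j - 1, h⟩ else N

/-- The grid `0 ≤ x_1 ≤ ⋯ ≤ x_D ≤ N`. -/
def racahGrid (D N : ℕ) : Finset (Fin D → ℕ) :=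
  (Fintype.piFinset fun _ => Finset.range (N + 1)).filter fun x => ∀ i j, i ≤ j → x i ≤ x j

/-- The polynomial `(U)_m (V)_m (W)_m ₄F₃(-m, X, Y, Z; U, V, W; 1)` (see `hyp43_eq`). -/
def hyp43 (m : ℕ) (X Y Z U V W : ℝ) : ℝ :=
  ∑ k ∈ Finset.range (m + 1),
    poch (-(m : ℝ)) k * poch X k * poch Y k * poch Z k / (k.factorial : ℝ) *
      (poch (U + k) (m - k) * poch (V + k) (m - k) * poch (W + k) (m - k))

theorem hyp43_eq (m : ℕ) (X Y Z U V W : ℝ) (hU : poch U m ≠ 0) (hV : poch V m ≠ 0)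
    (hW : poch W m ≠ 0) :
    hyp43 m X Y Z U V W = poch U m * poch V m * poch W m *
      ∑ k ∈ Finset.range (m + 1),
        poch (-(m : ℝ)) k * poch X k * poch Y k * poch Z k /
          (poch U k * poch V k * poch W k * (k.factorial : ℝ)) := by
  unfold hyp43
  rw [Finset.mul_sum]
  refine Finset.sum_congr rfl fun k hk => ?_
  have hk' : k + (m - k) = m := Nat.add_sub_cancel' (Nat.lt_succ_iff.mp (Finset.mem_range.mp hk))
  rw [← hk', poch_add] at hU hV hW
  have h : ∀ a : ℝ, poch a m = poch a k * poch (a + k) (m - k) := fun a => by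
    rw [← poch_add, hk']
  rw [h U, h V, h W]
  have h1 := left_ne_zero_of_mul hU
  have h2 := left_ne_zero_of_mul hV
  have h3 := left_ne_zero_of_mul hW
  field_simp

/-- The Racah polynomial `R_ν(x; β, N)`; the factor of index `i` below is the `j`-th factor of the
usual product, `j = i + 1`. -/
def racahPoly (D : ℕ) (β : ℕ → ℝ) (N : ℕ) (ν x : Fin D → ℕ) : ℝ :=
  ∏ i : Fin D,
    hyp43 (ν i)
      (ν i + 2 * ((headSum ν i : ℕ) : ℝ) + β ((i : ℕ) + 2) - β 0 - 1)
      (((headSum ν i : ℕ) : ℝ) - padded N x ((i : ℕ) + 1))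
      (((headSum ν i : ℕ) : ℝ) + β ((i : ℕ) + 1) + padded N x ((i : ℕ) + 1))
      (2 * ((headSum ν i : ℕ) : ℝ) + β ((i : ℕ) + 1) - β 0)
      (((headSum ν i : ℕ) : ℝ) + β ((i : ℕ) + 2) + padded N x ((i : ℕ) + 2))
      (((headSum ν i : ℕ) : ℝ) - padded N x ((i : ℕ) + 2))

/-- The Racah weight `w_R(x; β, N)`, a rational function of `β`, in reduced form, that is with the
common factors of numerator and denominator cancelled. `racahWeight_eq` gives the usual form, which
is of the form `0 / 0` for some parameters at which the function itself is regular. -/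
def racahWeight (D : ℕ) (β : ℕ → ℝ) (N : ℕ) (x : Fin D → ℕ) : ℝ :=
  (∏ j ∈ Finset.range (D + 1),
      poch (β (j + 1) - β j) (padded N x (j + 1) - padded N x j) /
        ((padded N x (j + 1) - padded N x j).factorial : ℝ)) *
    (poch (β (D + 1)) (N + padded N x D) / poch (β 0 + 1) (padded N x 1)) *
    ∏ j ∈ Finset.range D,
      (poch (β (j + 1) + padded N x j + padded N x (j + 1))
            (padded N x (j + 1) - padded N x j) *
          poch (β (j + 1) + 2 * padded N x (j + 1) + 1)
            (padded N x (j + 2) - padded N x (j + 1)))⁻¹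

theorem padded_zero {D : ℕ} (N : ℕ) (x : Fin D → ℕ) : padded N x 0 = 0 := by simp [padded]

theorem padded_last {D : ℕ} (N : ℕ) (x : Fin D → ℕ) : padded N x (D + 1) = N := by simp [padded]

theorem padded_mono {D N : ℕ} {x : Fin D → ℕ} (hx : x ∈ racahGrid D N) (j : ℕ) :
    padded N x j ≤ padded N x (j + 1) := by
  simp only [racahGrid, Finset.mem_filter, Fintype.mem_piFinset, Finset.mem_range] at hx
  rcases j with _ | j
  · simp [padded]
  · simp only [padded, Nat.add_eq_zero_iff, one_ne_zero, and_false, if_false,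
      Nat.add_sub_cancel]
    split_ifs with h1 h2 h2
    · exact hx.2 _ _ (by simp [Fin.le_def])
    · exact Nat.lt_succ_iff.mp (hx.1 _)
    · omega
    · exact le_rfl

theorem poch_half_mul (b : ℝ) (n : ℕ) :
    poch ((b + 2) / 2) n * b = poch (b / 2) n * (b + 2 * n) := by
  have h := poch_succ_left (b / 2) n
  rw [poch_succ_right, show b / 2 + 1 = (b + 2) / 2 by ring] at h
  linarith

theorem racahWeight_factor (b : ℝ) (p q r : ℕ) (hpq : p ≤ q) (hqr : q ≤ r)
    (h1 : poch (b / 2) q ≠ 0) (h2 : poch (b + 1) (r + q) ≠ 0) :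
    poch b (q + p) / poch (b + 1) (r + q) * (poch ((b + 2) / 2) q / poch (b / 2) q) =
      (poch (b + p + q) (q - p) * poch (b + 2 * q + 1) (r - q))⁻¹ := by
  obtain ⟨s, rfl⟩ := Nat.exists_eq_add_of_le hpq
  obtain ⟨t, rfl⟩ := Nat.exists_eq_add_of_le hqr
  simp only [Nat.add_sub_cancel_left]
  rcases Nat.eq_zero_or_pos (p + s) with h0 | hpos
  · obtain ⟨rfl, rfl⟩ : p = 0 ∧ s = 0 := by omega
    simp [poch_zero]
  · have hb : b ≠ 0 := by
      rintro rfl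
      obtain ⟨u, hu⟩ := Nat.exists_eq_succ_of_ne_zero hpos.ne'
      rw [hu, Nat.succ_eq_add_one, poch_succ_left] at h1
      simp at h1
    have e1 : b * poch (b + 1) (p + s + t + (p + s)) =
        poch b (p + s + p) * (poch (b + p + (p + s : ℕ)) s *
          ((b + 2 * (p + s : ℕ)) * poch (b + 2 * (p + s : ℕ) + 1) t)) := by
      rw [← poch_succ_left, ← poch_succ_left,
        show p + s + t + (p + s) + 1 = (p + s + p) + (s + (t + 1)) by ring,
        poch_add b (p + s + p), poch_add _ s (t + 1)]
      have a1 : b + ((p + s + p : ℕ) : ℝ) = b + p + (p + s : ℕ) := by push_cast; ring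
      have a2 : b + ((p + s + p : ℕ) : ℝ) + s = b + 2 * (p + s : ℕ) := by push_cast; ring
      rw [a2, a1]
    have e2 := poch_half_mul b (p + s)
    have hne : poch b (p + s + p) * (poch (b + p + (p + s : ℕ)) s *
          ((b + 2 * (p + s : ℕ)) * poch (b + 2 * (p + s : ℕ) + 1) t)) ≠ 0 := by
      rw [← e1]; exact mul_ne_zero hb h2
    have n1 := right_ne_zero_of_mul hne
    have n2 := left_ne_zero_of_mul n1
    have n3 := right_ne_zero_of_mul (right_ne_zero_of_mul n1)
    rw [div_mul_div_comm, eq_comm, inv_eq_iff_eq_inv, inv_div, eq_div_iff, eq_comm]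
    · apply mul_left_cancel₀ hb
      calc b * (poch (b + 1) (p + s + t + (p + s)) * poch (b / 2) (p + s))
          = (b * poch (b + 1) (p + s + t + (p + s))) * poch (b / 2) (p + s) := by ring
        _ = poch (b + p + (p + s : ℕ)) s * poch (b + 2 * (p + s : ℕ) + 1) t *
              poch b (p + s + p) * (poch (b / 2) (p + s) * (b + 2 * (p + s : ℕ))) := by
            rw [e1]; ring
        _ = _ := by rw [← e2]; ring
    · refine mul_ne_zero (left_ne_zero_of_mul hne) ?_
      intro hz
      rw [hz, zero_mul, eq_comm] at e2
      exact mul_ne_zero h1 (left_ne_zero_of_mul (right_ne_zero_of_mul n1)) e2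

/-- The usual form of the Racah weight, valid as soon as it makes sense. -/
theorem racahWeight_eq (D : ℕ) (β : ℕ → ℝ) (N : ℕ) (x : Fin D → ℕ) (hx : x ∈ racahGrid D N)
    (h1 : ∀ j ∈ Finset.range D, poch (β (j + 1) / 2) (padded N x (j + 1)) ≠ 0)
    (h2 : ∀ j ∈ Finset.range D,
      poch (β (j + 1) + 1) (padded N x (j + 2) + padded N x (j + 1)) ≠ 0) :
    racahWeight D β N x =
      (∏ j ∈ Finset.range (D + 1),
        poch (β (j + 1) - β j) (padded N x (j + 1) - padded N x j) *
            poch (β (j + 1)) (padded N x (j + 1) + padded N x j) /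
          (((padded N x (j + 1) - padded N x j).factorial : ℝ) *
            poch (β j + 1) (padded N x (j + 1) + padded N x j))) *
      ∏ j ∈ Finset.range D,
        poch ((β (j + 1) + 2) / 2) (padded N x (j + 1)) /
          poch (β (j + 1) / 2) (padded N x (j + 1)) := by
  have hR : ∏ j ∈ Finset.range D,
      (poch (β (j + 1) + padded N x j + padded N x (j + 1))
            (padded N x (j + 1) - padded N x j) *
          poch (β (j + 1) + 2 * padded N x (j + 1) + 1)
            (padded N x (j + 2) - padded N x (j + 1)))⁻¹ =
      ∏ j ∈ Finset.range D,
        (poch (β (j + 1)) (padded N x (j + 1) + padded N x j) /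
          poch (β (j + 1) + 1) (padded N x (j + 2) + padded N x (j + 1)) *
          (poch ((β (j + 1) + 2) / 2) (padded N x (j + 1)) /
            poch (β (j + 1) / 2) (padded N x (j + 1)))) :=
    Finset.prod_congr rfl fun j hj =>
      (racahWeight_factor _ _ _ _ (padded_mono hx j) (padded_mono hx (j + 1))
        (h1 j hj) (h2 j hj)).symm
  unfold racahWeight
  have hL : ∏ j ∈ Finset.range (D + 1),
      poch (β (j + 1)) (padded N x (j + 1) + padded N x j) /
        poch (β j + 1) (padded N x (j + 1) + padded N x j) =
      (∏ j ∈ Finset.range (D + 1), poch (β (j + 1)) (padded N x (j + 1) + padded N x j)) /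
        ∏ j ∈ Finset.range (D + 1), poch (β j + 1) (padded N x (j + 1) + padded N x j) :=
    Finset.prod_div_distrib _ _
  rw [hR, Finset.prod_mul_distrib]
  simp only [mul_div_mul_comm]
  rw [Finset.prod_mul_distrib, hL, Finset.prod_div_distrib (fun j =>
      poch (β (j + 1)) (padded N x (j + 1) + padded N x j)),
    Finset.prod_range_succ (fun j => poch (β (j + 1)) (padded N x (j + 1) + padded N x j)),
    Finset.prod_range_succ' (fun j => poch (β j + 1) (padded N x (j + 1) + padded N x j)),
    padded_last, padded_zero]
  simp only [add_zero, zero_add, div_eq_mul_inv, mul_inv]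
  ring

/-- The orthonormal Racah polynomials `R_ν / ‖R_ν‖`, where `‖R_ν‖ > 0` is the norm on the grid for
the weight `w`. -/
def racahHat (D : ℕ) (β : ℕ → ℝ) (N : ℕ) (w : (Fin D → ℕ) → ℝ) (ν x : Fin D → ℕ) : ℝ :=
  racahPoly D β N ν x / √(∑ y ∈ racahGrid D N, w y * racahPoly D β N ν y ^ 2)

/-! ### Parameters, indices and variables attached to the cyclic permutation, `d = m + 1` -/

/-- `β_j = κ_1 + |κ^{d+2-j}| + j` for `0 ≤ j ≤ d`. -/
def betaParam (m : ℕ) (κ : Fin (m + 1 + 1) → ℝ) (j : ℕ) : ℝ :=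
  κ 0 + tailSum κ (m + 1 + 2 - j) + j

/-- `β̃_0 = κ_1` and `β̃_j = -|κ^{j+1}| - 2 n - d + j` for `1 ≤ j ≤ d`. -/
def betaDual (m : ℕ) (κ : Fin (m + 1 + 1) → ℝ) (n j : ℕ) : ℝ :=
  if j = 0 then κ 0 else -tailSum κ (j + 1) - 2 * n - (m + 1 : ℕ) + j

/-- `(μ_d, μ_{d-1}, …, μ_2)`. -/
def revIdx {m : ℕ} (μ : Fin (m + 1) → ℕ) : Fin m → ℕ := fun i => μ (Fin.rev i).succ

/-- `(|ν^d|, |ν^{d-1}|, …, |ν^2|)`. -/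
def revSums {m : ℕ} (ν : Fin (m + 1) → ℕ) : Fin m → ℕ := fun i => tailSum ν (m + 1 - (i : ℕ))

/-- `(ν_1, …, ν_{d-1})`. -/
def initIdx {m : ℕ} (ν : Fin (m + 1) → ℕ) : Fin m → ℕ := fun i => ν i.castSucc

/-- `(|μ_1|, |μ_2|, …, |μ_{d-1}|)`, where `|μ_j| = μ_1 + ⋯ + μ_j`. -/
def initSums {m : ℕ} (μ : Fin (m + 1) → ℕ) : Fin m → ℕ := fun i => headSum μ ((i : ℕ) + 1)

end SimplexJacobi

end

noncomputable section

namespace SimplexJacobi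

open Finset

/-! ### Pochhammer symbols -/

/-! The rotation is reduced to transpositions of adjacent variables. After the second coordinate is
peeled off, rotating `x` means rotating the shorter list with that coordinate deleted, and what
remains is to exchange the first two coordinates. Two consecutive factors of a simplex polynomial
form a Jacobi polynomial on a triangle (`triJac`), so everything rests on the exchange of two
variables there (`triJac_swap`). Conservation of degree leaves a single intermediate index, so the
coefficient for the cycle (`cycCoef`) is a product of transposition coefficients, not a sum.

On the triangle, homogeneous Jacobi polynomials lie in the kernel of the operator obtained by
summing `x_i D_i² + (κ_i + 1) D_i` over the three variables (`triJac_mem_ker`). Up to the factor 4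
this is, with `x_i = y_i²`, the Laplace-type operator summing `∂² + ((2κ_i + 1)/y_i) ∂` in the
variables `y_i`. It treats all variables alike, and a kernel element is determined by its
restriction to `x₁ = 0` (`eq_zero_of_besselOp`). On that edge one Jacobi factor of each product
degenerates to a power. The exchange becomes a change of basis in one variable, the composite of two
explicit triangular matrices, and its entries are ₄F₃ sums (`triCoef`). Restricting to `x₀ = 0`
instead gives a second ₄F₃ for the same coefficient (`triCoef_eq_triDual`). The inversion of the
triangular matrices rests on a telescoping well-poised sum (`sum_inversion`).

Multiplying up, `cycCoef_eq` and `cycCoef_eq_dual` write the coefficient as a sign, a positive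
factor depending on `ν`, a positive factor depending on `μ`, and a product of ₄F₃ factors.
`racahPoly_rev` and `racahPoly_init` identify these two products with the Racah polynomials of (i)
and (ii).

The norm of a Racah polynomial is never evaluated. The inner product is invariant under the rotation
and the simplex polynomials are orthogonal, so the normalized coefficients form an orthogonal matrix
with rows and columns of length one. The Racah weight is, up to a constant, the square of the
positive factor attached to the grid variable (`racahWeight_mul_normSq`, `racahWeight_initSums_eq`),
and length one then forces the normalization (`eq_sqrt_mul_normalized`). For `n ≥ 1` the constant in
(i) equals `(|κ| + d)/(|κ| + d + 2n)`, whence the sign change of the weight when `|κ| + d < 0`. -/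

theorem poch_pos {a : ℝ} (ha : 0 < a) (n : ℕ) : 0 < poch a n := ascPochhammer_pos n a ha

theorem poch_ne_zero {a : ℝ} (ha : 0 < a) (n : ℕ) : poch a n ≠ 0 := (poch_pos ha n).ne'

theorem poch_split (a : ℝ) {k n : ℕ} (h : k ≤ n) :
    poch a n = poch a k * poch (a + k) (n - k) := by
  rw [← poch_add, Nat.add_sub_cancel' h]

theorem poch_neg (a : ℝ) (n : ℕ) : poch (-a) n = (-1) ^ n * poch (a - n + 1) n := by
  induction n generalizing a with
  | zero => simp [poch_zero]
  | succ n ih =>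
    rw [poch_succ_left, poch_succ_right, show -a + 1 = -(a - 1) by ring, ih]
    rw [show a - 1 - (n : ℝ) + 1 = a - ((n + 1 : ℕ) : ℝ) + 1 by push_cast; ring]
    push_cast
    ring

theorem poch_neg_natCast {k n : ℕ} (h : k ≤ n) :
    poch (-(n : ℝ)) k = (-1) ^ k * ((n.factorial : ℝ) / ((n - k).factorial : ℝ)) := by
  induction k with
  | zero => simp [poch_zero, Nat.factorial_ne_zero]
  | succ k ih =>
    rw [poch_succ_right, ih (by omega)]
    obtain ⟨t, rfl⟩ := Nat.exists_eq_add_of_le h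
    rw [show k + 1 + t - k = t + 1 by omega, show k + 1 + t - (k + 1) = t by omega,
      Nat.factorial_succ t]
    have := Nat.factorial_ne_zero t
    push_cast
    field_simp
    ring

theorem poch_neg_natCast_eq_zero {k n : ℕ} (h : n < k) : poch (-(n : ℝ)) k = 0 := by
  rw [poch_split _ h, poch_succ_right]
  simp

theorem Gamma_add_natCast {a : ℝ} (ha : 0 < a) (n : ℕ) :
    Real.Gamma (a + n) = poch a n * Real.Gamma a := by
  induction n with
  | zero => simp [poch_zero]
  | succ n ih =>
    rw [Nat.cast_succ, ← add_assoc, Real.Gamma_add_one (by positivity), ih, poch_succ_right]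
    ring

/-- The Chu–Vandermonde identity. -/
theorem chu_vandermonde (n : ℕ) (b c : ℝ) :
    ∑ k ∈ range (n + 1), (n.choose k : ℝ) * ((-1) ^ k * poch b k * poch (c + k) (n - k)) =
      poch (c - b) n := by
  induction n generalizing b c with
  | zero => simp [poch_zero]
  | succ n ih =>
    have h : poch (c - b) (n + 1) = (c + n) * poch (c - b) n - b * poch ((c + 1) - (b + 1)) n := by
      rw [poch_succ_right]; ring_nf
    rw [h, ← ih b c, ← ih (b + 1) (c + 1),
      sum_choose_succ_mul (fun i j => (-1) ^ i * poch b i * poch (c + i) j), mul_sum, mul_sum,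
      sub_eq_add_neg, ← sum_neg_distrib]
    congr 1
    · refine sum_congr rfl fun k hk => ?_
      have hk' : k ≤ n := Nat.lt_succ_iff.mp (mem_range.mp hk)
      rw [Nat.succ_sub hk', Nat.succ_eq_add_one, poch_succ_right, Nat.cast_sub hk']
      ring
    · refine sum_congr rfl fun k _ => ?_
      rw [poch_succ_left b, Nat.cast_succ, pow_succ, show c + ((k : ℝ) + 1) = c + 1 + k by ring]
      ring

/-- Up to sign and binomial coefficient the summand is `(A + 2r)/(A + r)_{N+2}`, with the factor `A
+ 2r` cancelled so that the term `r = 0` stays meaningful at `A = 0`. Such a sum telescopes; the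
closed form of all partial sums is what makes the induction run. -/
theorem sum_wellPoised_partial {A : ℝ} (hA : -1 < A) (N M : ℕ) (hM : M ≤ N + 1) :
    ∑ r ∈ range (M + 1), (-1) ^ r * ((N + 1).choose r : ℝ) *
        (poch (A + r) r * poch (A + 2 * r + 1) (N + 1 - r))⁻¹ =
      (-1) ^ M * (N.choose M : ℝ) / poch (A + M + 1) (N + 1) := by
  induction M with
  | zero => simp [poch_zero]
  | succ M ih =>
    rw [sum_range_succ, ih (by omega)]
    have hM' : (0 : ℝ) ≤ M := Nat.cast_nonneg M
    -- Three factorizations of `(A + M + 1)_{N+2}`, the common denominator of the old partial sum,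
    -- the new term and the new partial sum. After clearing it only the binomial recursion `c1` is
    -- left.
    have e1 : poch (A + M + 1) (N + 2) =
        poch (A + M + 1) (M + 1) * ((A + 2 * M + 2) * poch (A + 2 * M + 3) (N - M)) := by
      rw [show N + 2 = (M + 1) + ((N - M) + 1) by omega, poch_add,
        poch_succ_left (A + M + 1 + (M + 1 : ℕ))]
      push_cast; ring_nf
    have e2 : poch (A + M + 1) (N + 2) = poch (A + M + 1) (N + 1) * (A + M + N + 2) := by
      rw [poch_succ_right]; push_cast; ring
    have e3 : poch (A + M + 1) (N + 2) = (A + M + 1) * poch (A + M + 2) (N + 1) := by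
      rw [poch_succ_left]; ring_nf
    have n1 : poch (A + M + 1) (M + 1) ≠ 0 := poch_ne_zero (by linarith) _
    have n2 : poch (A + 2 * M + 3) (N - M) ≠ 0 := poch_ne_zero (by linarith) _
    have n3 : poch (A + M + 1) (N + 1) ≠ 0 := poch_ne_zero (by linarith) _
    have n4 : poch (A + M + 2) (N + 1) ≠ 0 := poch_ne_zero (by linarith) _
    have n5 : A + 2 * M + 2 ≠ 0 := by linarith
    have n6 : A + M + 1 ≠ 0 := by linarith
    have n7 : A + M + N + 2 ≠ 0 := by have : (0 : ℝ) ≤ N := Nat.cast_nonneg N; linarith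
    set Q := poch (A + M + 1) (N + 2) with hQ
    have nQ : Q ≠ 0 := by rw [e3]; exact mul_ne_zero n6 n4
    have c1 : ((M : ℝ) + 1) * (N.choose (M + 1) : ℝ) = (N - M) * (N.choose M : ℝ) := by
      have := Nat.choose_succ_right_eq N M
      rcases Nat.lt_or_ge N M with h | h
      · rw [Nat.choose_eq_zero_of_lt h, Nat.choose_eq_zero_of_lt (by omega)]; simp
      · have h' : ((N.choose (M + 1) * (M + 1) : ℕ) : ℝ) = ((N.choose M * (N - M) : ℕ) : ℝ) := by
          rw [this]
        rw [Nat.cast_mul, Nat.cast_mul, Nat.cast_sub h] at h'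
        push_cast at h'
        linarith
    have t1 : (poch (A + (M + 1 : ℕ)) (M + 1) *
        poch (A + 2 * (M + 1 : ℕ) + 1) (N + 1 - (M + 1)))⁻¹ = (A + 2 * M + 2) / Q := by
      rw [e1, show N + 1 - (M + 1) = N - M by omega,
        show A + ((M + 1 : ℕ) : ℝ) = A + M + 1 by push_cast; ring,
        show A + 2 * ((M + 1 : ℕ) : ℝ) + 1 = A + 2 * M + 3 by push_cast; ring,
        inv_eq_one_div, div_eq_div_iff (mul_ne_zero n1 n2) (mul_ne_zero n1 (mul_ne_zero n5 n2))]
      ring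
    have t2 : (poch (A + M + 1) (N + 1))⁻¹ = (A + M + N + 2) / Q := by
      rw [e2]; field_simp
    have t3 : (poch (A + (M + 1 : ℕ) + 1) (N + 1))⁻¹ = (A + M + 1) / Q := by
      rw [e3, show A + ((M + 1 : ℕ) : ℝ) + 1 = A + M + 2 by push_cast; ring]; field_simp
    rw [div_eq_mul_inv, div_eq_mul_inv, t1, t2, t3, Nat.choose_succ_succ, pow_succ]
    field_simp
    push_cast
    linear_combination -c1

theorem sum_wellPoised {A : ℝ} (hA : -1 < A) (N : ℕ) :
    ∑ r ∈ range (N + 1), (-1) ^ r * (N.choose r : ℝ) *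
        (poch (A + r) r * poch (A + 2 * r + 1) (N - r))⁻¹ = if N = 0 then 1 else 0 := by
  rcases N with _ | N
  · simp [poch_zero]
  -- The full sum is the partial sum with `M = N + 1`, whose closed form contains the vanishing
  -- binomial coefficient of `N` over `N + 1`.
  · rw [sum_wellPoised_partial hA N (N + 1) le_rfl]
    simp

/-- The orthogonality relation behind the inversion formulas for Jacobi polynomials. -/
theorem sum_inversion {A : ℝ} (hA : -1 < A) {i k n : ℕ} (hi : i ≤ n) :
    ∑ q ∈ range (n + 1), (-1) ^ q * ((i.choose q : ℝ) * (q.choose k : ℝ)) *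
        (poch (A + q) k / (poch (A + q) q * poch (A + 2 * q + 1) (i - q))) =
      if i = k then (-1) ^ k else 0 := by
  rcases Nat.lt_or_ge i k with h | h
  · rw [if_neg h.ne]
    refine sum_eq_zero fun q _ => ?_
    rcases Nat.lt_or_ge i q with h' | h'
    · simp [Nat.choose_eq_zero_of_lt h']
    · simp [Nat.choose_eq_zero_of_lt (h'.trans_lt h)]
  obtain ⟨N, rfl⟩ := Nat.exists_eq_add_of_le h
  -- With `q = k + r` and `i = k + N` the two binomials recombine, and the sum becomes the
  -- well-poised one with `A` replaced by `A + 2k`.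
  have hA' : -1 < A + 2 * k := by
    have : (0 : ℝ) ≤ k := Nat.cast_nonneg k
    linarith
  have key := sum_wellPoised hA' N
  have hs : ∀ q ∈ range (n + 1), q ∉ (range (N + 1)).map (addLeftEmbedding k) →
      (-1 : ℝ) ^ q * (((k + N).choose q : ℝ) * (q.choose k : ℝ)) *
        (poch (A + q) k / (poch (A + q) q * poch (A + 2 * q + 1) (k + N - q))) = 0 := by
    intro q _ hq
    have : q < k ∨ k + N < q := by
      by_contra! hcon
      exact hq (mem_map.mpr ⟨q - k, mem_range.mpr (by omega), by
        simp only [addLeftEmbedding_apply]; omega⟩)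
    rcases this with h' | h' <;> simp [Nat.choose_eq_zero_of_lt h']
  rw [← sum_subset (s₁ := (range (N + 1)).map (addLeftEmbedding k)) _ hs, sum_map]
  · have h2 : (if k + N = k then (-1 : ℝ) ^ k else 0) =
        (-1) ^ k * ((k + N).choose k : ℝ) * if N = 0 then 1 else 0 := by
      rcases Nat.eq_zero_or_pos N with rfl | h0
      · simp
      · rw [if_neg (by omega), if_neg (by omega), mul_zero]
    rw [h2, ← key, mul_sum]
    refine sum_congr rfl fun r hr => ?_
    have hr' : r ≤ N := Nat.lt_succ_iff.mp (mem_range.mp hr)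
    simp only [addLeftEmbedding_apply]
    have c : ((k + N).choose (k + r) : ℝ) * ((k + r).choose k : ℝ) =
        ((k + N).choose k : ℝ) * (N.choose r : ℝ) := by
      have := Nat.choose_mul (n := k + N) (k := k + r) (s := k) (by omega)
      rw [Nat.add_sub_cancel_left, Nat.add_sub_cancel_left] at this
      exact_mod_cast this
    have p1 : poch (A + (k + r : ℕ)) (k + r) =
        poch (A + (k + r : ℕ)) k * poch (A + 2 * k + r) r := by
      rw [poch_add]; push_cast; ring_nf
    rw [c, p1, show k + N - (k + r) = N - r by omega, pow_add,
      show A + 2 * ((k + r : ℕ) : ℝ) + 1 = A + 2 * k + 2 * r + 1 by push_cast; ring]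
    have hne : poch (A + (k + r : ℕ)) k ≠ 0 := by
      rcases Nat.eq_zero_or_pos k with rfl | hk
      · simp [poch_zero]
      · have h1 : (1 : ℝ) ≤ k := by exact_mod_cast hk
        have h2 : (0 : ℝ) ≤ r := Nat.cast_nonneg r
        exact poch_ne_zero (by push_cast; linarith) _
    rw [mul_assoc (poch (A + (k + r : ℕ)) k), mul_comm (poch (A + (k + r : ℕ)) k),
      div_mul_cancel_right₀ hne]
    ring
  · intro q hq
    obtain ⟨r, hr, rfl⟩ := mem_map.mp hq
    rw [mem_range] at hr ⊢
    simp only [addLeftEmbedding_apply]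
    omega

end SimplexJacobi

end

noncomputable section

namespace SimplexJacobi

open Finset

/-! ### Jacobi polynomials as homogeneous polynomials over an algebra -/

/-- The coefficients of the homogeneous Jacobi polynomial `jac`. -/
def jacCoef (n : ℕ) (a b : ℝ) (k : ℕ) : ℝ :=
  (-1) ^ k * (poch (a + 1 + k) (n - k) * poch (n + a + b + 1) k) /
    ((n - k).factorial * k.factorial)

/-- The homogeneous Jacobi polynomial of degree `n` in `s` and `y = s - t`. -/
def jac {R : Type*} [CommRing R] [Algebra ℝ R] (n : ℕ) (a b : ℝ) (s y : R) : R :=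
  ∑ k ∈ range (n + 1), jacCoef n a b k • (y ^ k * s ^ (n - k))

/-- In `jac` the quotient `(a+1)_n / (a+1)_k` is already carried out, which is legitimate because `a
> -1` keeps `(a+1)_k` away from zero. -/
theorem jacobiHom_eq_jac (n : ℕ) {a : ℝ} (ha : -1 < a) (b s t : ℝ) :
    jacobiHom n a b s t = jac n a b s (s - t) := by
  unfold jacobiHom jac jacCoef
  rw [mul_sum]
  refine sum_congr rfl fun k hk => ?_
  have hk' : k ≤ n := Nat.lt_succ_iff.mp (mem_range.mp hk)
  rw [poch_neg_natCast hk', poch_split (a + 1) hk', smul_eq_mul]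
  have h1 : poch (a + 1) k ≠ 0 := poch_ne_zero (by linarith) k
  have h2 := Nat.factorial_ne_zero n
  have h3 := Nat.factorial_ne_zero k
  have h4 := Nat.factorial_ne_zero (n - k)
  field_simp

theorem map_jac {R R' : Type*} [CommRing R] [Algebra ℝ R] [CommRing R'] [Algebra ℝ R']
    (φ : R →ₐ[ℝ] R') (n : ℕ) (a b : ℝ) (s y : R) :
    φ (jac n a b s y) = jac n a b (φ s) (φ y) := by
  simp [jac, map_sum]

/-- This is the value of the Jacobi polynomial at the endpoint `-1`, an instance of Chu–Vandermonde.
-/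
theorem sum_jacCoef (n : ℕ) (a b : ℝ) :
    ∑ k ∈ range (n + 1), jacCoef n a b k = (-1) ^ n * poch (b + 1) n / n.factorial := by
  have h := chu_vandermonde n (n + a + b + 1) (a + 1)
  rw [show a + 1 - (n + a + b + 1) = -(b + n) by ring, poch_neg,
    show b + n - n + 1 = b + 1 by ring] at h
  rw [← h, sum_div]
  refine sum_congr rfl fun k hk => ?_
  have hk' : k ≤ n := Nat.lt_succ_iff.mp (mem_range.mp hk)
  rw [jacCoef, Nat.cast_choose ℝ hk']
  have h2 := Nat.factorial_ne_zero n
  have h3 := Nat.factorial_ne_zero k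
  have h4 := Nat.factorial_ne_zero (n - k)
  field_simp

section

variable {R : Type*} [CommRing R] [Algebra ℝ R]

/-- On an edge of the triangle one of the two Jacobi factors collapses to this multiple of a power.
-/
theorem jac_self (n : ℕ) (a b : ℝ) (s : R) :
    jac n a b s s = ((-1) ^ n * poch (b + 1) n / n.factorial : ℝ) • s ^ n := by
  rw [← sum_jacCoef n a b, sum_smul]
  refine sum_congr rfl fun k hk => ?_
  rw [← pow_add, Nat.add_sub_cancel' (Nat.lt_succ_iff.mp (mem_range.mp hk))]

/-- The binomial coefficient vanishes for `i < q`, so the sum may run over all `i ≤ n`: the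
transition matrix to the monomials is triangular and in the shape inverted by `sum_inversion`. -/
theorem pow_mul_jac_left {n q : ℕ} (hq : q ≤ n) (A κ : ℝ) (s w : R) :
    w ^ q * jac (n - q) (A + 2 * q) κ s w = ∑ i ∈ range (n + 1),
      ((i.choose q : ℝ) * ((-1) ^ (i + q) * (q.factorial / (i.factorial * (n - i).factorial)) *
        (poch (A + q + i + 1) (n - i) * poch (n + q + (A + κ + 1)) (i - q)))) •
        (w ^ i * s ^ (n - i)) := by
  rw [jac, mul_sum]
  rw [← sum_subset (s₁ := (range (n - q + 1)).map (addLeftEmbedding q)) (s₂ := range (n + 1))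
    ?_ ?_, sum_map]
  · refine sum_congr rfl fun j hj => ?_
    have hj' : q + j ≤ n := by rw [mem_range] at hj; omega
    obtain ⟨t, rfl⟩ := Nat.exists_eq_add_of_le hj'
    simp only [addLeftEmbedding_apply]
    rw [mul_smul_comm, ← mul_assoc, ← pow_add, jacCoef, show q + j + t - q = j + t by omega,
      show j + t - j = t by omega, show q + j + t - (q + j) = t by omega,
      show q + j - q = j by omega, Nat.cast_add_choose]
    congr 1
    have h2 := Nat.factorial_ne_zero q
    have h3 := Nat.factorial_ne_zero j
    have h4 := Nat.factorial_ne_zero t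
    have h5 := Nat.factorial_ne_zero (q + j)
    have e1 : A + 2 * (q : ℝ) + 1 + j = A + q + (q + j : ℕ) + 1 := by push_cast; ring
    have e2 : ((j + t : ℕ) : ℝ) + (A + 2 * q) + κ + 1 = (q + j + t : ℕ) + q + (A + κ + 1) := by
      push_cast; ring
    have e3 : (-1 : ℝ) ^ (q + j + q) = (-1) ^ j := by
      rw [show q + j + q = j + 2 * q by ring, pow_add, pow_mul]; simp
    rw [e1, e2, e3]
    field_simp
  · intro i hi
    obtain ⟨r, hr, rfl⟩ := mem_map.mp hi
    rw [mem_range] at hr ⊢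
    simp only [addLeftEmbedding_apply]
    omega
  · intro i hi hi'
    have : i < q := by
      by_contra! hcon
      rw [mem_range] at hi
      exact hi' (mem_map.mpr ⟨i - q, mem_range.mpr (by omega), by
        simp only [addLeftEmbedding_apply]; omega⟩)
    simp [Nat.choose_eq_zero_of_lt this]

/-- The coefficients in `pow_mul_pow_eq_sum_left`. -/
def invLeft (n : ℕ) (A κ : ℝ) (k q : ℕ) : ℝ :=
  (q.choose k : ℝ) * (k.factorial * (n - k).factorial / q.factorial *
    (poch (n + (A + κ + 1) + k) (q - k) * poch (A + q) k /
      (poch (A + q) q * poch (A + 2 * q + 1) (n - q))))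

/-- Composing both triangular matrices, the factors depending on `i` and `k` alone come out of the
sum, and the remaining sum over `q` is `sum_inversion`. -/
theorem pow_mul_pow_eq_sum_left {n k : ℕ} (hk : k ≤ n) {A : ℝ} (hA : -1 < A) (κ : ℝ) (s w : R) :
    w ^ k * s ^ (n - k) = ∑ q ∈ range (n + 1),
      invLeft n A κ k q • (w ^ q * jac (n - q) (A + 2 * q) κ s w) := by
  have h : ∀ q ∈ range (n + 1), invLeft n A κ k q • (w ^ q * jac (n - q) (A + 2 * q) κ s w) =
      ∑ i ∈ range (n + 1), ((k.factorial * (n - k).factorial / (i.factorial * (n - i).factorial) *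
        poch (n + (A + κ + 1) + k) (i - k) * (-1) ^ i) * ((-1) ^ q *
          ((i.choose q : ℝ) * (q.choose k : ℝ)) *
          (poch (A + q) k / (poch (A + q) q * poch (A + 2 * q + 1) (i - q))))) •
        (w ^ i * s ^ (n - i)) := by
    intro q hq
    have hq' : q ≤ n := Nat.lt_succ_iff.mp (mem_range.mp hq)
    rw [pow_mul_jac_left hq', smul_sum]
    refine sum_congr rfl fun i hi => ?_
    have hi' : i ≤ n := Nat.lt_succ_iff.mp (mem_range.mp hi)
    rw [smul_smul]
    congr 1
    unfold invLeft
    rcases Nat.lt_or_ge i q with h1 | h1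
    · simp [Nat.choose_eq_zero_of_lt h1]
    rcases Nat.lt_or_ge q k with h2 | h2
    · simp [Nat.choose_eq_zero_of_lt h2]
    have e1 : poch (n + (A + κ + 1) + k) (i - k) =
        poch (n + (A + κ + 1) + k) (q - k) * poch (n + q + (A + κ + 1)) (i - q) := by
      rw [show i - k = (q - k) + (i - q) by omega, poch_add, Nat.cast_sub h2]
      ring_nf
    have e2 : poch (A + 2 * q + 1) (n - q) =
        poch (A + 2 * q + 1) (i - q) * poch (A + q + i + 1) (n - i) := by
      rw [show n - q = (i - q) + (n - i) by omega, poch_add, Nat.cast_sub h1]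
      ring_nf
    have n0 : poch (A + q + i + 1) (n - i) ≠ 0 ∨ n - i = 0 := by
      rcases Nat.eq_zero_or_pos (n - i) with h3 | h3
      · exact Or.inr h3
      · left
        have : (0 : ℝ) ≤ q := Nat.cast_nonneg q
        have : (0 : ℝ) ≤ i := Nat.cast_nonneg i
        exact poch_ne_zero (by linarith) _
    have n1 : poch (A + q + i + 1) (n - i) ≠ 0 := by
      rcases n0 with h | h
      · exact h
      · rw [h, poch_zero]; exact one_ne_zero
    have f1 := Nat.factorial_ne_zero q
    have f2 := Nat.factorial_ne_zero i
    have f3 := Nat.factorial_ne_zero (n - i)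
    rw [e1, e2, pow_add]
    rw [show poch (A + q) q * (poch (A + 2 * q + 1) (i - q) * poch (A + q + i + 1) (n - i)) =
      (poch (A + q) q * poch (A + 2 * q + 1) (i - q)) * poch (A + q + i + 1) (n - i) by ring]
    generalize poch (A + q) q * poch (A + 2 * q + 1) (i - q) = D
    rw [← div_div _ D]
    field_simp
  rw [sum_congr rfl h, sum_comm, sum_eq_single k]
  · rw [← sum_smul, ← mul_sum, sum_inversion hA hk, if_pos rfl, Nat.sub_self, poch_zero]
    have f1 := Nat.factorial_ne_zero k
    have f2 := Nat.factorial_ne_zero (n - k)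
    rw [div_self (by positivity), one_mul, one_mul, ← mul_pow]
    simp
  · intro i hi hik
    rw [← sum_smul, ← mul_sum, sum_inversion hA (Nat.lt_succ_iff.mp (mem_range.mp hi)),
      if_neg hik, mul_zero, zero_smul]
  · intro hk'
    exact absurd (mem_range.mpr (Nat.lt_succ_of_le hk)) hk'

theorem pow_mul_jac_right {n q : ℕ} (hq : q ≤ n) (α κ : ℝ) (s w : R) :
    s ^ (n - q) * jac q α κ s w = ∑ k ∈ range (n + 1),
      ((q.choose k : ℝ) * ((-1) ^ k * (poch (α + 1 + k) (q - k) * poch (q + α + κ + 1) k) /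
        q.factorial)) • (w ^ k * s ^ (n - k)) := by
  rw [jac, mul_sum]
  rw [← sum_subset (s₁ := range (q + 1)) (s₂ := range (n + 1))
    (by intro x; simp only [mem_range]; omega) ?_]
  · refine sum_congr rfl fun k hk => ?_
    have hk' : k ≤ q := Nat.lt_succ_iff.mp (mem_range.mp hk)
    rw [mul_smul_comm, mul_left_comm, ← pow_add, show n - q + (q - k) = n - k by omega, jacCoef,
      Nat.cast_choose ℝ hk']
    congr 1
    have h2 := Nat.factorial_ne_zero q
    have h3 := Nat.factorial_ne_zero k
    have h4 := Nat.factorial_ne_zero (q - k)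
    field_simp
  · intro k _ hk
    rw [Nat.choose_eq_zero_of_lt (by rw [mem_range] at hk; omega)]
    simp

/-- The coefficients in `pow_mul_pow_eq_sum_right`. -/
def invRight (α κ : ℝ) (i q : ℕ) : ℝ :=
  (i.choose q : ℝ) * ((-1) ^ q * q.factorial * (poch (α + 1 + q) (i - q) /
    (poch (α + κ + 1 + q) q * poch (α + κ + 1 + 2 * q + 1) (i - q))))

/-- The same inversion with the roles of row and column index exchanged and `A = α + κ + 1`. -/
theorem pow_mul_pow_eq_sum_right {n i : ℕ} (hi : i ≤ n) {α κ : ℝ} (hA : -1 < α + κ + 1)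
    (s w : R) :
    w ^ i * s ^ (n - i) = ∑ q ∈ range (n + 1),
      invRight α κ i q • (s ^ (n - q) * jac q α κ s w) := by
  have h : ∀ q ∈ range (n + 1), invRight α κ i q • (s ^ (n - q) * jac q α κ s w) =
      ∑ k ∈ range (n + 1), ((poch (α + 1 + k) (i - k) * (-1) ^ k) * ((-1) ^ q *
          ((i.choose q : ℝ) * (q.choose k : ℝ)) *
          (poch (α + κ + 1 + q) k /
            (poch (α + κ + 1 + q) q * poch (α + κ + 1 + 2 * q + 1) (i - q))))) •
        (w ^ k * s ^ (n - k)) := by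
    intro q hq
    have hq' : q ≤ n := Nat.lt_succ_iff.mp (mem_range.mp hq)
    rw [pow_mul_jac_right hq', smul_sum]
    refine sum_congr rfl fun k hk => ?_
    rw [smul_smul]
    congr 1
    unfold invRight
    rcases Nat.lt_or_ge i q with h1 | h1
    · simp [Nat.choose_eq_zero_of_lt h1]
    rcases Nat.lt_or_ge q k with h2 | h2
    · simp [Nat.choose_eq_zero_of_lt h2]
    have e1 : poch (α + 1 + k) (i - k) =
        poch (α + 1 + k) (q - k) * poch (α + 1 + q) (i - q) := by
      rw [show i - k = (q - k) + (i - q) by omega, poch_add, Nat.cast_sub h2]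
      ring_nf
    have f1 := Nat.factorial_ne_zero q
    rw [e1, show (q : ℝ) + α + κ + 1 = α + κ + 1 + q by ring]
    field_simp
  rw [sum_congr rfl h, sum_comm, sum_eq_single i]
  · rw [← sum_smul, ← mul_sum, sum_inversion hA hi, if_pos rfl, Nat.sub_self, poch_zero,
      one_mul, ← mul_pow]
    simp
  · intro k _ hik
    rw [← sum_smul, ← mul_sum, sum_inversion hA hi, if_neg (Ne.symm hik), mul_zero, zero_smul]
  · intro hk'
    exact absurd (mem_range.mpr (Nat.lt_succ_of_le hi)) hk'

end

end SimplexJacobi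

end

noncomputable section

namespace SimplexJacobi

open Finset

/-! ### The differential operator whose kernel contains the Jacobi polynomials on the triangle -/

/-- The factor `k` makes the truncated exponent `k - 1` harmless at `k = 0`. With these identities
the derivative computations below become polynomial identities. -/
theorem mul_pow_pred {R : Type*} [CommRing R] (k : ℕ) (t : R) : (k : R) * t ^ (k - 1) * t = k * t ^ k := by
  rcases k with _ | k
  · simp
  · rw [Nat.add_sub_cancel, pow_succ]; ring

theorem mul_pow_pred_pred {R : Type*} [CommRing R] (k : ℕ) (t : R) :
    (k : R) * ((k - 1 : ℕ) : R) * t ^ (k - 1 - 1) * t = k * (k - 1) * t ^ (k - 1) := by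
  rcases k with _ | k
  · simp
  · have h := mul_pow_pred k t
    rw [Nat.add_sub_cancel]
    push_cast
    linear_combination ((k : R) + 1) * h

section

variable {R : Type*} [CommRing R] [Algebra ℝ R]

/-- The operator `x D² + c D`. -/
def besselOp (D : Derivation ℝ R R) (x : R) (c : ℝ) (f : R) : R := x * D (D f) + c • D f

theorem besselOp_smul (D : Derivation ℝ R R) (x : R) (c r : ℝ) (f : R) :
    besselOp D x c (r • f) = r • besselOp D x c f := by
  simp only [besselOp, Derivation.map_smul, smul_add, mul_smul_comm]
  rw [smul_comm]

theorem besselOp_sum {ι : Type*} (D : Derivation ℝ R R) (x : R) (c : ℝ) (s : Finset ι)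
    (f : ι → R) : besselOp D x c (∑ i ∈ s, f i) = ∑ i ∈ s, besselOp D x c (f i) := by
  simp only [besselOp, map_sum, smul_sum, mul_sum, sum_add_distrib]

theorem derivation_pow (D : Derivation ℝ R R) (f : R) (n : ℕ) :
    D (f ^ n) = n * f ^ (n - 1) * D f := by
  rw [D.leibniz_pow, nsmul_eq_mul, smul_eq_mul, mul_assoc]

theorem derivation_mul (D : Derivation ℝ R R) (f g : R) : D (f * g) = f * D g + g * D f := by
  rw [D.leibniz, smul_eq_mul, smul_eq_mul]

/-- The operator lowers the degree by one and sends each product of powers to two neighbouring ones.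
This is why a two-term recursion for the coefficients describes the kernel. -/
theorem besselOp_pow_mul_pow (D₁ D₂ : Derivation ℝ R R) (x₁ x₂ : R) (h11 : D₁ x₁ = 1)
    (h12 : D₁ x₂ = 0) (h21 : D₂ x₁ = 0) (h22 : D₂ x₂ = 1) (c₁ c₂ : ℝ) (k m : ℕ) :
    besselOp D₁ x₁ c₁ (x₂ ^ k * (x₁ + x₂) ^ m) + besselOp D₂ x₂ c₂ (x₂ ^ k * (x₁ + x₂) ^ m) =
      ((k : ℝ) * (k - 1 + c₂)) • (x₂ ^ (k - 1) * (x₁ + x₂) ^ m) +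
        ((m : ℝ) * (m - 1 + 2 * k + c₁ + c₂)) • (x₂ ^ k * (x₁ + x₂) ^ (m - 1)) := by
  have a1 := mul_pow_pred k x₂
  have a2 := mul_pow_pred_pred k x₂
  have b2 := mul_pow_pred_pred m (x₁ + x₂)
  simp only [besselOp, derivation_mul, derivation_pow, map_add, map_zero, map_one, h11, h12, h21,
    h22, Derivation.map_natCast, Derivation.map_one_eq_zero, Algebra.smul_def, map_add, map_mul,
    map_natCast, map_sub, map_one, map_ofNat]
  linear_combination (x₁ + x₂) ^ m * a2 + x₂ ^ k * b2 +
    2 * m * (x₁ + x₂) ^ (m - 1) * a1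

/-- Separation of variables: a factor `g` that is homogeneous of degree `q` and annihilated in `x₁,
x₂` only shifts the parameter `c₁ + c₂` by `2q`. The inner Jacobi factor of `triJac` plays the role
of `g`. -/
theorem besselOp_pow_mul_pow_mul (D₀ D₁ D₂ : Derivation ℝ R R) (x₀ x₁ x₂ : R) (h00 : D₀ x₀ = 1)
    (h01 : D₀ x₁ = 0) (h02 : D₀ x₂ = 0) (h10 : D₁ x₀ = 0) (h11 : D₁ x₁ = 1)
    (h12 : D₁ x₂ = 0) (h20 : D₂ x₀ = 0) (h21 : D₂ x₁ = 0) (h22 : D₂ x₂ = 1) (c₀ c₁ c₂ : ℝ)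
    (k m q : ℕ) (g : R) (hg0 : D₀ g = 0) (hE : x₁ * D₁ g + x₂ * D₂ g = q * g)
    (hL : besselOp D₁ x₁ c₁ g + besselOp D₂ x₂ c₂ g = 0) :
    besselOp D₀ x₀ c₀ ((x₁ + x₂) ^ k * (x₀ + x₁ + x₂) ^ m * g) +
      besselOp D₁ x₁ c₁ ((x₁ + x₂) ^ k * (x₀ + x₁ + x₂) ^ m * g) +
      besselOp D₂ x₂ c₂ ((x₁ + x₂) ^ k * (x₀ + x₁ + x₂) ^ m * g) =
      ((k : ℝ) * (k - 1 + c₁ + c₂ + 2 * q)) •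
          ((x₁ + x₂) ^ (k - 1) * (x₀ + x₁ + x₂) ^ m * g) +
        ((m : ℝ) * (m - 1 + 2 * k + 2 * q + c₀ + c₁ + c₂)) •
          ((x₁ + x₂) ^ k * (x₀ + x₁ + x₂) ^ (m - 1) * g) := by
  have a1 := mul_pow_pred k (x₁ + x₂)
  have a2 := mul_pow_pred_pred k (x₁ + x₂)
  have b2 := mul_pow_pred_pred m (x₀ + x₁ + x₂)
  simp only [besselOp, Algebra.smul_def] at hL
  simp only [besselOp, derivation_mul, derivation_pow, map_add, map_zero, map_one, h00, h01, h02,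
    h10, h11, h12, h20, h21, h22, hg0, Derivation.map_natCast, Derivation.map_one_eq_zero,
    Algebra.smul_def, map_mul, map_natCast, map_sub, map_ofNat]
  linear_combination (x₀ + x₁ + x₂) ^ m * g * a2 + (x₁ + x₂) ^ k * g * b2 +
    2 * m * (x₀ + x₁ + x₂) ^ (m - 1) * g * a1 + (x₁ + x₂) ^ k * (x₀ + x₁ + x₂) ^ m * hL +
    (2 * k * (x₁ + x₂) ^ (k - 1) * (x₀ + x₁ + x₂) ^ m +
      2 * m * (x₁ + x₂) ^ k * (x₀ + x₁ + x₂) ^ (m - 1)) * hE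

theorem jacCoef_succ {n k : ℕ} (hk : k < n) (a b : ℝ) :
    jacCoef n a b (k + 1) * (((k : ℝ) + 1) * (k + 1 + a)) =
      -(jacCoef n a b k * (((n : ℝ) - k) * (n + k + a + b + 1))) := by
  obtain ⟨t, rfl⟩ := Nat.exists_eq_add_of_lt hk
  unfold jacCoef
  rw [show k + t + 1 - (k + 1) = t by omega, show k + t + 1 - k = t + 1 by omega, poch_succ_right,
    poch_succ_left (a + 1 + k), Nat.factorial_succ, Nat.factorial_succ]
  have h1 := Nat.factorial_ne_zero k
  have h2 := Nat.factorial_ne_zero t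
  have e : a + 1 + (k : ℝ) + 1 = a + 1 + (k + 1 : ℕ) := by push_cast; ring
  rw [e]
  push_cast
  field_simp
  ring

/-- The two-term recursion of the coefficients makes the sum telescope. -/
theorem sum_jacCoef_telescope (n : ℕ) (a b : ℝ) (S T : ℕ → R) (hST : ∀ k, k < n →
    S k = T (k + 1)) :
    ∑ k ∈ range (n + 1), jacCoef n a b k • (((k : ℝ) * (k + a)) • T k +
      (((n : ℝ) - k) * (n + k + a + b + 1)) • S k) = 0 := by
  simp only [smul_add, smul_smul, sum_add_distrib]
  rw [sum_range_succ', sum_range_succ (fun k => (jacCoef n a b k *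
    (((n : ℝ) - k) * (n + k + a + b + 1))) • S k)]
  simp only [Nat.cast_zero, zero_mul, mul_zero, zero_smul, add_zero, sub_self]
  rw [← sum_add_distrib]
  refine sum_eq_zero fun k hk => ?_
  have hk' := mem_range.mp hk
  rw [hST k hk', ← add_smul]
  have := jacCoef_succ hk' a b
  push_cast
  rw [this, neg_add_cancel, zero_smul]

/-- The product of two homogeneous Jacobi polynomials which is a Jacobi polynomial on the
triangle with barycentric coordinates `x₀, x₁, x₂`. -/
def triJac (κ₀ κ₁ α : ℝ) (p q : ℕ) (x₀ x₁ x₂ : R) : R :=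
  jac p (α + κ₁ + 2 * q + 1) κ₀ (x₀ + x₁ + x₂) (x₁ + x₂) * jac q α κ₁ (x₁ + x₂) x₂

/-- The Jacobi coefficients solve exactly the recursion under which the images of the summands
telescope, once for the inner factor and once for the outer. Derivations and variables are abstract
so that the lemma applies to either order of the first two variables. -/
theorem triJac_mem_ker (D₀ D₁ D₂ : Derivation ℝ R R) (x₀ x₁ x₂ : R) (h00 : D₀ x₀ = 1)
    (h01 : D₀ x₁ = 0) (h02 : D₀ x₂ = 0) (h10 : D₁ x₀ = 0) (h11 : D₁ x₁ = 1)
    (h12 : D₁ x₂ = 0) (h20 : D₂ x₀ = 0) (h21 : D₂ x₁ = 0) (h22 : D₂ x₂ = 1)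
    (κ₀ κ₁ α : ℝ) (p q : ℕ) :
    besselOp D₀ x₀ (κ₀ + 1) (triJac κ₀ κ₁ α p q x₀ x₁ x₂) +
      besselOp D₁ x₁ (κ₁ + 1) (triJac κ₀ κ₁ α p q x₀ x₁ x₂) +
      besselOp D₂ x₂ (α + 1) (triJac κ₀ κ₁ α p q x₀ x₁ x₂) = 0 := by
  set g : R := jac q α κ₁ (x₁ + x₂) x₂ with hg
  have hg0 : D₀ g = 0 := by
    simp [hg, jac, h01, h02]
  -- Euler's identity for the inner factor, homogeneous of degree `q`.
  have hE : x₁ * D₁ g + x₂ * D₂ g = q * g := by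
    rw [hg]
    simp only [jac, map_sum, mul_sum, ← sum_add_distrib]
    refine sum_congr rfl fun k hk => ?_
    have hk' : k ≤ q := Nat.lt_succ_iff.mp (mem_range.mp hk)
    have a1 := mul_pow_pred k x₂
    have a2 := mul_pow_pred (q - k) (x₁ + x₂)
    rw [Nat.cast_sub hk'] at a2
    simp only [Derivation.map_smul, derivation_mul, derivation_pow, map_add, h11, h12, h21, h22,
      Nat.cast_sub hk']
    simp only [Algebra.smul_def]
    linear_combination algebraMap ℝ R (jacCoef q α κ₁ k) * ((x₁ + x₂) ^ (q - k) * a1 +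
      x₂ ^ k * a2)
  have hL : besselOp D₁ x₁ (κ₁ + 1) g + besselOp D₂ x₂ (α + 1) g = 0 := by
    rw [hg, jac, besselOp_sum, besselOp_sum, ← sum_add_distrib]
    rw [← sum_jacCoef_telescope q α κ₁ (fun k => x₂ ^ k * (x₁ + x₂) ^ (q - k - 1))
      (fun k => x₂ ^ (k - 1) * (x₁ + x₂) ^ (q - k))
      (fun k _ => by simp only [Nat.add_sub_cancel, Nat.sub_sub])]
    refine sum_congr rfl fun k hk => ?_
    have hk' : k ≤ q := Nat.lt_succ_iff.mp (mem_range.mp hk)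
    rw [besselOp_smul, besselOp_smul, ← smul_add,
      besselOp_pow_mul_pow D₁ D₂ x₁ x₂ h11 h12 h21 h22, Nat.cast_sub hk']
    ring_nf
  rw [triJac, ← hg, jac, sum_mul, besselOp_sum, besselOp_sum, besselOp_sum, ← sum_add_distrib,
    ← sum_add_distrib]
  rw [← sum_jacCoef_telescope p (α + κ₁ + 2 * q + 1) κ₀
    (fun k => (x₁ + x₂) ^ k * (x₀ + x₁ + x₂) ^ (p - k - 1) * g)
      (fun k => (x₁ + x₂) ^ (k - 1) * (x₀ + x₁ + x₂) ^ (p - k) * g)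
      (fun k _ => by simp only [Nat.add_sub_cancel, Nat.sub_sub])]
  refine sum_congr rfl fun k hk => ?_
  have hk' : k ≤ p := Nat.lt_succ_iff.mp (mem_range.mp hk)
  rw [smul_mul_assoc, besselOp_smul, besselOp_smul, besselOp_smul, ← smul_add, ← smul_add,
    besselOp_pow_mul_pow_mul D₀ D₁ D₂ x₀ x₁ x₂ h00 h01 h02 h10 h11 h12 h20 h21 h22 _ _ _ _ _ q g
      hg0 hE hL, Nat.cast_sub hk']
  ring_nf

end

theorem coeff_besselOp (i : Fin 3) (c : ℝ) (f : MvPolynomial (Fin 3) ℝ) (m : Fin 3 →₀ ℕ) :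
    (besselOp (MvPolynomial.pderiv i) (MvPolynomial.X i) c f).coeff m =
      (m i + 1) * (m i + c) * f.coeff (m + Finsupp.single i 1) := by
  have h : MvPolynomial.coeff m (MvPolynomial.X i * MvPolynomial.pderiv i (MvPolynomial.pderiv i f))
      = m i * (m i + 1) * f.coeff (m + Finsupp.single i 1) := by
    rw [MvPolynomial.coeff_X_mul']
    split_ifs with hm
    · have h1 : 1 ≤ m i := Nat.one_le_iff_ne_zero.mpr (Finsupp.mem_support_iff.mp hm)
      have h2 : m - Finsupp.single i 1 + Finsupp.single i 1 = m :=
        tsub_add_cancel_of_le (Finsupp.single_le_iff.mpr h1)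
      rw [MvPolynomial.coeff_pderiv, MvPolynomial.coeff_pderiv, h2]
      simp only [Finsupp.coe_tsub, Pi.sub_apply, Finsupp.single_eq_same, Nat.cast_sub h1]
      push_cast
      ring
    · rw [Finsupp.notMem_support_iff.mp hm]
      simp
  rw [besselOp, MvPolynomial.coeff_add, h, MvPolynomial.coeff_smul, MvPolynomial.coeff_pderiv,
    smul_eq_mul]
  ring

/-- An element of the kernel is determined by its restriction to `x₁ = 0`. -/
theorem eq_zero_of_besselOp {c : Fin 3 → ℝ} (hc : 0 < c 1) (f : MvPolynomial (Fin 3) ℝ)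
    (hf : besselOp (MvPolynomial.pderiv 0) (MvPolynomial.X 0) (c 0) f +
      besselOp (MvPolynomial.pderiv 1) (MvPolynomial.X 1) (c 1) f +
      besselOp (MvPolynomial.pderiv 2) (MvPolynomial.X 2) (c 2) f = 0)
    (h0 : MvPolynomial.X 1 ∣ f) : f = 0 := by
  -- Induction on the exponent of `x₁`. Comparing coefficients in the equation expresses
  -- `(j+1)(j+c₁)` times a coefficient with exponent `j+1` through coefficients with exponent `j`,
  -- and `c₁ > 0` allows division.
  have key : ∀ j : ℕ, ∀ m : Fin 3 →₀ ℕ, m 1 = j → f.coeff m = 0 := by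
    intro j
    induction j with
    | zero =>
      intro m hm
      obtain ⟨g, rfl⟩ := h0
      rw [MvPolynomial.coeff_X_mul', if_neg (by simpa using hm)]
    | succ j ih =>
      intro m hm
      have h2 : m - Finsupp.single 1 1 + Finsupp.single 1 1 = m :=
        tsub_add_cancel_of_le (Finsupp.single_le_iff.mpr (by omega))
      have h := congrArg (MvPolynomial.coeff (m - Finsupp.single 1 1)) hf
      have h3 : (m - Finsupp.single (1 : Fin 3) 1 : Fin 3 →₀ ℕ) 1 = j := by simp [hm]
      rw [MvPolynomial.coeff_add, MvPolynomial.coeff_add, coeff_besselOp, coeff_besselOp,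
        coeff_besselOp, h2, ih (m - Finsupp.single 1 1 + Finsupp.single 0 1) (by simp [hm]),
        ih (m - Finsupp.single 1 1 + Finsupp.single 2 1) (by simp [hm]), h3,
        MvPolynomial.coeff_zero] at h
      simp only [mul_zero, zero_add, add_zero] at h
      have hj : (0 : ℝ) ≤ j := Nat.cast_nonneg j
      have : (((j : ℝ) + 1) * (j + c 1)) ≠ 0 := by positivity
      exact (mul_eq_zero.mp h).resolve_left this
  ext m
  rw [key _ m rfl, MvPolynomial.coeff_zero]

end SimplexJacobi

end

noncomputable section

namespace SimplexJacobi

open Finset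

/-! ### The transposition of two variables -/

/-- The connection coefficients for the transposition of the first two variables. -/
def triCoef (κ₀ κ₁ α : ℝ) (p q p' q' : ℕ) : ℝ :=
  (-1) ^ p * (poch (κ₁ + 1) p * poch (α + 1) q * p'.factorial) /
      (p.factorial * q.factorial * (poch (κ₁ + 1) q' * poch (α + 1) q' *
        (poch (α + κ₁ + 1 + q') q' * poch (α + κ₁ + 1 + 2 * q' + 1) p'))) *
    hyp43 q' (q' + (α + κ₁ + 1)) (-q) (q + α + κ₀ + 1) (α + 1) (α + κ₀ + κ₁ + 2 + (p + q : ℕ))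
      (-((p + q : ℕ) : ℝ))

theorem poch_neg_add_natCast {n k q : ℕ} (hk : k ≤ q) (hq : q ≤ n) :
    poch (-(n : ℝ) + k) (q - k) =
      (-1) ^ (q - k) * (((n - k).factorial : ℝ) / ((n - q).factorial : ℝ)) := by
  rw [show -(n : ℝ) + k = -((n - k : ℕ) : ℝ) by rw [Nat.cast_sub (hk.trans hq)]; ring,
    poch_neg_natCast (by omega), show n - k - (q - k) = n - q by omega]

theorem poch_add_natCast_ne_zero {A : ℝ} (hA : -1 < A) (q : ℕ) : poch (A + q) q ≠ 0 := by
  rcases q with _ | q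
  · rw [poch_zero]; exact one_ne_zero
  · have : (0 : ℝ) ≤ q := Nat.cast_nonneg q
    exact poch_ne_zero (by push_cast; linarith) _

/-- The left side is an entry of the composite of two triangular base changes, in which the sum over
the intermediate monomials is a ₄F₃. The prefactors on both sides are the endpoint values from
`jac_self`. -/
theorem triCoef_sum {κ₀ κ₁ α : ℝ} (h₁ : -1 < κ₁) (hα : -1 < α)
    {p q p' q' : ℕ} (h : p' + q' = p + q) :
    ∑ k ∈ range (p + q + 1), ((-1) ^ p * poch (κ₁ + 1) p / p.factorial) *
      ((q.choose k : ℝ) * ((-1) ^ k * (poch (α + 1 + k) (q - k) * poch (q + α + κ₀ + 1) k) /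
        q.factorial)) * invLeft (p + q) (α + κ₁ + 1) κ₀ k q' =
      triCoef κ₀ κ₁ α p q p' q' * ((-1) ^ q' * poch (κ₁ + 1) q' / q'.factorial) := by
  have hs : ∀ k ∈ range (p + q + 1), k ∉ range (q' + 1) →
      ((-1) ^ p * poch (κ₁ + 1) p / p.factorial) *
      ((q.choose k : ℝ) * ((-1) ^ k * (poch (α + 1 + k) (q - k) * poch (q + α + κ₀ + 1) k) /
        q.factorial)) * invLeft (p + q) (α + κ₁ + 1) κ₀ k q' = 0 := by
    intro k _ hk
    have : q' < k := by rw [mem_range] at hk; omega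
    simp [invLeft, Nat.choose_eq_zero_of_lt this]
  rw [← sum_subset (range_subset_range.mpr (by omega)) hs, triCoef, hyp43, mul_sum, sum_mul]
  refine sum_congr rfl fun k hk => ?_
  have hk' : k ≤ q' := Nat.lt_succ_iff.mp (mem_range.mp hk)
  rcases Nat.lt_or_ge q k with hqk | hqk
  · simp [Nat.choose_eq_zero_of_lt hqk, poch_neg_natCast_eq_zero hqk]
  rw [invLeft, poch_neg_natCast hk', poch_neg_natCast hqk,
    poch_neg_add_natCast hk' (by omega : q' ≤ p + q), Nat.cast_choose ℝ hk', Nat.cast_choose ℝ hqk,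
    show p + q - q' = p' by omega, poch_split (α + 1) hqk, poch_split (α + 1) hk',
    show α + κ₁ + 1 + κ₀ + 1 = α + κ₀ + κ₁ + 2 by ring,
    show ((p + q : ℕ) : ℝ) + (α + κ₀ + κ₁ + 2) + k = α + κ₀ + κ₁ + 2 + (p + q : ℕ) + k by ring,
    show (q' : ℝ) + (α + κ₁ + 1) = α + κ₁ + 1 + q' by ring]
  have hq' : (0 : ℝ) ≤ q' := Nat.cast_nonneg q'
  have n1 : poch (α + 1) k ≠ 0 := poch_ne_zero (by linarith) _
  have n2 : poch (α + 1 + k) (q' - k) ≠ 0 := poch_ne_zero (by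
    have : (0 : ℝ) ≤ k := Nat.cast_nonneg k
    linarith) _
  have n3 : poch (κ₁ + 1) q' ≠ 0 := poch_ne_zero (by linarith) _
  have n4 : poch (α + κ₁ + 1 + q') q' ≠ 0 := poch_add_natCast_ne_zero (by linarith) q'
  have n5 : poch (α + κ₁ + 1 + 2 * q' + 1) p' ≠ 0 := poch_ne_zero (by linarith) _
  have f1 := Nat.factorial_ne_zero p
  have f2 := Nat.factorial_ne_zero q
  have f3 := Nat.factorial_ne_zero q'
  have f4 := Nat.factorial_ne_zero p'
  have f5 := Nat.factorial_ne_zero k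
  have f6 := Nat.factorial_ne_zero (q - k)
  have f7 := Nat.factorial_ne_zero (q' - k)
  have s1 : (-1 : ℝ) ^ (q' - k) = (-1) ^ q' * (-1) ^ k := by
    obtain ⟨t, rfl⟩ := Nat.exists_eq_add_of_le hk'
    rw [Nat.add_sub_cancel_left, pow_add, mul_right_comm, ← mul_pow]
    simp
  have s2 : ((-1 : ℝ) ^ q') ^ 2 = 1 := by rw [← pow_mul, mul_comm, pow_mul]; simp
  have s3 : ((-1 : ℝ) ^ k) ^ 2 = 1 := by rw [← pow_mul, mul_comm, pow_mul]; simp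
  rw [s1]
  field_simp
  rw [s2, s3]
  ring

theorem X_dvd_of_aeval_eq_zero (f : MvPolynomial (Fin 3) ℝ)
    (hf : MvPolynomial.aeval
      (![MvPolynomial.X 0, 0, MvPolynomial.X 2] : Fin 3 → MvPolynomial (Fin 3) ℝ) f = 0) :
    MvPolynomial.X 1 ∣ f := by
  have key : ∀ f : MvPolynomial (Fin 3) ℝ, MvPolynomial.X 1 ∣ f - MvPolynomial.aeval
      (![MvPolynomial.X 0, 0, MvPolynomial.X 2] : Fin 3 → MvPolynomial (Fin 3) ℝ) f := by
    intro f
    induction f using MvPolynomial.induction_on with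
    | C a => simp [MvPolynomial.algebraMap_eq]
    | add f g hf hg =>
      rw [map_add, add_sub_add_comm]
      exact dvd_add hf hg
    | mul_X f i hf =>
      rw [map_mul, MvPolynomial.aeval_X]
      fin_cases i
      · simpa [← sub_mul] using hf.mul_right _
      · simp
      · simpa [← sub_mul] using hf.mul_right _
  have h := key f
  rwa [hf, sub_zero] at h

/-- Both sides are annihilated by the operator with parameters `κ₀+1, κ₁+1, α+1`, so they agree as
soon as they agree at `x₁ = 0`. -/
theorem triJac_swap_X {κ₀ κ₁ α : ℝ} (h₁ : -1 < κ₁) (hα : -1 < α) (p q : ℕ) :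
    triJac κ₁ κ₀ α p q (MvPolynomial.X 1 : MvPolynomial (Fin 3) ℝ) (MvPolynomial.X 0)
        (MvPolynomial.X 2) =
      ∑ q' ∈ range (p + q + 1), triCoef κ₀ κ₁ α p q (p + q - q') q' •
        triJac κ₀ κ₁ α (p + q - q') q' (MvPolynomial.X 0) (MvPolynomial.X 1)
          (MvPolynomial.X 2) := by
  rw [← sub_eq_zero, sub_eq_add_neg, ← sum_neg_distrib]
  have hadd : ∀ (i : Fin 3) (c : ℝ) (f g : MvPolynomial (Fin 3) ℝ),
      besselOp (MvPolynomial.pderiv i) (MvPolynomial.X i) c (f + g) =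
        besselOp (MvPolynomial.pderiv i) (MvPolynomial.X i) c f +
        besselOp (MvPolynomial.pderiv i) (MvPolynomial.X i) c g := by
    intro i c f g
    simp only [besselOp, map_add, smul_add]
    ring
  have hX : ∀ i j : Fin 3, MvPolynomial.pderiv (R := ℝ) i (MvPolynomial.X j) =
      if i = j then 1 else 0 := by
    intro i j
    rw [MvPolynomial.pderiv_X, Pi.single_apply]
    simp only [eq_comm]
  refine eq_zero_of_besselOp (c := ![κ₀ + 1, κ₁ + 1, α + 1]) ?_ _ ?_ ?_
  · simp only [Matrix.cons_val_one, Matrix.cons_val_zero]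
    linarith
  · have k1 := triJac_mem_ker (MvPolynomial.pderiv (R := ℝ) (1 : Fin 3)) (MvPolynomial.pderiv 0)
      (MvPolynomial.pderiv 2) (MvPolynomial.X 1) (MvPolynomial.X 0) (MvPolynomial.X 2)
      (by simp [hX]) (by simp [hX]) (by simp [hX]) (by simp [hX]) (by simp [hX]) (by simp [hX])
      (by simp [hX]) (by simp [hX]) (by simp [hX]) κ₁ κ₀ α p q
    have k2 := fun p' q' => triJac_mem_ker (MvPolynomial.pderiv (R := ℝ) (0 : Fin 3))
      (MvPolynomial.pderiv 1)
      (MvPolynomial.pderiv 2) (MvPolynomial.X 0) (MvPolynomial.X 1) (MvPolynomial.X 2)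
      (by simp [hX]) (by simp [hX]) (by simp [hX]) (by simp [hX]) (by simp [hX]) (by simp [hX])
      (by simp [hX]) (by simp [hX]) (by simp [hX]) κ₀ κ₁ α p' q'
    simp only [Matrix.cons_val_zero, Matrix.cons_val_one, Matrix.cons_val_two, Matrix.tail_cons,
      Matrix.head_cons, hadd, besselOp_sum, ← neg_smul, besselOp_smul]
    rw [add_comm (besselOp (MvPolynomial.pderiv (1 : Fin 3)) _ _ _)] at k1
    have k3 : ∀ q', besselOp (MvPolynomial.pderiv (R := ℝ) (0 : Fin 3)) (MvPolynomial.X 0) (κ₀ + 1)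
        (triJac κ₀ κ₁ α (p + q - q') q' (MvPolynomial.X 0) (MvPolynomial.X 1)
          (MvPolynomial.X 2)) = -(besselOp (MvPolynomial.pderiv (R := ℝ) (1 : Fin 3))
          (MvPolynomial.X 1) (κ₁ + 1)
        (triJac κ₀ κ₁ α (p + q - q') q' (MvPolynomial.X 0) (MvPolynomial.X 1)
          (MvPolynomial.X 2))) - besselOp (MvPolynomial.pderiv (R := ℝ) (2 : Fin 3))
          (MvPolynomial.X 2) (α + 1)
        (triJac κ₀ κ₁ α (p + q - q') q' (MvPolynomial.X 0) (MvPolynomial.X 1)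
          (MvPolynomial.X 2)) := fun q' => by
      linear_combination k2 (p + q - q') q'
    simp only [k3, smul_sub, smul_neg, sum_sub_distrib, sum_neg_distrib]
    linear_combination k1
  · apply X_dvd_of_aeval_eq_zero
    -- At `x₁ = 0` the left side is a multiple of `s^p jac q`, and the right side is a combination
    -- of the products `w^q' jac (p+q-q')`. It remains to pass from one family to the other through
    -- the monomials.
    set s : MvPolynomial (Fin 3) ℝ := MvPolynomial.X 0 + MvPolynomial.X 2 with hs
    set w : MvPolynomial (Fin 3) ℝ := MvPolynomial.X 2 with hw
    simp only [map_add, map_sum, map_neg, map_smul, triJac, map_mul, map_jac,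
      MvPolynomial.aeval_X, Matrix.cons_val_zero, Matrix.cons_val_one, Matrix.cons_val,
      zero_add, add_zero, hw]
    rw [← hw, ← hs, jac_self, smul_mul_assoc]
    have e : s ^ p * jac q α κ₀ s w = s ^ (p + q - q) * jac q α κ₀ s w := by
      rw [Nat.add_sub_cancel]
    rw [e, pow_mul_jac_right (by omega), smul_sum]
    have h1 : ∀ k ∈ range (p + q + 1), ((-1) ^ p * poch (κ₁ + 1) p / p.factorial : ℝ) •
        ((q.choose k : ℝ) * ((-1) ^ k * (poch (α + 1 + k) (q - k) * poch (q + α + κ₀ + 1) k) /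
        q.factorial)) • (w ^ k * s ^ (p + q - k)) = ∑ q' ∈ range (p + q + 1),
        (((-1) ^ p * poch (κ₁ + 1) p / p.factorial) *
      ((q.choose k : ℝ) * ((-1) ^ k * (poch (α + 1 + k) (q - k) * poch (q + α + κ₀ + 1) k) /
        q.factorial)) * invLeft (p + q) (α + κ₁ + 1) κ₀ k q') •
        (w ^ q' * jac (p + q - q') (α + κ₁ + 1 + 2 * q') κ₀ s w) := by
      intro k hk
      rw [pow_mul_pow_eq_sum_left (Nat.lt_succ_iff.mp (mem_range.mp hk))
        (A := α + κ₁ + 1) (by linarith) κ₀ s w, smul_smul, smul_sum]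
      exact sum_congr rfl fun q' _ => smul_smul _ _ _
    rw [sum_congr rfl h1, sum_comm, ← sum_add_distrib]
    refine sum_eq_zero fun q' hq' => ?_
    have hq : q' ≤ p + q := Nat.lt_succ_iff.mp (mem_range.mp hq')
    rw [← sum_smul, triCoef_sum h₁ hα (p' := p + q - q') (by omega), jac_self,
      show α + κ₁ + 2 * (q' : ℝ) + 1 = α + κ₁ + 1 + 2 * q' by ring, mul_smul_comm, smul_smul,
      mul_comm (w ^ q'), add_neg_cancel]

theorem triJac_swap {R : Type*} [CommRing R] [Algebra ℝ R] {κ₀ κ₁ α : ℝ} (h₁ : -1 < κ₁)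
    (hα : -1 < α) (p q : ℕ) (x₀ x₁ x₂ : R) :
    triJac κ₁ κ₀ α p q x₁ x₀ x₂ =
      ∑ q' ∈ range (p + q + 1), triCoef κ₀ κ₁ α p q (p + q - q') q' •
        triJac κ₀ κ₁ α (p + q - q') q' x₀ x₁ x₂ := by
  have h := congrArg (MvPolynomial.aeval (![x₀, x₁, x₂] : Fin 3 → R))
    (triJac_swap_X (κ₀ := κ₀) h₁ hα p q)
  simpa [triJac, map_jac] using h

end SimplexJacobi

end

/-! ### The second form of the transposition coefficients -/

noncomputable section

namespace SimplexJacobi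

open Finset

theorem eq_zero_of_triangular {n : ℕ} (d : ℕ → ℝ) (r : ℕ → ℕ → ℝ)
    (h0 : ∀ q k, q < k → r q k = 0) (h1 : ∀ k ≤ n, r k k ≠ 0)
    (h : ∀ k ≤ n, ∑ q ∈ range (n + 1), d q * r q k = 0) : ∀ q ≤ n, d q = 0 := by
  have key : ∀ j q, q ≤ n → n - q = j → d q = 0 := by
    intro j
    induction j using Nat.strong_induction_on with
    | _ j ih =>
      intro q hq hj
      have hs := h q hq
      rw [sum_eq_single q] at hs
      · exact (mul_eq_zero.mp hs).resolve_right (h1 q hq)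
      · intro b hb hbq
        have hb' : b ≤ n := Nat.lt_succ_iff.mp (mem_range.mp hb)
        rcases Nat.lt_or_ge b q with hlt | hge
        · rw [h0 b q hlt, mul_zero]
        · rw [ih (n - b) (by omega) b hb' rfl, zero_mul]
      · intro hq'
        exact absurd (mem_range.mpr (Nat.lt_succ_of_le hq)) hq'
  exact fun q hq => key _ q hq rfl

theorem eq_zero_of_sum_jac_eq_zero {α κ : ℝ} (hA : -1 < α + κ + 1) {n : ℕ} (d : ℕ → ℝ)
    (h : ∑ q ∈ range (n + 1), d q • ((1 : Polynomial ℝ) ^ (n - q) *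
      jac q α κ (1 : Polynomial ℝ) Polynomial.X) = 0) : ∀ q ≤ n, d q = 0 := by
  refine eq_zero_of_triangular d (fun q k => (q.choose k : ℝ) * ((-1) ^ k *
    (poch (α + 1 + k) (q - k) * poch (q + α + κ + 1) k) / q.factorial)) ?_ ?_ ?_
  · intro q k hqk
    simp [Nat.choose_eq_zero_of_lt hqk]
  · intro k _
    have f1 := Nat.factorial_ne_zero k
    have h2 : poch (k + α + κ + 1) k ≠ 0 := by
      rw [show (k : ℝ) + α + κ + 1 = α + κ + 1 + k by ring]
      exact poch_add_natCast_ne_zero hA k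
    simp only [Nat.choose_self, Nat.sub_self, poch_zero]
    simp [h2, f1]
  · intro k hk
    have h2 : ∀ q ∈ range (n + 1), d q • ((1 : Polynomial ℝ) ^ (n - q) *
        jac q α κ (1 : Polynomial ℝ) Polynomial.X) = ∑ k ∈ range (n + 1),
        (d q * ((q.choose k : ℝ) * ((-1) ^ k *
          (poch (α + 1 + k) (q - k) * poch (q + α + κ + 1) k) / q.factorial))) •
          (Polynomial.X : Polynomial ℝ) ^ k := by
      intro q hq
      rw [pow_mul_jac_right (Nat.lt_succ_iff.mp (mem_range.mp hq)), smul_sum]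
      refine sum_congr rfl fun k _ => ?_
      rw [smul_smul, one_pow, mul_one]
    rw [sum_congr rfl h2, sum_comm] at h
    simp only [← sum_smul] at h
    have h3 := congrArg (fun f => Polynomial.coeff f k) h
    simp only [Polynomial.finsetSum_coeff, Polynomial.coeff_smul, Polynomial.coeff_X_pow,
      smul_eq_mul, mul_ite, mul_one, mul_zero, Polynomial.coeff_zero] at h3
    rw [sum_ite_eq, if_pos (mem_range.mpr (Nat.lt_succ_of_le hk))] at h3
    exact h3

/-- The scalar factor of the second form of the connection coefficients. -/
def triDual (κ₀ κ₁ α : ℝ) (p q p' q' : ℕ) : ℝ :=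
  (-1) ^ p * (poch (κ₀ + 1) q * poch (α + 1) q) /
      (p.factorial * (poch (κ₀ + 1) p' * poch (α + 1) q' *
        (poch (α + κ₁ + 1 + q') q' * poch (α + κ₁ + 1 + 2 * q' + 1) p'))) *
    hyp43 p (-q - (p + q : ℕ) - α - κ₀ - 1) (-p') (-q' - (p + q : ℕ) - (α + κ₁ + 1))
      (-(α + κ₀ + κ₁ + 2) - 2 * (p + q : ℕ) + 1) (-α - (p + q : ℕ)) (-((p + q : ℕ) : ℝ))

/-- The counterpart of `triCoef_sum` for the edge `x₀ = 0`, where the two base changes are used in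
the opposite order. -/
theorem triDual_sum {κ₀ κ₁ α : ℝ} (h₀ : -1 < κ₀) (h₁ : -1 < κ₁) (hα : -1 < α)
    {p q p' q' : ℕ} (h : p' + q' = p + q) :
    ∑ i ∈ range (p + q + 1), ((-1) ^ q * poch (κ₀ + 1) q / q.factorial) *
      ((i.choose q : ℝ) * ((-1) ^ (i + q) *
        (q.factorial / (i.factorial * (p + q - i).factorial)) *
        (poch (α + κ₀ + 1 + q + i + 1) (p + q - i) *
          poch ((p + q : ℕ) + q + (α + κ₀ + 1 + κ₁ + 1)) (i - q)))) * invRight α κ₁ i q' =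
      triDual κ₀ κ₁ α p q p' q' * ((-1) ^ p' * poch (κ₀ + 1) p' / p'.factorial) := by
  -- The sum is read backwards, `k = p + q - i`. Since the binomial of `i` over `q` vanishes for `i
  -- < q`, only `k ≤ p` contributes, so this ₄F₃ has length `p` instead of `q'`.
  rw [← sum_range_reflect]
  rw [← sum_subset (s₁ := range (p + 1)) (s₂ := range (p + q + 1))
    (range_subset_range.mpr (by omega)) ?_, triDual, hyp43, mul_sum, sum_mul]
  · refine sum_congr rfl fun k hk => ?_
    have hk' : k ≤ p := Nat.lt_succ_iff.mp (mem_range.mp hk)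
    obtain ⟨t, rfl⟩ := Nat.exists_eq_add_of_le hk'
    have i1 : k + t + q + 1 - 1 - k = q + t := by omega
    rw [i1, show k + t + q - (q + t) = k by omega, show q + t - q = t by omega,
      show k + t - k = t by omega]
    rcases Nat.lt_or_ge p' k with hpk | hpk
    · have : q + t < q' := by omega
      simp [invRight, Nat.choose_eq_zero_of_lt this, poch_neg_natCast_eq_zero hpk]
    obtain ⟨u, rfl⟩ := Nat.exists_eq_add_of_le hpk
    have hu : u + q' = q + t := by omega
    have hur : (u : ℝ) + q' = q + t := by exact_mod_cast hu
    have e1 : poch (-((k + t : ℕ) : ℝ)) k = (-1) ^ k * ((k + t).factorial / t.factorial) := by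
      rw [poch_neg_natCast (by omega), show k + t - k = t by omega]
    have e2 : poch (-((k + u : ℕ) : ℝ)) k = (-1) ^ k * ((k + u).factorial / u.factorial) := by
      rw [poch_neg_natCast (by omega), show k + u - k = u by omega]
    have e3 : poch (-((k + t + q : ℕ) : ℝ) + k) t =
        (-1) ^ t * ((q + t).factorial / q.factorial) := by
      have := poch_neg_add_natCast (n := k + t + q) (k := k) (q := k + t) (by omega) (by omega)
      rwa [show k + t - k = t by omega, show k + t + q - k = q + t by omega,
        show k + t + q - (k + t) = q by omega] at this
    have e4 : poch (-(q : ℝ) - (k + t + q : ℕ) - α - κ₀ - 1) k =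
        (-1) ^ k * poch (α + κ₀ + 1 + q + (q + t : ℕ) + 1) k := by
      rw [show -(q : ℝ) - (k + t + q : ℕ) - α - κ₀ - 1 = -(q + (k + t + q : ℕ) + α + κ₀ + 1) by
        ring, poch_neg]
      push_cast
      ring_nf
    have e5 : poch (-(q' : ℝ) - (k + t + q : ℕ) - (α + κ₁ + 1)) k =
        (-1) ^ k * poch (α + κ₁ + 1 + 2 * q' + 1 + u) k := by
      rw [show -(q' : ℝ) - (k + t + q : ℕ) - (α + κ₁ + 1) =
        -(q' + (k + t + q : ℕ) + (α + κ₁ + 1)) by ring, poch_neg,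
        show (q' : ℝ) + (k + t + q : ℕ) + (α + κ₁ + 1) - k + 1 = α + κ₁ + 1 + 2 * q' + 1 + u by
          push_cast; linear_combination -hur]
    have e6 : poch (-(α + κ₀ + κ₁ + 2) - 2 * (k + t + q : ℕ) + 1 + k) t =
        (-1) ^ t * poch ((k + t + q : ℕ) + q + (α + κ₀ + 1 + κ₁ + 1)) t := by
      rw [show -(α + κ₀ + κ₁ + 2) - 2 * ((k + t + q : ℕ) : ℝ) + 1 + k =
        -((α + κ₀ + κ₁ + 2) + 2 * (k + t + q : ℕ) - 1 - k) by ring, poch_neg]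
      push_cast
      ring_nf
    have e7 : poch (-α - (k + t + q : ℕ) + k) t = (-1) ^ t * poch (α + 1 + q) t := by
      rw [show -α - ((k + t + q : ℕ) : ℝ) + k = -(α + (k + t + q : ℕ) - k) by ring, poch_neg]
      push_cast
      ring_nf
    have e8 : poch (α + 1) q * poch (α + 1 + q) t = poch (α + 1) q' * poch (α + 1 + q') u := by
      rw [← poch_add, ← poch_add, ← hu, add_comm u]
    have e9 : poch (α + κ₁ + 1 + 2 * q' + 1) (k + u) =
        poch (α + κ₁ + 1 + 2 * q' + 1) u * poch (α + κ₁ + 1 + 2 * q' + 1 + u) k := by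
      rw [add_comm k, poch_add]
    rw [invRight, e1, e2, e3, e4, e5, e6, e7, e9, show q + t - q' = u by omega,
      Nat.cast_add_choose, ← hu, add_comm u q', Nat.cast_add_choose, add_comm q' u, hu]
    have hq' : (0 : ℝ) ≤ q' := Nat.cast_nonneg q'
    have hu' : (0 : ℝ) ≤ u := Nat.cast_nonneg u
    have n1 : poch (α + 1) q' ≠ 0 := poch_ne_zero (by linarith) _
    have n3 : poch (κ₀ + 1) (k + u) ≠ 0 := poch_ne_zero (by linarith) _
    have n4 : poch (α + κ₁ + 1 + q') q' ≠ 0 := poch_add_natCast_ne_zero (by linarith) q'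
    have n5 : poch (α + κ₁ + 1 + 2 * q' + 1) u ≠ 0 := poch_ne_zero (by linarith) _
    have n6 : poch (α + κ₁ + 1 + 2 * q' + 1 + u) k ≠ 0 := poch_ne_zero (by linarith) _
    have f1 := Nat.factorial_ne_zero (k + t)
    have f2 := Nat.factorial_ne_zero q
    have f3 := Nat.factorial_ne_zero q'
    have f4 := Nat.factorial_ne_zero (k + u)
    have f5 := Nat.factorial_ne_zero k
    have f6 := Nat.factorial_ne_zero t
    have f7 := Nat.factorial_ne_zero u
    have f8 := Nat.factorial_ne_zero (q + t)
    have s0 : ∀ j : ℕ, ((-1 : ℝ) ^ j) ^ 2 = 1 := fun j => by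
      rw [← pow_mul, mul_comm, pow_mul]; simp
    have s4 : ∀ j : ℕ, ((-1 : ℝ) ^ j) ^ 4 = 1 := fun j => by
      rw [← pow_mul, mul_comm, pow_mul]; norm_num
    have s5 : (-1 : ℝ) ^ q * (-1) ^ t = (-1) ^ u * (-1) ^ q' := by
      rw [← pow_add, ← pow_add, hu]
    have s6 : (-1 : ℝ) ^ t * (-1) ^ u = (-1) ^ q * (-1) ^ q' := by
      linear_combination (-1 : ℝ) ^ q * (-1) ^ u * s5 - (-1) ^ t * (-1) ^ u * s0 q +
        (-1 : ℝ) ^ q * (-1) ^ q' * s0 u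
    clear e1 e2 e3 e4 e5 e6 e7 e9 i1
    generalize poch (α + κ₁ + 1 + 2 * q' + 1 + u) k = Y₁ at n6 ⊢
    generalize poch (α + κ₁ + 1 + 2 * q' + 1) u = Y₂ at n5 ⊢
    generalize poch (α + κ₀ + 1 + q + (q + t : ℕ) + 1) k = Y₃
    simp only [pow_add]
    field_simp
    have s3 : ∀ j : ℕ, ((-1 : ℝ) ^ j) ^ 3 = (-1) ^ j := fun j => by
      rw [← pow_mul, mul_comm, pow_mul]; norm_num
    have s7 : ((-1 : ℝ) ^ k) ^ 6 = 1 := by rw [← pow_mul, mul_comm, pow_mul]; norm_num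
    rw [s3, s3, s7]
    linear_combination (poch (κ₀ + 1) q * Y₃ *
      poch ((k + t + q : ℕ) + q + (α + κ₀ + 1 + κ₁ + 1)) t) *
        (-((-1) ^ t * (-1) ^ u) * e8) - poch (κ₀ + 1) q * Y₃ *
      poch ((k + t + q : ℕ) + q + (α + κ₀ + 1 + κ₁ + 1)) t * poch (α + 1 + q') u *
        poch (α + 1) q' * s6
  · intro k hk hk'
    have : p + q + 1 - 1 - k < q := by
      rw [mem_range] at hk hk'; omega
    rw [Nat.choose_eq_zero_of_lt this]
    simp

/-- The exchange formula is restricted to `x₀ = 0`, with `x₁ = 1 - X` and `x₂ = X`. There the right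
side is a combination of the linearly independent Jacobi polynomials in `X`, so the coefficients are
determined a second time. -/
theorem triCoef_eq_triDual {κ₀ κ₁ α : ℝ} (h₀ : -1 < κ₀) (h₁ : -1 < κ₁) (hα : -1 < α)
    {p q p' q' : ℕ} (h : p' + q' = p + q) :
    triCoef κ₀ κ₁ α p q p' q' = triDual κ₀ κ₁ α p q p' q' := by
  have hX' : (1 - Polynomial.X : Polynomial ℝ) + 0 + Polynomial.X = 1 := by ring
  have hX'' : (1 - Polynomial.X : Polynomial ℝ) + Polynomial.X = 1 := by ring
  have hsw := triJac_swap (κ₀ := κ₀) h₁ hα p q (0 : Polynomial ℝ) (1 - Polynomial.X) Polynomial.X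
  simp only [triJac, hX', hX'', zero_add, jac_self, one_pow] at hsw
  rw [show α + κ₀ + 2 * (q : ℝ) + 1 = α + κ₀ + 1 + 2 * q by ring, mul_smul_comm,
    mul_comm (jac p _ _ _ _)] at hsw
  have e : jac p (α + κ₀ + 1 + 2 * q) κ₁ (1 : Polynomial ℝ) Polynomial.X =
      jac (p + q - q) (α + κ₀ + 1 + 2 * q) κ₁ (1 : Polynomial ℝ) Polynomial.X := by
    rw [Nat.add_sub_cancel]
  rw [e, pow_mul_jac_left (by omega), smul_sum] at hsw
  have h1 : ∀ i ∈ range (p + q + 1), ((-1) ^ q * poch (κ₀ + 1) q / q.factorial : ℝ) •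
      ((i.choose q : ℝ) * ((-1) ^ (i + q) *
        (q.factorial / (i.factorial * (p + q - i).factorial)) *
        (poch (α + κ₀ + 1 + q + i + 1) (p + q - i) *
          poch ((p + q : ℕ) + q + (α + κ₀ + 1 + κ₁ + 1)) (i - q)))) •
        ((Polynomial.X : Polynomial ℝ) ^ i * 1 ^ (p + q - i)) = ∑ q' ∈ range (p + q + 1),
      (((-1) ^ q * poch (κ₀ + 1) q / q.factorial) *
      ((i.choose q : ℝ) * ((-1) ^ (i + q) *
        (q.factorial / (i.factorial * (p + q - i).factorial)) *
        (poch (α + κ₀ + 1 + q + i + 1) (p + q - i) *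
          poch ((p + q : ℕ) + q + (α + κ₀ + 1 + κ₁ + 1)) (i - q)))) * invRight α κ₁ i q') •
        ((1 : Polynomial ℝ) ^ (p + q - q') * jac q' α κ₁ (1 : Polynomial ℝ) Polynomial.X) := by
    intro i hi
    rw [pow_mul_pow_eq_sum_right (Nat.lt_succ_iff.mp (mem_range.mp hi)) (α := α) (κ := κ₁)
      (by linarith), smul_smul, smul_sum]
    exact sum_congr rfl fun q' _ => smul_smul _ _ _
  rw [sum_congr rfl h1, sum_comm] at hsw
  simp only [← sum_smul] at hsw
  have h2 := eq_zero_of_sum_jac_eq_zero (α := α) (κ := κ₁) (by linarith) (n := p + q)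
    (fun q' => (∑ i ∈ range (p + q + 1), (((-1) ^ q * poch (κ₀ + 1) q / q.factorial) *
      ((i.choose q : ℝ) * ((-1) ^ (i + q) *
        (q.factorial / (i.factorial * (p + q - i).factorial)) *
        (poch (α + κ₀ + 1 + q + i + 1) (p + q - i) *
          poch ((p + q : ℕ) + q + (α + κ₀ + 1 + κ₁ + 1)) (i - q)))) * invRight α κ₁ i q')) -
      triCoef κ₀ κ₁ α p q (p + q - q') q' *
        ((-1) ^ (p + q - q') * poch (κ₀ + 1) (p + q - q') / (p + q - q').factorial)) (by
    simp only [sub_smul, sum_sub_distrib]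
    rw [hsw, sub_eq_zero]
    refine sum_congr rfl fun q' _ => ?_
    rw [smul_mul_assoc, smul_smul, one_pow]) q' (by omega)
  have hp' : p + q - q' = p' := by omega
  simp only [hp'] at h2
  rw [triDual_sum h₀ h₁ hα h, ← sub_mul] at h2
  have f1 := Nat.factorial_ne_zero p'
  have n1 : poch (κ₀ + 1) p' ≠ 0 := poch_ne_zero (by linarith) _
  have n2 : ((-1) ^ p' * poch (κ₀ + 1) p' / p'.factorial : ℝ) ≠ 0 := by
    refine div_ne_zero (mul_ne_zero (pow_ne_zero _ (by norm_num)) n1) (by exact_mod_cast f1)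
  exact (sub_eq_zero.mp ((mul_eq_zero.mp h2).resolve_right n2)).symm

end SimplexJacobi

end

noncomputable section

namespace SimplexJacobi

open Finset

/-! ### Partial sums -/

section

variable {M : Type*} [AddCommMonoid M] {k : ℕ}

theorem headSum_zero (y : Fin k → M) : headSum y 0 = 0 := by simp [headSum]

theorem headSum_succ (y : Fin (k + 1) → M) (j : ℕ) :
    headSum y (j + 1) = y 0 + headSum (Fin.tail y) j := by
  simp [headSum, Fin.sum_univ_succ, Fin.tail]

theorem tailSum_add_two (y : Fin (k + 1) → M) (j : ℕ) :
    tailSum y (j + 2) = tailSum (Fin.tail y) (j + 1) := by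
  simp [tailSum, Fin.sum_univ_succ, Fin.tail]

theorem tailSum_one (y : Fin k → M) : tailSum y 1 = ∑ i, y i := by simp [tailSum]

theorem tailSum_eq_zero (y : Fin k → M) {j : ℕ} (h : k < j) : tailSum y j = 0 := by
  refine sum_eq_zero fun i _ => if_neg (by omega)

theorem tailSum_eq_add (y : Fin k → M) (i : Fin k) :
    tailSum y (i + 1) = y i + tailSum y (i + 2) := by
  rw [tailSum, tailSum, ← Fintype.sum_ite_eq i (fun j => y j), ← sum_add_distrib]
  refine sum_congr rfl fun j _ => ?_
  rcases lt_trichotomy i j with h | h | h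
  · rw [if_pos (by have := Fin.lt_def.mp h; omega), if_neg h.ne,
      if_pos (by have := Fin.lt_def.mp h; omega), zero_add]
  · rw [if_pos (by rw [h]), if_pos h, if_neg (by rw [h]; omega), add_zero]
  · rw [if_neg (by have := Fin.lt_def.mp h; omega), if_neg h.ne',
      if_neg (by have := Fin.lt_def.mp h; omega), zero_add]

theorem headSum_add_tailSum (y : Fin k → M) (j : ℕ) :
    headSum y j + tailSum y (j + 1) = ∑ i, y i := by
  rw [headSum, tailSum, ← sum_add_distrib]
  refine sum_congr rfl fun i _ => ?_
  by_cases h : (i : ℕ) + 1 ≤ j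
  · rw [if_pos h, if_neg (by omega), add_zero]
  · rw [if_neg h, if_pos (by omega), zero_add]

end

theorem neg_card_lt_sum {k : ℕ} (y : Fin (k + 1) → ℝ) (hy : ∀ i, -1 < y i) :
    -((k : ℝ) + 1) < ∑ i, y i := by
  have h : ∑ _i : Fin (k + 1), (-1 : ℝ) < ∑ i, y i :=
    sum_lt_sum_of_nonempty univ_nonempty fun i _ => hy i
  simpa using h

theorem aParam_add_two {d : ℕ} (κ : Fin (d + 1 + 1) → ℝ) (ν : Fin (d + 1) → ℕ) (j : ℕ) :
    aParam κ ν (j + 2) = aParam (Fin.tail κ) (Fin.tail ν) (j + 1) := by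
  rw [aParam, aParam, tailSum_add_two κ (j + 1), tailSum_add_two ν (j + 1)]
  push_cast
  ring

theorem aParam_one {d : ℕ} (κ : Fin (d + 1 + 1) → ℝ) (ν : Fin (d + 1) → ℕ) :
    aParam κ ν 1 = ∑ i, Fin.tail κ i + 2 * ((∑ i, Fin.tail ν i : ℕ) : ℝ) + d := by
  rw [aParam, tailSum_add_two κ 0, tailSum_add_two ν 0, tailSum_one, tailSum_one]
  push_cast
  ring

/-- This is the relation between the parameters of the outer and inner factor of `triJac`, so
consecutive factors of a simplex polynomial form a triangle polynomial. It also makes the Gamma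
factors of the norms telescope. -/
theorem aParam_eq_add {d : ℕ} (κ : Fin (d + 1) → ℝ) (ν : Fin d → ℕ) {j : ℕ} (h : j < d) :
    aParam κ ν j = aParam κ ν (j + 1) + κ (Fin.castSucc ⟨j, h⟩) + 2 * ν ⟨j, h⟩ + 1 := by
  have h1 := tailSum_eq_add κ (Fin.castSucc ⟨j, h⟩)
  have h2 := tailSum_eq_add ν ⟨j, h⟩
  simp only [Fin.val_castSucc] at h1 h2
  rw [aParam, aParam, h1, h2]
  push_cast
  ring

theorem neg_one_lt_aParam {d : ℕ} (κ : Fin (d + 1) → ℝ) (hκ : ∀ i, -1 < κ i) (ν : Fin d → ℕ)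
    (i : Fin d) : -1 < aParam κ ν (i + 1) := by
  induction d with
  | zero => exact i.elim0
  | succ d ih =>
    refine Fin.cases ?_ (fun i => ?_) i
    · have h := neg_card_lt_sum (Fin.tail κ) (fun i => hκ i.succ)
      have h2 : (0 : ℝ) ≤ ((∑ i, Fin.tail ν i : ℕ) : ℝ) := Nat.cast_nonneg _
      rw [Fin.val_zero, zero_add, aParam_one]
      linarith
    · rw [Fin.val_succ, aParam_add_two]
      exact ih (Fin.tail κ) (fun i => hκ i.succ) (Fin.tail ν) i

/-! ### Homogeneous Jacobi polynomials on the simplex -/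

/-- The homogeneous form of `simplexJacobi`. -/
def simplexJac {d : ℕ} (κ : Fin (d + 1) → ℝ) (ν : Fin d → ℕ) (s : ℝ) (x : Fin d → ℝ) : ℝ :=
  ∏ i : Fin d, jacobiHom (ν i) (aParam κ ν ((i : ℕ) + 1)) (κ i.castSucc) (s - headSum x (i : ℕ))
    (x i)

theorem simplexJac_one {d : ℕ} (κ : Fin (d + 1) → ℝ) (ν : Fin d → ℕ) (x : Fin d → ℝ) :
    simplexJac κ ν 1 x = simplexJacobi κ ν x := rfl

theorem simplexJac_succ {d : ℕ} (κ : Fin (d + 1 + 1) → ℝ) (ν : Fin (d + 1) → ℕ) (s : ℝ)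
    (x : Fin (d + 1) → ℝ) :
    simplexJac κ ν s x = jacobiHom (ν 0) (aParam κ ν 1) (κ 0) s (x 0) *
      simplexJac (Fin.tail κ) (Fin.tail ν) (s - x 0) (Fin.tail x) := by
  rw [simplexJac, Fin.prod_univ_succ, simplexJac]
  congr 1
  · simp [headSum_zero]
  · refine prod_congr rfl fun i _ => ?_
    rw [Fin.val_succ, headSum_succ, aParam_add_two, sub_add_eq_sub_sub]
    rfl

/-- `y` without its second entry. -/
def dropSecond {M : Type*} {k : ℕ} (y : Fin (k + 1 + 1) → M) : Fin (k + 1) → M :=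
  Fin.cons (y 0) (Fin.tail (Fin.tail y))

/-- Cyclic rotation of the entries. -/
def rot {M : Type*} {k : ℕ} (y : Fin (k + 1) → M) : Fin (k + 1) → M :=
  Fin.snoc (Fin.tail y) (y 0)

theorem rot_zero {M : Type*} {k : ℕ} (y : Fin (k + 1 + 1) → M) : rot y 0 = y 1 := by
  rw [rot, ← Fin.castSucc_zero, Fin.snoc_castSucc]; rfl

/-- The rotation brings the second entry to the front; what follows is the shorter rotation of the
remaining entries. With `tail_permParam_cyclicPerm` this drives every induction on the dimension for
the cycle. -/
theorem tail_rot {M : Type*} {k : ℕ} (y : Fin (k + 1 + 1) → M) :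
    Fin.tail (rot y) = rot (dropSecond y) := by
  funext i
  refine Fin.lastCases ?_ (fun i => ?_) i
  · rw [Fin.tail, Fin.succ_last, rot, rot, Fin.snoc_last, Fin.snoc_last]; rfl
  · rw [Fin.tail, ← Fin.castSucc_succ, rot, rot, Fin.snoc_castSucc, Fin.snoc_castSucc]; rfl

theorem cyclicPerm_castSucc_last (m : ℕ) : cyclicPerm m (Fin.castSucc (Fin.last m)) = 0 :=
  Fin.cycleRange_self _

theorem cyclicPerm_castSucc_castSucc (m : ℕ) (i : Fin m) :
    cyclicPerm m (Fin.castSucc (Fin.castSucc i)) = Fin.castSucc i.succ := by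
  rw [cyclicPerm, Fin.cycleRange_of_lt (by simp [Fin.lt_def])]
  ext
  rw [Fin.val_add_one_of_lt (by simp only [Fin.lt_def, Fin.val_castSucc, Fin.val_last]; omega)]
  simp

theorem cyclicPerm_last (m : ℕ) : cyclicPerm m (Fin.last (m + 1)) = Fin.last (m + 1) :=
  Fin.cycleRange_of_gt (by simp [Fin.lt_def])

theorem permPoint_cyclicPerm {m : ℕ} (x : Fin (m + 1) → ℝ) :
    permPoint (cyclicPerm m) x = rot x := by
  funext i
  refine Fin.lastCases ?_ (fun i => ?_) i
  · rw [permPoint, cyclicPerm_castSucc_last, rot, Fin.snoc_last, ← Fin.castSucc_zero,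
      Fin.snoc_castSucc]
  · rw [permPoint, cyclicPerm_castSucc_castSucc, rot, Fin.snoc_castSucc, Fin.snoc_castSucc]; rfl

theorem permParam_cyclicPerm {m : ℕ} (κ : Fin (m + 1 + 1) → ℝ) :
    permParam (cyclicPerm m) κ = Fin.snoc (rot (Fin.init κ)) (κ (Fin.last (m + 1))) := by
  funext i
  refine Fin.lastCases ?_ (fun i => ?_) i
  · rw [permParam, cyclicPerm_last, Fin.snoc_last]
  · rw [Fin.snoc_castSucc]
    refine Fin.lastCases ?_ (fun i => ?_) i
    · rw [permParam, cyclicPerm_castSucc_last, rot, Fin.snoc_last]; rfl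
    · rw [permParam, cyclicPerm_castSucc_castSucc, rot, Fin.snoc_castSucc]; rfl

theorem permParam_cyclicPerm_zero {m : ℕ} (κ : Fin (m + 1 + 1 + 1) → ℝ) :
    permParam (cyclicPerm (m + 1)) κ 0 = κ 1 :=
  congrArg κ (cyclicPerm_castSucc_castSucc (m + 1) 0)

theorem tail_permParam_cyclicPerm {m : ℕ} (κ : Fin (m + 1 + 1 + 1) → ℝ) :
    Fin.tail (permParam (cyclicPerm (m + 1)) κ) = permParam (cyclicPerm m) (dropSecond κ) := by
  rw [permParam_cyclicPerm, permParam_cyclicPerm]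
  funext i
  refine Fin.lastCases ?_ (fun i => ?_) i
  · rw [Fin.tail, Fin.succ_last, Fin.snoc_last, Fin.snoc_last, ← Fin.succ_last (m + 1),
      ← Fin.succ_last m]
    rfl
  · rw [Fin.tail, ← Fin.castSucc_succ, Fin.snoc_castSucc, Fin.snoc_castSucc]
    have h := congrFun (tail_rot (Fin.init κ)) i
    rw [Fin.tail] at h
    rw [h]
    congr 1
    funext j
    refine Fin.cases rfl (fun j => rfl) j

theorem sum_permParam {m : ℕ} (τ : Equiv.Perm (Fin (m + 1))) (κ : Fin (m + 1) → ℝ) :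
    ∑ i, permParam τ κ i = ∑ i, κ i := Equiv.sum_comp τ κ

/-! ### Existence of the connection coefficients -/

theorem jacobiHom_swap {κ₀ κ₁ α : ℝ} (h₀ : -1 < κ₀) (h₁ : -1 < κ₁) (hα : -1 < α) (p q : ℕ)
    (s x y : ℝ) :
    jacobiHom p (α + κ₀ + 2 * q + 1) κ₁ s y * jacobiHom q α κ₀ (s - y) x =
      ∑ q' ∈ range (p + q + 1), triCoef κ₀ κ₁ α p q (p + q - q') q' *
        (jacobiHom (p + q - q') (α + κ₁ + 2 * q' + 1) κ₀ s x * jacobiHom q' α κ₁ (s - x) y) := by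
  have h := triJac_swap (κ₀ := κ₀) h₁ hα p q x y (s - x - y)
  have hn : ∀ k : ℕ, (0 : ℝ) ≤ k := Nat.cast_nonneg
  rw [jacobiHom_eq_jac _ (by linarith [hn q]), jacobiHom_eq_jac _ hα]
  rw [triJac, show y + x + (s - x - y) = s by ring, show x + (s - x - y) = s - y by ring] at h
  rw [show s - y - x = s - x - y by ring, h]
  refine sum_congr rfl fun q' _ => ?_
  rw [jacobiHom_eq_jac _ (by linarith [hn q']), jacobiHom_eq_jac _ hα, triJac, smul_eq_mul,
    show x + y + (s - x - y) = s by ring, show y + (s - x - y) = s - x by ring]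

/-- The connection coefficients for the cyclic permutation, computed by one transposition and
a shorter cyclic permutation. -/
def cycCoef : (m : ℕ) → (Fin (m + 1 + 1) → ℝ) → (Fin (m + 1) → ℕ) → (Fin (m + 1) → ℕ) → ℝ
  | 0, _, _, _ => 1
  | m + 1, κ, ν, μ =>
    -- The transposition preserves the joint degree of the first two factors, so the intermediate
    -- index must begin with `μ 0 + μ 1 - ν 0`; without such an index the coefficient is zero.
    if ν 0 ≤ μ 0 + μ 1 then
      triCoef (κ 0) (κ 1) (aParam κ μ 2) (ν 0) (μ 0 + μ 1 - ν 0) (μ 0) (μ 1) *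
        cycCoef m (dropSecond κ) (Fin.tail ν)
          (Fin.cons (μ 0 + μ 1 - ν 0) (Fin.tail (Fin.tail μ)))
    else 0

theorem mem_multiIdx {d n : ℕ} {ν : Fin d → ℕ} : ν ∈ multiIdx d n ↔ ∑ i, ν i = n := by
  simp [multiIdx]

/-- Peel off the first rotated coordinate, apply the shorter rotation to the rest, then exchange the
first two variables. The scale `s` is kept free because peeling replaces it by `s - x 1`. -/
theorem simplexJac_rot (m : ℕ) (κ : Fin (m + 1 + 1) → ℝ) (hκ : ∀ i, -1 < κ i)
    (ν : Fin (m + 1) → ℕ) (s : ℝ) (x : Fin (m + 1) → ℝ) :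
    simplexJac (permParam (cyclicPerm m) κ) ν s (rot x) =
      ∑ μ ∈ multiIdx (m + 1) (∑ i, ν i), cycCoef m κ ν μ * simplexJac κ μ s x := by
  induction m generalizing s with
  | zero =>
    have e1 : permParam (cyclicPerm 0) κ = κ := by
      funext i
      fin_cases i
      · exact congrArg κ (cyclicPerm_castSucc_last 0)
      · exact congrArg κ (cyclicPerm_last 0)
    have e2 : rot x = x := by funext i; fin_cases i; rfl
    rw [e1, e2, sum_eq_single ν]
    · simp [cycCoef]
    · intro μ hμ hne
      rw [mem_multiIdx] at hμ
      refine absurd ?_ hne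
      funext i
      fin_cases i
      simpa using hμ
    · intro h
      exact absurd (mem_multiIdx.mpr rfl) h
  | succ m ih =>
    have hκ' : ∀ i, -1 < dropSecond κ i := fun i => by
      refine Fin.cases ?_ (fun i => ?_) i
      · exact hκ 0
      · exact hκ i.succ.succ
    rw [simplexJac_succ, rot_zero, tail_rot, permParam_cyclicPerm_zero, tail_permParam_cyclicPerm,
      ih _ hκ']
    simp only [cycCoef, ite_mul, zero_mul]
    rw [← sum_filter, mul_sum]
    have key : ∀ μ' ∈ multiIdx (m + 1) (∑ i, Fin.tail ν i),
        jacobiHom (ν 0) (aParam (permParam (cyclicPerm (m + 1)) κ) ν 1) (κ 1) s (x 1) *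
          (cycCoef m (dropSecond κ) (Fin.tail ν) μ' *
            simplexJac (dropSecond κ) μ' (s - x 1) (dropSecond x)) =
        ∑ q' ∈ range (ν 0 + μ' 0 + 1),
          triCoef (κ 0) (κ 1) (aParam (dropSecond κ) μ' 1) (ν 0) (μ' 0) (ν 0 + μ' 0 - q') q' *
            cycCoef m (dropSecond κ) (Fin.tail ν) μ' *
            simplexJac κ (Fin.cons (ν 0 + μ' 0 - q') (Fin.cons q' (Fin.tail μ'))) s x := by
      intro μ' hμ'
      rw [mem_multiIdx] at hμ'
      -- This parameter depends only on the totals of the remaining parameters and degrees, and the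
      -- shorter rotation preserves both totals.
      have ha : aParam (permParam (cyclicPerm (m + 1)) κ) ν 1 =
          aParam (dropSecond κ) μ' 1 + κ 0 + 2 * (μ' 0 : ℕ) + 1 := by
        rw [aParam_one, aParam_one, tail_permParam_cyclicPerm, sum_permParam, ← hμ',
          Fin.sum_univ_succ (dropSecond κ), Fin.sum_univ_succ μ']
        simp only [Fin.tail, dropSecond, Fin.cons_zero, Fin.cons_succ]
        push_cast
        ring
      have hα := neg_one_lt_aParam (dropSecond κ) hκ' μ' 0
      rw [Fin.val_zero, zero_add] at hα
      rw [ha, simplexJac_succ (dropSecond κ)]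
      have e := jacobiHom_swap (hκ 0) (hκ 1) hα (ν 0) (μ' 0) s (x 0) (x 1)
      have e0 : dropSecond κ 0 = κ 0 := rfl
      have e0' : dropSecond x 0 = x 0 := rfl
      have e1 : Fin.tail (dropSecond κ) = Fin.tail (Fin.tail κ) := rfl
      have e1' : Fin.tail (dropSecond x) = Fin.tail (Fin.tail x) := rfl
      rw [e0, e0', e1, e1', show ∀ a b c d : ℝ, a * (b * (c * d)) = (a * c) * (b * d) by
        intros; ring, e, sum_mul]
      refine sum_congr rfl fun q' hq' => ?_
      rw [simplexJac_succ κ, simplexJac_succ (Fin.tail κ), Fin.cons_zero, Fin.tail_cons,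
        Fin.cons_zero, Fin.tail_cons]
      have a2 : aParam (Fin.tail κ) (Fin.cons q' (Fin.tail μ')) 1 =
          aParam (dropSecond κ) μ' 1 := by
        rw [aParam_one, aParam_one, Fin.tail_cons]; rfl
      have a1 : aParam κ (Fin.cons (ν 0 + μ' 0 - q') (Fin.cons q' (Fin.tail μ'))) 1 =
          aParam (dropSecond κ) μ' 1 + κ 1 + 2 * q' + 1 := by
        rw [aParam_eq_add _ _ (by omega), aParam_add_two, Fin.tail_cons, a2]
        rfl
      rw [a1, a2, show s - x 1 - x 0 = s - x 0 - x 1 by ring]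
      simp only [Fin.tail, Fin.succ_zero_eq_one]
      ring
    rw [sum_congr rfl key, sum_sigma']
    -- Pairs of an intermediate index `μ'` and an exchange index `q'` correspond to the final
    -- indices `μ` with `ν 0 ≤ μ 0 + μ 1`.
    refine sum_nbij' (fun z => Fin.cons (ν 0 + z.1 0 - z.2) (Fin.cons z.2 (Fin.tail z.1)))
      (fun μ => ⟨Fin.cons (μ 0 + μ 1 - ν 0) (Fin.tail (Fin.tail μ)), μ 1⟩) ?_ ?_ ?_ ?_ ?_
    · rintro ⟨μ', q'⟩ hz
      simp only [mem_sigma, mem_multiIdx, mem_range] at hz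
      obtain ⟨h1, h2⟩ := hz
      rw [mem_filter, mem_multiIdx, Fin.sum_univ_succ, Fin.sum_univ_succ]
      rw [Fin.sum_univ_succ μ'] at h1
      rw [Fin.sum_univ_succ ν]
      have e1 : (Fin.cons (ν 0 + μ' 0 - q') (Fin.cons q' (Fin.tail μ')) : Fin (m + 1 + 1) → ℕ) 1
        = q' := rfl
      simp only [Fin.cons_zero, Fin.cons_succ, Fin.tail, e1] at h1 ⊢
      omega
    · intro μ hμ
      rw [mem_filter, mem_multiIdx, Fin.sum_univ_succ, Fin.sum_univ_succ, Fin.sum_univ_succ ν]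
        at hμ
      rw [mem_sigma, mem_multiIdx, mem_range, Fin.sum_univ_succ]
      simp only [Fin.cons_zero, Fin.cons_succ, Fin.tail, Fin.succ_zero_eq_one] at hμ ⊢
      omega
    · rintro ⟨μ', q'⟩ hz
      simp only [mem_sigma, mem_multiIdx, mem_range] at hz
      have e1 : (Fin.cons (ν 0 + μ' 0 - q') (Fin.cons q' (Fin.tail μ')) : Fin (m + 1 + 1) → ℕ) 1
        = q' := rfl
      simp only [Fin.cons_zero, Fin.tail_cons, e1]
      rw [show ν 0 + μ' 0 - q' + q' - ν 0 = μ' 0 by omega, Fin.cons_self_tail]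
    · intro μ hμ
      rw [mem_filter] at hμ
      simp only [Fin.cons_zero, Fin.tail_cons]
      rw [show ν 0 + (μ 0 + μ 1 - ν 0) - μ 1 = μ 0 by omega]
      have : (Fin.cons (μ 1) (Fin.tail (Fin.tail μ)) : Fin (m + 1) → ℕ) = Fin.tail μ :=
        Fin.cons_self_tail (Fin.tail μ)
      rw [this, Fin.cons_self_tail]
    · rintro ⟨μ', q'⟩ hz
      simp only [mem_sigma, mem_multiIdx, mem_range] at hz
      have e1 : (Fin.cons (ν 0 + μ' 0 - q') (Fin.cons q' (Fin.tail μ')) : Fin (m + 1 + 1) → ℕ) 1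
        = q' := rfl
      have a2 : aParam κ (Fin.cons (ν 0 + μ' 0 - q') (Fin.cons q' (Fin.tail μ'))) 2 =
          aParam (dropSecond κ) μ' 1 := by
        rw [aParam_add_two κ _ 0, Fin.tail_cons, zero_add, aParam_one, aParam_one,
          Fin.tail_cons]; rfl
      simp only [Fin.cons_zero, Fin.tail_cons, e1]
      rw [show ν 0 + μ' 0 - q' + q' - ν 0 = μ' 0 by omega, Fin.cons_self_tail, a2]

end SimplexJacobi

end

noncomputable section

namespace SimplexJacobi

open Finset

/-! ### Closed forms of the connection coefficients -/

/-- The factor of index `i` of the Racah polynomial in `cycCoef_eq`. -/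
def racahLevel {m : ℕ} (κ : Fin (m + 1 + 1) → ℝ) (ν μ : Fin (m + 1) → ℕ) (i : Fin m) : ℝ :=
  hyp43 (μ i.succ) (μ i.succ + (aParam κ μ (i + 2) + κ i.succ.castSucc + 1))
    (-((tailSum ν (i + 2) : ℕ) - (tailSum μ (i + 3) : ℕ) : ℝ))
    ((tailSum ν (i + 2) : ℕ) - (tailSum μ (i + 3) : ℕ) + aParam κ μ (i + 2) + κ 0 + 1)
    (aParam κ μ (i + 2) + 1)
    (aParam κ μ (i + 2) + κ 0 + κ i.succ.castSucc + 2 +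
      ((tailSum ν (i + 1) : ℕ) - (tailSum μ (i + 3) : ℕ)))
    (-((tailSum ν (i + 1) : ℕ) - (tailSum μ (i + 3) : ℕ) : ℝ))

/-- The factor of index `i` of the Racah polynomial in `cycCoef_eq_dual`. -/
def racahDualLevel {m : ℕ} (κ : Fin (m + 1 + 1) → ℝ) (ν μ : Fin (m + 1) → ℕ) (i : Fin m) : ℝ :=
  hyp43 (ν i.castSucc)
    (-((tailSum ν (i + 2) : ℕ) - (tailSum μ (i + 3) : ℕ)) -
      ((tailSum ν (i + 1) : ℕ) - (tailSum μ (i + 3) : ℕ)) - aParam κ μ (i + 2) - κ 0 - 1)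
    (-((tailSum ν (i + 1) : ℕ) - (tailSum μ (i + 2) : ℕ) : ℝ))
    (-μ i.succ - ((tailSum ν (i + 1) : ℕ) - (tailSum μ (i + 3) : ℕ)) -
      (aParam κ μ (i + 2) + κ i.succ.castSucc + 1))
    (-(aParam κ μ (i + 2) + κ 0 + κ i.succ.castSucc + 2) -
      2 * ((tailSum ν (i + 1) : ℕ) - (tailSum μ (i + 3) : ℕ)) + 1)
    (-aParam κ μ (i + 2) - ((tailSum ν (i + 1) : ℕ) - (tailSum μ (i + 3) : ℕ)))
    (-((tailSum ν (i + 1) : ℕ) - (tailSum μ (i + 3) : ℕ) : ℝ))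

/-- The factor depending on `ν` in `cycCoef_eq`. -/
def rowFactor {m : ℕ} (κ : Fin (m + 1 + 1) → ℝ) (ν : Fin (m + 1) → ℕ) : ℝ :=
  ∏ i, poch (κ i.succ + 1) (ν i) / (ν i).factorial

/-- The factor depending on `μ` in `cycCoef_eq`. -/
def colFactor {m : ℕ} (κ : Fin (m + 1 + 1) → ℝ) (μ : Fin (m + 1) → ℕ) : ℝ :=
  (μ 0).factorial / poch (aParam κ μ 1 + 1) (μ 0) *
    ∏ i : Fin m, (poch (κ i.succ.castSucc + 1) (μ i.succ) *
      (poch (aParam κ μ (i + 2) + 1) (μ i.succ) *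
        poch (aParam κ μ (i + 2) + κ i.succ.castSucc + 1 + μ i.succ) (μ i.succ)))⁻¹

/-- The factor depending on `ν` in `cycCoef_eq_dual`. -/
def rowDual {m : ℕ} (κ : Fin (m + 1 + 1) → ℝ) (ν : Fin (m + 1) → ℕ) : ℝ :=
  poch (κ 0 + 1) (ν (Fin.last m)) * poch (κ (Fin.last (m + 1)) + 1) (ν (Fin.last m)) *
    ∏ i : Fin m, (((ν i.castSucc).factorial : ℝ))⁻¹

/-- The factor depending on `μ` in `cycCoef_eq_dual`. -/
def colDual {m : ℕ} (κ : Fin (m + 1 + 1) → ℝ) (μ : Fin (m + 1) → ℕ) : ℝ :=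
  (poch (κ 0 + 1) (μ 0) * poch (aParam κ μ 1 + 1) (μ 0))⁻¹ *
    ∏ i : Fin m, (poch (aParam κ μ (i + 2) + 1) (μ i.succ) *
        poch (aParam κ μ (i + 2) + κ i.succ.castSucc + 1 + μ i.succ) (μ i.succ))⁻¹

/-- In every summand either the upper parameter `-q` or the lower parameter `-n` produces a zero
factor. With this the closed forms vanish where `cycCoef` is zero by definition. -/
theorem hyp43_eq_zero {m q n : ℕ} (hq : q ≤ n) (hn : n < m) (X Z U V : ℝ) :
    hyp43 m X (-q) Z U V (-n) = 0 := by
  refine sum_eq_zero fun k hk => ?_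
  rcases Nat.lt_or_ge q k with h | h
  · rw [poch_neg_natCast_eq_zero h]; ring
  · have : -(n : ℝ) + k = -((n - k : ℕ) : ℝ) := by
      rw [Nat.cast_sub (h.trans hq)]; ring
    rw [this, poch_neg_natCast_eq_zero (by omega : n - k < m - k)]
    ring

/-- The level does not see the first entry of `μ`, so `j` is arbitrary. -/
theorem racahLevel_succ {m : ℕ} (κ : Fin (m + 1 + 1 + 1) → ℝ) (ν μ : Fin (m + 1 + 1) → ℕ)
    (j : ℕ) (i : Fin m) :
    racahLevel κ ν μ i.succ =
      racahLevel (dropSecond κ) (Fin.tail ν) (Fin.cons j (Fin.tail (Fin.tail μ))) i := by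
  unfold racahLevel
  rw [Fin.val_succ, show (i : ℕ) + 1 + 1 = i + 2 by ring, show (i : ℕ) + 1 + 2 = i + 1 + 2 by ring,
    show (i : ℕ) + 1 + 3 = i + 2 + 2 by ring]
  rw [aParam_add_two κ, aParam_add_two (Fin.tail κ), aParam_add_two (dropSecond κ),
    tailSum_add_two ν, tailSum_add_two ν, tailSum_add_two μ, tailSum_add_two (Fin.tail μ),
    tailSum_add_two (Fin.cons j (Fin.tail (Fin.tail μ))), Fin.tail_cons, Fin.cons_succ]
  rfl

theorem racahDualLevel_succ {m : ℕ} (κ : Fin (m + 1 + 1 + 1) → ℝ) (ν μ : Fin (m + 1 + 1) → ℕ)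
    (j : ℕ) (i : Fin m) :
    racahDualLevel κ ν μ i.succ =
      racahDualLevel (dropSecond κ) (Fin.tail ν) (Fin.cons j (Fin.tail (Fin.tail μ))) i := by
  unfold racahDualLevel
  rw [Fin.val_succ, show (i : ℕ) + 1 + 1 = i + 2 by ring, show (i : ℕ) + 1 + 2 = i + 1 + 2 by ring,
    show (i : ℕ) + 1 + 3 = i + 2 + 2 by ring]
  rw [aParam_add_two κ, aParam_add_two (Fin.tail κ), aParam_add_two (dropSecond κ),
    tailSum_add_two ν, tailSum_add_two ν, tailSum_add_two μ, tailSum_add_two μ,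
    tailSum_add_two (Fin.tail μ), tailSum_add_two (Fin.tail μ) i,
    tailSum_add_two (Fin.cons j (Fin.tail (Fin.tail μ))),
    tailSum_add_two (Fin.cons j (Fin.tail (Fin.tail μ))), Fin.tail_cons, Fin.cons_succ]
  rfl

/-- Descending through the tail sums, there is a level at which the inequality between those of `ν`
and `μ` first holds while the next one fails; the factor at that level vanishes. -/
theorem prod_racahLevel_eq_zero {m : ℕ} (κ : Fin (m + 1 + 1) → ℝ) (ν μ : Fin (m + 1) → ℕ)
    (h : (tailSum ν 1 : ℕ) < tailSum μ 2) : ∏ i, racahLevel κ ν μ i = 0 := by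
  induction m with
  | zero => simp [tailSum_eq_zero μ (j := 2) (by norm_num)] at h
  | succ m ih =>
    rw [Fin.prod_univ_succ]
    rcases Nat.lt_or_ge (tailSum ν 2) (tailSum μ 3) with h2 | h2
    · simp only [racahLevel_succ κ ν μ 0]
      rw [ih, mul_zero]
      rw [tailSum_add_two _ 0, Fin.tail_cons, zero_add]
      rwa [tailSum_add_two ν 0, tailSum_add_two μ 1, tailSum_add_two _ 0, zero_add] at h2
    · have e1 := tailSum_eq_add ν 0
      have e2 := tailSum_eq_add μ 1
      simp only [Fin.val_zero, zero_add, Fin.val_one] at e1 e2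
      norm_num at e2
      refine mul_eq_zero_of_left ?_ _
      have c1 : ((tailSum ν 2 : ℕ) : ℝ) - (tailSum μ 3 : ℕ) = (tailSum ν 2 - tailSum μ 3 : ℕ) := by
        rw [Nat.cast_sub h2]
      have c2 : ((tailSum ν 1 : ℕ) : ℝ) - (tailSum μ 3 : ℕ) = (tailSum ν 1 - tailSum μ 3 : ℕ) := by
        rw [Nat.cast_sub (by omega)]
      unfold racahLevel
      simp only [Fin.val_zero, zero_add]
      rw [c1, c2]
      exact hyp43_eq_zero (by omega) (by rw [Fin.succ_zero_eq_one]; omega) _ _ _ _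

theorem prod_racahDualLevel_eq_zero {m : ℕ} (κ : Fin (m + 1 + 1 + 1) → ℝ)
    (ν μ : Fin (m + 1 + 1) → ℕ) (h : ∑ i, ν i = ∑ i, μ i) (h' : μ 0 + μ 1 < ν 0) :
    ∏ i, racahDualLevel κ ν μ i = 0 := by
  rw [Fin.prod_univ_succ]
  refine mul_eq_zero_of_left ?_ _
  have e0 := tailSum_eq_add μ 0
  have e2 := tailSum_eq_add μ 1
  simp only [Fin.val_zero, zero_add, Fin.val_one] at e0 e2
  norm_num at e2
  rw [← tailSum_one, ← tailSum_one] at h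
  have c1 : ((tailSum ν 1 : ℕ) : ℝ) - (tailSum μ 2 : ℕ) = (μ 0 : ℕ) := by
    rw [h, e0]; push_cast; ring
  have c2 : ((tailSum ν 1 : ℕ) : ℝ) - (tailSum μ 3 : ℕ) = (μ 0 + μ 1 : ℕ) := by
    rw [h, e0, e2]; push_cast; ring
  unfold racahDualLevel
  simp only [Fin.val_zero, zero_add]
  rw [c1, c2]
  exact hyp43_eq_zero (by omega) h' _ _ _ _

theorem neg_one_lt_dropSecond {m : ℕ} {κ : Fin (m + 1 + 1) → ℝ} (hκ : ∀ i, -1 < κ i)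
    (i : Fin (m + 1)) : -1 < dropSecond κ i := by
  refine Fin.cases ?_ (fun i => ?_) i
  · exact hκ 0
  · exact hκ i.succ.succ

theorem aParam_dropSecond {m : ℕ} (κ : Fin (m + 1 + 1 + 1) → ℝ) (μ : Fin (m + 1 + 1) → ℕ)
    (q j : ℕ) : aParam (dropSecond κ) (Fin.cons q (Fin.tail (Fin.tail μ))) (j + 1) =
      aParam κ μ (j + 2) := by
  rcases j with _ | j
  · rw [aParam_add_two, zero_add, aParam_one, aParam_one, Fin.tail_cons]; rfl
  · rw [show j + 1 + 2 = j + 1 + 2 by rfl, aParam_add_two, aParam_add_two, aParam_add_two,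
      Fin.tail_cons]; rfl

theorem neg_one_pow_sum_succ {m : ℕ} (ν : Fin (m + 1 + 1) → ℕ) :
    (-1 : ℝ) ^ (∑ i, ν i + ν (Fin.last (m + 1))) =
      (-1) ^ ν 0 * (-1) ^ (∑ i, Fin.tail ν i + Fin.tail ν (Fin.last m)) := by
  rw [Fin.sum_univ_succ, add_assoc, pow_add]; rfl

/-- In the recursion the intermediate degree `q` enters, outside the hypergeometric factors, only
through `(α+1)_q / q!`. This cancels against the first factor of `colFactor` for the shorter cycle,
so the dependence on `ν` and `μ` separates. -/
theorem cycCoef_eq {m : ℕ} (κ : Fin (m + 1 + 1) → ℝ) (hκ : ∀ i, -1 < κ i)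
    (ν μ : Fin (m + 1) → ℕ) (h : ∑ i, ν i = ∑ i, μ i) :
    cycCoef m κ ν μ = (-1) ^ (∑ i, ν i + ν (Fin.last m)) *
      (rowFactor κ ν * colFactor κ μ * ∏ i, racahLevel κ ν μ i) := by
  induction m with
  | zero =>
    have h0 : ν 0 = μ 0 := by simpa using h
    have ha : aParam κ μ 1 = κ 1 := by
      rw [aParam_one]
      simp [Fin.tail]
    have n1 : poch (κ 1 + 1) (μ 0) ≠ 0 := poch_ne_zero (by linarith [hκ 1]) _
    have f1 := Nat.factorial_ne_zero (μ 0)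
    have hs : ∑ i, ν i = μ 0 := by simpa using h
    have hp : rowFactor κ ν = poch (κ 1 + 1) (μ 0) / (μ 0).factorial := by
      simp [rowFactor, h0]
    simp only [cycCoef, colFactor, hs, hp, h0, ha, prod_of_isEmpty, Fin.last_zero]
    rw [← two_mul (μ 0), pow_mul]
    field_simp
    norm_num
  | succ m ih =>
    rw [cycCoef]
    split_ifs with hle
    · set q := μ 0 + μ 1 - ν 0 with hq
      have e1 := tailSum_eq_add ν 0
      have e2 := tailSum_eq_add μ 0
      have e3 := tailSum_eq_add μ 1
      simp only [Fin.val_zero, zero_add, Fin.val_one] at e1 e2 e3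
      norm_num at e3
      have h' := h
      rw [← tailSum_one, ← tailSum_one] at h'
      have c1 : ((tailSum ν 2 : ℕ) : ℝ) - (tailSum μ 3 : ℕ) = (q : ℕ) := by
        rw [sub_eq_iff_eq_add]; norm_cast; omega
      have c2 : ((tailSum ν 1 : ℕ) : ℝ) - (tailSum μ 3 : ℕ) = (ν 0 + q : ℕ) := by
        rw [sub_eq_iff_eq_add]; norm_cast; omega
      rw [ih (dropSecond κ) (neg_one_lt_dropSecond hκ) (Fin.tail ν)
        (Fin.cons q (Fin.tail (Fin.tail μ))), neg_one_pow_sum_succ, Fin.prod_univ_succ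
        (racahLevel κ ν μ)]
      · simp only [racahLevel_succ κ ν μ q]
        rw [triCoef, racahLevel]
        simp only [Fin.val_zero, zero_add, c1, c2]
        have r1 : rowFactor κ ν = poch (κ 1 + 1) (ν 0) / (ν 0).factorial *
            rowFactor (dropSecond κ) (Fin.tail ν) := by
          rw [rowFactor, Fin.prod_univ_succ]; rfl
        have r2 : colFactor κ μ = (μ 0).factorial / poch (aParam κ μ 1 + 1) (μ 0) *
            ((poch (κ 1 + 1) (μ 1) * (poch (aParam κ μ 2 + 1) (μ 1) *
              poch (aParam κ μ 2 + κ 1 + 1 + μ 1) (μ 1)))⁻¹ *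
            (colFactor (dropSecond κ) (Fin.cons q (Fin.tail (Fin.tail μ))) /
              (q.factorial / poch (aParam κ μ 2 + 1) q))) := by
          have f1 := Nat.factorial_ne_zero q
          have n2 : poch (aParam κ μ 2 + 1) q ≠ 0 := poch_ne_zero (by
            have := neg_one_lt_aParam κ hκ μ 1
            rw [Fin.val_one] at this
            linarith) _
          rw [colFactor, colFactor, Fin.prod_univ_succ, aParam_dropSecond κ μ q 0, Fin.cons_zero,
            mul_div_cancel_left₀ _ (div_ne_zero (by exact_mod_cast f1) n2)]
          congr 2
          refine prod_congr rfl fun i _ => ?_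
          rw [Fin.val_succ, aParam_dropSecond κ μ q (i + 1)]
          rfl
        have a1 : aParam κ μ 2 + κ 1 + 1 + 2 * (μ 1 : ℕ) + 1 = aParam κ μ 1 + 1 := by
          rw [aParam_eq_add κ μ (j := 1) (by omega)]
          have : (Fin.castSucc ⟨1, by omega⟩ : Fin (m + 1 + 1 + 1)) = 1 := rfl
          rw [this]
          have : (⟨1, by omega⟩ : Fin (m + 1 + 1)) = 1 := rfl
          rw [this]
          ring
        have b2 := neg_one_lt_aParam κ hκ μ 1
        rw [Fin.val_one] at b2
        have n2 : poch (aParam κ μ 2 + 1) q ≠ 0 := poch_ne_zero (by linarith) _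
        have k1 : κ (Fin.succ 0 : Fin (m + 1 + 1)).castSucc = κ 1 := rfl
        have k2 : μ (Fin.succ (0 : Fin (m + 1))) = μ 1 := rfl
        rw [r1, r2, a1, k1, k2]
        simp only [div_eq_mul_inv, mul_inv, inv_inv]
        have n2' : poch (aParam κ μ 2 + 1) q * (poch (aParam κ μ 2 + 1) q)⁻¹ = 1 :=
          mul_inv_cancel₀ n2
        ring
      · simp only [Fin.sum_univ_succ, Fin.cons_zero, Fin.cons_succ, Fin.tail,
          Fin.succ_zero_eq_one] at h ⊢
        omega
    · rw [Fin.prod_univ_succ]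
      simp only [racahLevel_succ κ ν μ 0]
      rw [prod_racahLevel_eq_zero (dropSecond κ)]
      · ring
      · rw [← tailSum_one, ← tailSum_one] at h
        have e1 := tailSum_eq_add ν 0
        have e2 := tailSum_eq_add μ 0
        have e3 := tailSum_eq_add μ 1
        simp only [Fin.val_zero, zero_add, Fin.val_one] at e1 e2 e3
        norm_num at e3
        have t1 : tailSum ν 2 = tailSum (Fin.tail ν) 1 := tailSum_add_two ν 0
        have t3 : tailSum μ 3 = tailSum (Fin.tail (Fin.tail μ)) 1 :=
          (tailSum_add_two μ 1).trans (tailSum_add_two (Fin.tail μ) 0)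
        rw [tailSum_add_two _ 0, Fin.tail_cons, zero_add]
        omega

/-- The same induction starting from the second form `triDual`; now `(κ₀+1)_q (α+1)_q` cancels
against the first factor of `colDual`. -/
theorem cycCoef_eq_dual {m : ℕ} (κ : Fin (m + 1 + 1) → ℝ) (hκ : ∀ i, -1 < κ i)
    (ν μ : Fin (m + 1) → ℕ) (h : ∑ i, ν i = ∑ i, μ i) :
    cycCoef m κ ν μ = (-1) ^ (∑ i, ν i + ν (Fin.last m)) *
      (rowDual κ ν * colDual κ μ * ∏ i, racahDualLevel κ ν μ i) := by
  induction m with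
  | zero =>
    have h0 : ν 0 = μ 0 := by simpa using h
    have ha : aParam κ μ 1 = κ 1 := by
      rw [aParam_one]
      simp [Fin.tail]
    have n1 : poch (κ 1 + 1) (μ 0) ≠ 0 := poch_ne_zero (by linarith [hκ 1]) _
    have n2 : poch (κ 0 + 1) (μ 0) ≠ 0 := poch_ne_zero (by linarith [hκ 0]) _
    have hl : κ (Fin.last (0 + 1)) = κ 1 := rfl
    have hs : ∑ i, ν i = μ 0 := by simpa using h
    simp only [cycCoef, rowDual, colDual, hs, h0, ha, prod_of_isEmpty, Fin.last_zero, hl]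
    rw [← two_mul (μ 0), pow_mul]
    field_simp
    norm_num
  | succ m ih =>
    rw [cycCoef]
    split_ifs with hle
    · set q := μ 0 + μ 1 - ν 0 with hq
      have e1 := tailSum_eq_add ν 0
      have e2 := tailSum_eq_add μ 0
      have e3 := tailSum_eq_add μ 1
      simp only [Fin.val_zero, zero_add, Fin.val_one] at e1 e2 e3
      norm_num at e3
      have h' := h
      rw [← tailSum_one, ← tailSum_one] at h'
      have c1 : ((tailSum ν 2 : ℕ) : ℝ) - (tailSum μ 3 : ℕ) = (q : ℕ) := by
        rw [sub_eq_iff_eq_add]; norm_cast; omega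
      have c2 : ((tailSum ν 1 : ℕ) : ℝ) - (tailSum μ 3 : ℕ) = (ν 0 + q : ℕ) := by
        rw [sub_eq_iff_eq_add]; norm_cast; omega
      have c3 : ((tailSum ν 1 : ℕ) : ℝ) - (tailSum μ 2 : ℕ) = (μ 0 : ℕ) := by
        rw [sub_eq_iff_eq_add]; norm_cast; omega
      have b2 := neg_one_lt_aParam κ hκ μ 1
      rw [Fin.val_one] at b2
      rw [triCoef_eq_triDual (hκ 0) (hκ 1) b2 (by omega),
        ih (dropSecond κ) (neg_one_lt_dropSecond hκ) (Fin.tail ν)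
        (Fin.cons q (Fin.tail (Fin.tail μ))), neg_one_pow_sum_succ, Fin.prod_univ_succ
        (racahDualLevel κ ν μ)]
      · simp only [racahDualLevel_succ κ ν μ q]
        rw [triDual, racahDualLevel]
        simp only [Fin.val_zero, zero_add, c1, c2, c3]
        have n2 : poch (aParam κ μ 2 + 1) q ≠ 0 := poch_ne_zero (by linarith) _
        have n3 : poch (κ 0 + 1) q ≠ 0 := poch_ne_zero (by linarith [hκ 0]) _
        have r1 : rowDual κ ν = ((ν 0).factorial : ℝ)⁻¹ *
            rowDual (dropSecond κ) (Fin.tail ν) := by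
          rw [rowDual, Fin.prod_univ_succ, mul_left_comm]; rfl
        have r2 : colDual κ μ = (poch (κ 0 + 1) (μ 0) * poch (aParam κ μ 1 + 1) (μ 0))⁻¹ *
            ((poch (aParam κ μ 2 + 1) (μ 1) *
              poch (aParam κ μ 2 + κ 1 + 1 + μ 1) (μ 1))⁻¹ *
            (colDual (dropSecond κ) (Fin.cons q (Fin.tail (Fin.tail μ))) *
              (poch (κ 0 + 1) q * poch (aParam κ μ 2 + 1) q))) := by
          have z : dropSecond κ 0 = κ 0 := rfl
          rw [colDual, colDual, Fin.prod_univ_succ, aParam_dropSecond κ μ q 0, Fin.cons_zero,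
            z, mul_right_comm, inv_mul_cancel₀ (mul_ne_zero n3 n2), one_mul]
          congr 2
          refine prod_congr rfl fun i _ => ?_
          rw [Fin.val_succ, aParam_dropSecond κ μ q (i + 1)]
          rfl
        have a1 : aParam κ μ 2 + κ 1 + 1 + 2 * (μ 1 : ℕ) + 1 = aParam κ μ 1 + 1 := by
          rw [aParam_eq_add κ μ (j := 1) (by omega)]
          have : (Fin.castSucc ⟨1, by omega⟩ : Fin (m + 1 + 1 + 1)) = 1 := rfl
          rw [this]
          have : (⟨1, by omega⟩ : Fin (m + 1 + 1)) = 1 := rfl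
          rw [this]
          ring
        have k1 : κ (Fin.succ 0 : Fin (m + 1 + 1)).castSucc = κ 1 := rfl
        have k2 : μ (Fin.succ (0 : Fin (m + 1))) = μ 1 := rfl
        have k3 : ν (Fin.castSucc (0 : Fin (m + 1))) = ν 0 := rfl
        rw [r1, r2, a1, k1, k2, k3]
        simp only [div_eq_mul_inv, mul_inv]
        ring
      · simp only [Fin.sum_univ_succ, Fin.cons_zero, Fin.cons_succ, Fin.tail,
          Fin.succ_zero_eq_one] at h ⊢
        omega
    · rw [prod_racahDualLevel_eq_zero κ ν μ h (by omega)]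
      ring

end SimplexJacobi

end

noncomputable section

namespace SimplexJacobi

open Finset

/-! ### Comparison with the Racah polynomials -/

theorem padded_revSums {m : ℕ} (ν : Fin (m + 1) → ℕ) {j : ℕ} (hj : j ≤ m + 1) :
    padded (∑ i, ν i) (revSums ν) j = tailSum ν (m + 2 - j) := by
  unfold padded revSums
  split_ifs with h1 h2
  · rw [h1, tailSum_eq_zero ν (by omega)]
  · rw [show m + 2 - j = m + 1 - (j - 1) by omega]
  · rw [show m + 2 - j = 1 by omega, tailSum_one]

theorem padded_initSums {m : ℕ} (μ : Fin (m + 1) → ℕ) {j : ℕ} (hj : j ≤ m + 1) :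
    padded (∑ i, μ i) (initSums μ) j = headSum μ j := by
  unfold padded initSums
  split_ifs with h1 h2
  · rw [h1, headSum_zero]
  · rw [show j - 1 + 1 = j by omega]
  · have : j = m + 1 := by omega
    have h := headSum_add_tailSum μ j
    rw [tailSum_eq_zero μ (by omega)] at h
    exact h.symm

theorem headSum_eq_sub {k : ℕ} (y : Fin k → ℕ) (j : ℕ) :
    ((headSum y j : ℕ) : ℝ) = (∑ i, y i : ℕ) - (tailSum y (j + 1) : ℕ) := by
  rw [← headSum_add_tailSum y j]
  push_cast
  ring

theorem headSum_revIdx {m : ℕ} (μ : Fin (m + 1) → ℕ) (i : Fin m) :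
    headSum (revIdx μ) (Fin.rev i) = tailSum μ (i + 3) := by
  unfold headSum tailSum revIdx
  rw [Fin.sum_univ_succ, if_neg (by simp), zero_add, ← Equiv.sum_comp Fin.revPerm]
  refine sum_congr rfl fun j _ => ?_
  simp only [Fin.revPerm_apply, Fin.rev_rev, Fin.val_rev, Fin.val_succ]
  have := i.2
  have := j.2
  by_cases h : (i : ℕ) < j
  · rw [if_pos (by omega), if_pos (by omega)]
  · rw [if_neg (by omega), if_neg (by omega)]

theorem headSum_initIdx {m : ℕ} (ν : Fin (m + 1) → ℕ) (i : Fin m) :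
    headSum (initIdx ν) i = headSum ν i := by
  unfold headSum initIdx
  rw [Fin.sum_univ_castSucc, if_neg (by simp only [Fin.val_last]; omega), add_zero]
  rfl

theorem tailSum_castSucc {m : ℕ} (κ : Fin (m + 1 + 1) → ℝ) (i : Fin m) :
    tailSum κ (i + 2) = κ i.succ.castSucc + tailSum κ (i + 3) := by
  have h := tailSum_eq_add κ i.succ.castSucc
  simpa using h

/-- The factors are matched in reverse order: partial sums of the reversed `μ` are tail sums of `μ`,
and the grid points are tail sums of `ν`. -/
theorem racahPoly_rev {m : ℕ} (κ : Fin (m + 1 + 1) → ℝ) (ν μ : Fin (m + 1) → ℕ) :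
    racahPoly m (betaParam m κ) (∑ i, ν i) (revIdx μ) (revSums ν) =
      ∏ i, racahLevel κ ν μ i := by
  unfold racahPoly
  rw [← Equiv.prod_comp Fin.revPerm]
  refine prod_congr rfl fun i _ => ?_
  have hi := i.2
  have e1 : revIdx μ (Fin.revPerm i) = μ i.succ := by simp [revIdx]
  have v : ((Fin.revPerm i : Fin m) : ℕ) = m - (i + 1) := by simp [Fin.val_rev]
  have e2 : headSum (revIdx μ) (Fin.revPerm i : Fin m) = tailSum μ (i + 3) := by
    rw [Fin.revPerm_apply, headSum_revIdx]
  rw [e1, e2, v, padded_revSums ν (by omega), padded_revSums ν (by omega),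
    show m + 2 - (m - (i + 1) + 1) = i + 2 by omega,
    show m + 2 - (m - (i + 1) + 2) = i + 1 by omega]
  have b0 : betaParam m κ 0 = κ 0 := by
    rw [betaParam, tailSum_eq_zero κ (by omega)]; simp
  have b1 : betaParam m κ (m - (i + 1) + 1) = κ 0 + tailSum κ (i + 3) + (m - i) := by
    rw [betaParam, show m + 1 + 2 - (m - (i + 1) + 1) = (i : ℕ) + 3 by omega,
      show m - (i + 1) + 1 = m - (i : ℕ) by omega, Nat.cast_sub (by omega)]
  have b2 : betaParam m κ (m - (i + 1) + 2) =
      κ 0 + (κ i.succ.castSucc + tailSum κ (i + 3)) + (m - i) + 1 := by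
    rw [betaParam, show m + 1 + 2 - (m - (i + 1) + 2) = (i : ℕ) + 2 by omega, tailSum_castSucc,
      show m - (i + 1) + 2 = m - (i : ℕ) + 1 by omega, Nat.cast_add, Nat.cast_sub (by omega)]
    push_cast
    ring
  have a : aParam κ μ (i + 2) = tailSum κ (i + 3) + 2 * (tailSum μ (i + 3) : ℕ) + m - i - 1 := by
    rw [aParam]
    push_cast
    ring
  rw [b0, b1, b2, racahLevel, a]
  congr 1 <;> ring

/-- Here the order is kept. Head sums are `n` minus tail sums, and the term `-2n` in the dual
parameters absorbs the resulting multiples of `n`. -/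
theorem racahPoly_init {m : ℕ} (κ : Fin (m + 1 + 1) → ℝ) (ν μ : Fin (m + 1) → ℕ)
    (h : ∑ i, ν i = ∑ i, μ i) :
    racahPoly m (betaDual m κ (∑ i, μ i)) (∑ i, μ i) (initIdx ν) (initSums μ) =
      ∏ i, racahDualLevel κ ν μ i := by
  unfold racahPoly
  refine prod_congr rfl fun i _ => ?_
  have hi := i.2
  have e1 : initIdx ν i = ν i.castSucc := rfl
  rw [e1, headSum_initIdx, padded_initSums μ (by omega), padded_initSums μ (by omega)]
  simp only [headSum_eq_sub, h]
  set n := ∑ i, μ i with hn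
  have b0 : betaDual m κ n 0 = κ 0 := by rw [betaDual, if_pos rfl]
  have b1 : betaDual m κ n (i + 1) =
      -(κ i.succ.castSucc + tailSum κ (i + 3)) - 2 * n - m + i := by
    rw [betaDual, if_neg (by omega), show (i : ℕ) + 1 + 1 = i + 2 by ring, tailSum_castSucc]
    push_cast
    ring
  have b2 : betaDual m κ n (i + 2) = -tailSum κ (i + 3) - 2 * n - m + i + 1 := by
    rw [betaDual, if_neg (by omega), show (i : ℕ) + 2 + 1 = i + 3 by ring]
    push_cast
    ring
  have a : aParam κ μ (i + 2) = tailSum κ (i + 3) + 2 * (tailSum μ (i + 3) : ℕ) + m - i - 1 := by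
    rw [aParam]
    push_cast
    ring
  have c1 : ((ν i.castSucc : ℕ) : ℝ) = (tailSum ν (i + 1) : ℕ) - (tailSum ν (i + 2) : ℕ) := by
    have h := tailSum_eq_add ν i.castSucc
    simp only [Fin.val_castSucc] at h
    rw [h]; push_cast; ring
  have c2 : ((μ i.succ : ℕ) : ℝ) = (tailSum μ (i + 2) : ℕ) - (tailSum μ (i + 3) : ℕ) := by
    have h := tailSum_eq_add μ i.succ
    simp only [Fin.val_succ] at h
    rw [show (i : ℕ) + 2 = i + 1 + 1 by ring, show (i : ℕ) + 3 = i + 1 + 2 by ring, h]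
    push_cast; ring
  rw [b0, b1, b2, racahDualLevel, a, c1, c2]
  rw [show (i : ℕ) + 1 + 1 = i + 2 by ring, show (i : ℕ) + 2 + 1 = i + 3 by ring]
  congr 1 <;> ring

/-! ### The grid of the Racah polynomials -/

theorem sum_tsub_telescope {k : ℕ} (y : ℕ → ℕ) (hy : ∀ i, i < k → y i ≤ y (i + 1)) (j : ℕ)
    (hj : j ≤ k) :
    headSum (fun i : Fin k => y (i + 1) - y i) j = y j - y 0 := by
  induction k generalizing y j with
  | zero =>
    obtain rfl : j = 0 := by omega
    simp [headSum]
  | succ k ih =>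
    rcases j with _ | j
    · simp [headSum_zero]
    · rw [headSum_succ]
      have := ih (fun i => y (i + 1)) (fun i hi => hy (i + 1) (by omega)) j (by omega)
      have e : Fin.tail (fun i : Fin (k + 1) => y (i + 1) - y i) =
          fun i : Fin k => y (i + 1 + 1) - y (i + 1) := by funext i; simp [Fin.tail]
      rw [e, this]
      have h0 := hy 0 (by omega)
      have h1 : y 1 ≤ y (j + 1) := by
        clear this e ih h0
        induction j with
        | zero => exact le_rfl
        | succ j ihj => exact (ihj (by omega)).trans (hy (j + 1) (by omega))
      simp only [Fin.val_zero, zero_add] at h0 ⊢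
      omega

theorem sum_initSums {m n : ℕ} (F : (Fin m → ℕ) → ℝ) :
    ∑ μ ∈ multiIdx (m + 1) n, F (initSums μ) = ∑ y ∈ racahGrid m n, F y := by
  have hmono : ∀ μ : Fin (m + 1) → ℕ, ∀ i j : ℕ, i ≤ j → headSum μ i ≤ headSum μ j := by
    intro μ i j hij
    refine sum_le_sum fun l _ => ?_
    by_cases h : (l : ℕ) + 1 ≤ i
    · rw [if_pos h, if_pos (by omega)]
    · rw [if_neg h]; exact Nat.zero_le _
  have hdiff : ∀ y ∈ racahGrid m n, ∀ j ≤ m + 1,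
      headSum (fun i : Fin (m + 1) => padded n y (i + 1) - padded n y i) j = padded n y j := by
    intro y hy j hj
    rw [sum_tsub_telescope (padded n y) (fun i _ => padded_mono hy i) j hj, padded_zero, tsub_zero]
  refine sum_nbij' initSums (fun y i => padded n y (i + 1) - padded n y i) ?_ ?_ ?_ ?_ ?_
  · intro μ hμ
    rw [mem_multiIdx] at hμ
    simp only [racahGrid, mem_filter, Fintype.mem_piFinset, mem_range, initSums]
    refine ⟨fun i => ?_, fun i j hij => hmono μ _ _ (by simpa using hij)⟩
    have := headSum_add_tailSum μ (i + 1)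
    omega
  · intro y hy
    rw [mem_multiIdx]
    have h := headSum_add_tailSum (fun i : Fin (m + 1) => padded n y (i + 1) - padded n y i)
      (m + 1)
    rw [tailSum_eq_zero _ (by omega), hdiff y hy _ le_rfl, padded_last, add_zero] at h
    exact h.symm
  · intro μ hμ
    rw [mem_multiIdx] at hμ
    funext i
    rw [← hμ, padded_initSums μ (by omega), padded_initSums μ (by omega)]
    have h1 := headSum_add_tailSum μ i
    have h2 := headSum_add_tailSum μ (i + 1)
    have h3 := tailSum_eq_add μ i
    rw [show (i : ℕ) + 1 + 1 = i + 2 by ring] at h2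
    omega
  · intro y hy
    funext i
    rw [initSums, hdiff y hy _ (by omega), padded]
    simp
  · intro μ _
    rfl

theorem revSums_eq_initSums {m : ℕ} (ν : Fin (m + 1) → ℕ) :
    revSums ν = initSums (fun i => ν (Fin.rev i)) := by
  funext i
  unfold revSums initSums headSum tailSum
  rw [← Equiv.sum_comp Fin.revPerm]
  refine sum_congr rfl fun j _ => ?_
  simp only [Fin.revPerm_apply, Fin.val_rev]
  have := j.2
  have := i.2
  by_cases h : (j : ℕ) ≤ i
  · rw [if_pos (by omega), if_pos (by omega)]
  · rw [if_neg (by omega), if_neg (by omega)]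

theorem sum_revSums {m n : ℕ} (F : (Fin m → ℕ) → ℝ) :
    ∑ ν ∈ multiIdx (m + 1) n, F (revSums ν) = ∑ y ∈ racahGrid m n, F y := by
  rw [← sum_initSums]
  have hs : ∀ ν : Fin (m + 1) → ℕ, ∑ i, ν (Fin.rev i) = ∑ i, ν i := fun ν =>
    Equiv.sum_comp Fin.revPerm ν
  refine sum_nbij' (fun ν i => ν (Fin.rev i)) (fun ν i => ν (Fin.rev i)) ?_ ?_ ?_ ?_ ?_
  · intro ν hν
    rw [mem_multiIdx] at hν ⊢
    rw [hs, hν]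
  · intro ν hν
    rw [mem_multiIdx] at hν ⊢
    rw [hs, hν]
  · intro ν _
    simp
  · intro ν _
    simp
  · intro ν _
    rw [revSums_eq_initSums]

end SimplexJacobi

end

noncomputable section

namespace SimplexJacobi

open Finset MeasureTheory

/-! ### The norms of the Jacobi polynomials of one variable -/

theorem beta_integral {a b : ℝ} (ha : -1 < a) (hb : -1 < b) :
    IntegrableOn (fun x : ℝ => x ^ b * (1 - x) ^ a) (Set.Ioo 0 1) ∧
      ∫ x in Set.Ioo (0 : ℝ) 1, x ^ b * (1 - x) ^ a =
        Real.Gamma (b + 1) * Real.Gamma (a + 1) / Real.Gamma (a + b + 2) := by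
  have hb1 : 0 < b + 1 := by linarith
  have ha1 : 0 < a + 1 := by linarith
  set B := ProbabilityTheory.beta (b + 1) (a + 1) with hB
  have hBpos : 0 < B := ProbabilityTheory.beta_pos hb1 ha1
  -- The total mass of the beta distribution yields both integrability and the value of the
  -- integral.
  have h1 := ProbabilityTheory.lintegral_betaPDF_eq_one hb1 ha1
  rw [ProbabilityTheory.lintegral_betaPDF, ← hB] at h1
  simp only [add_sub_cancel_right] at h1
  have hnn : ∀ x ∈ Set.Ioo (0 : ℝ) 1, 0 ≤ 1 / B * x ^ b * (1 - x) ^ a := fun x hx => by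
    have := hx.1
    have : 0 < 1 - x := by linarith [hx.2]
    positivity
  have hae : 0 ≤ᵐ[volume.restrict (Set.Ioo (0 : ℝ) 1)] fun x => 1 / B * x ^ b * (1 - x) ^ a :=
    (ae_restrict_iff' measurableSet_Ioo).mpr (Filter.Eventually.of_forall hnn)
  have hm : Measurable fun x : ℝ => 1 / B * x ^ b * (1 - x) ^ a := by fun_prop
  have hint : IntegrableOn (fun x : ℝ => 1 / B * x ^ b * (1 - x) ^ a) (Set.Ioo 0 1) := by
    refine ⟨hm.aestronglyMeasurable, ?_⟩
    rw [hasFiniteIntegral_iff_ofReal hae, h1]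
    exact ENNReal.one_lt_top
  have hval : ∫ x in Set.Ioo (0 : ℝ) 1, 1 / B * x ^ b * (1 - x) ^ a = 1 := by
    rw [integral_eq_lintegral_of_nonneg_ae hae hm.aestronglyMeasurable, h1]
    simp
  have e : (fun x : ℝ => x ^ b * (1 - x) ^ a) =
      fun x : ℝ => B * (1 / B * x ^ b * (1 - x) ^ a) := by
    funext x
    field_simp
  constructor
  · rw [e]
    exact hint.const_mul B
  · rw [e, integral_const_mul, hval, mul_one, hB, ProbabilityTheory.beta]
    congr 2
    ring

theorem integrableOn_mul_beta {a b : ℝ} (ha : -1 < a) (hb : -1 < b) {f : ℝ → ℝ}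
    (hf : Continuous f) :
    IntegrableOn (fun x : ℝ => f x * (x ^ b * (1 - x) ^ a)) (Set.Ioo 0 1) := by
  have h := (beta_integral ha hb).1
  rw [← integrableOn_Icc_iff_integrableOn_Ioo] at h ⊢
  exact h.continuousOn_mul hf.continuousOn isCompact_Icc

theorem beta_moment {a b : ℝ} (ha : -1 < a) (hb : -1 < b) (j k : ℕ) :
    ∫ x in Set.Ioo (0 : ℝ) 1, ((1 - x) ^ k * x ^ j) * (x ^ b * (1 - x) ^ a) =
      poch (a + 1) k * Real.Gamma (a + 1) * Real.Gamma (b + j + 1) /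
        (poch (a + b + j + 2) k * Real.Gamma (a + b + j + 2)) := by
  have hj : (0 : ℝ) ≤ j := Nat.cast_nonneg j
  have hk : (0 : ℝ) ≤ k := Nat.cast_nonneg k
  have h := (beta_integral (a := a + k) (b := b + j) (by linarith) (by linarith)).2
  rw [← Gamma_add_natCast (by linarith), ← Gamma_add_natCast (by linarith),
    show a + 1 + (k : ℝ) = a + k + 1 by ring,
    show a + b + j + 2 + (k : ℝ) = a + k + (b + j) + 2 by ring, mul_comm (Real.Gamma (a + k + 1)),
    ← h]
  refine setIntegral_congr_fun measurableSet_Ioo fun x hx => ?_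
  have h1 : 0 < 1 - x := by linarith [hx.2]
  rw [Real.rpow_add hx.1, Real.rpow_add h1, Real.rpow_natCast, Real.rpow_natCast]
  ring

/-- Termwise beta integrals are summed by Chu–Vandermonde. The factor `(j+1-n)_n` vanishes for `j <
n`, which is orthogonality, and equals `n!` for `j = n`, which gives the norm. -/
theorem jacobi_moment {a b : ℝ} (ha : -1 < a) (hb : -1 < b) (n j : ℕ) :
    ∫ x in Set.Ioo (0 : ℝ) 1, (jac n a b 1 (1 - x) * x ^ j) * (x ^ b * (1 - x) ^ a) =
      Real.Gamma (b + j + 1) * Real.Gamma (a + n + 1) * poch (j + 1 - n) n /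
        (n.factorial * Real.Gamma (a + b + j + n + 2)) := by
  have hj : (0 : ℝ) ≤ j := Nat.cast_nonneg j
  have e : ∀ x : ℝ, (jac n a b 1 (1 - x) * x ^ j) * (x ^ b * (1 - x) ^ a) =
      ∑ k ∈ range (n + 1), jacCoef n a b k *
        (((1 - x) ^ k * x ^ j) * (x ^ b * (1 - x) ^ a)) := by
    intro x
    rw [jac, sum_mul, sum_mul]
    refine sum_congr rfl fun k _ => ?_
    rw [one_pow, smul_eq_mul]
    ring
  simp only [e]
  rw [integral_finsetSum]
  · simp only [integral_const_mul, beta_moment ha hb]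
    set c := a + b + j + 2 with hc
    have hc0 : 0 < c := by linarith
    have hch := chu_vandermonde n (n + a + b + 1) c
    rw [show c - (n + a + b + 1) = j + 1 - n by rw [hc]; ring] at hch
    rw [← hch, show a + b + j + (n : ℝ) + 2 = c + n by rw [hc]; ring, Gamma_add_natCast hc0,
      show a + (n : ℝ) + 1 = a + 1 + n by ring, Gamma_add_natCast (by linarith), mul_sum, sum_div]
    refine sum_congr rfl fun k hk => ?_
    have hk' : k ≤ n := Nat.lt_succ_iff.mp (mem_range.mp hk)
    rw [jacCoef, Nat.cast_choose ℝ hk', poch_split c hk', poch_split (a + 1) hk']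
    have n1 : poch c k ≠ 0 := poch_ne_zero hc0 _
    have n2 : poch (c + k) (n - k) ≠ 0 := poch_ne_zero (by positivity) _
    have n3 := (Real.Gamma_pos_of_pos hc0).ne'
    have f1 := Nat.factorial_ne_zero n
    have f2 := Nat.factorial_ne_zero k
    have f3 := Nat.factorial_ne_zero (n - k)
    field_simp
  · intro k _
    exact (integrableOn_mul_beta ha hb (by fun_prop)).const_mul _

/-- The squared norm of the Jacobi polynomial of degree `n` on `[0, 1]`. -/
def jacobiNorm (n : ℕ) (a b : ℝ) : ℝ :=
  poch (n + a + b + 1) n * Real.Gamma (a + n + 1) * Real.Gamma (b + n + 1) /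
    (n.factorial * Real.Gamma (2 * n + a + b + 2))

theorem jac_polynomial_degree (n : ℕ) (a b : ℝ) :
    (jac n a b (1 : Polynomial ℝ) (1 - Polynomial.X)).natDegree ≤ n ∧
      (jac n a b (1 : Polynomial ℝ) (1 - Polynomial.X)).coeff n =
        poch (n + a + b + 1) n / n.factorial := by
  have hd1 : (1 - Polynomial.X : Polynomial ℝ).natDegree ≤ 1 := by
    refine (Polynomial.natDegree_sub_le _ _).trans ?_
    simp
  have hd : ∀ k, ((1 - Polynomial.X : Polynomial ℝ) ^ k).natDegree ≤ k := fun k =>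
    Polynomial.natDegree_pow_le_of_le k hd1 |>.trans (by simp)
  constructor
  · refine Polynomial.natDegree_sum_le_of_forall_le _ _ fun k hk => ?_
    rw [one_pow, mul_one]
    exact (Polynomial.natDegree_smul_le _ _).trans
      ((hd k).trans (Nat.lt_succ_iff.mp (mem_range.mp hk)))
  · rw [jac, Polynomial.finsetSum_coeff, sum_eq_single n]
    · rw [one_pow, mul_one, Polynomial.coeff_smul, smul_eq_mul]
      have h := Polynomial.coeff_pow_of_natDegree_le (m := n) hd1
      rw [mul_one] at h
      rw [h]
      simp only [Polynomial.coeff_sub, Polynomial.coeff_X_one]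
      rw [Polynomial.coeff_one, if_neg one_ne_zero, zero_sub, jacCoef, Nat.sub_self, poch_zero]
      have : (-1 : ℝ) ^ n * (-1) ^ n = 1 := by rw [← mul_pow]; simp
      simp only [Nat.factorial_zero, Nat.cast_one, one_mul]
      rw [mul_comm, ← mul_div_assoc, ← mul_assoc, this, one_mul]
    · intro k hk hkn
      rw [one_pow, mul_one, Polynomial.coeff_smul, Polynomial.coeff_eq_zero_of_natDegree_lt,
        smul_zero]
      have := hd k
      rw [mem_range] at hk
      omega
    · intro h
      exact absurd (mem_range.mpr (Nat.lt_succ_self n)) h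

/-- Expand the polynomial of lower degree in powers of `x`: only a term of degree `n` can survive,
and it is the leading term when `m = n`. -/
theorem jacobi_orthogonal_of_le {a b : ℝ} (ha : -1 < a) (hb : -1 < b) {n m : ℕ} (hm : m ≤ n) :
    ∫ x in Set.Ioo (0 : ℝ) 1, (jac n a b 1 (1 - x) * jac m a b 1 (1 - x)) *
      (x ^ b * (1 - x) ^ a) = if n = m then jacobiNorm n a b else 0 := by
  obtain ⟨hdeg, hcoeff⟩ := jac_polynomial_degree m a b
  set P := jac m a b (1 : Polynomial ℝ) (1 - Polynomial.X) with hP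
  have hev : ∀ x : ℝ, jac m a b 1 (1 - x) = ∑ j ∈ range (m + 1), P.coeff j * x ^ j := by
    intro x
    rw [← Polynomial.eval_eq_sum_range' (Nat.lt_succ_of_le hdeg) x]
    have := map_jac (Polynomial.aeval x : Polynomial ℝ →ₐ[ℝ] ℝ) m a b 1 (1 - Polynomial.X)
    rw [← hP, map_one, map_sub, map_one, Polynomial.aeval_X] at this
    rw [← this]
    rfl
  have hcont : Continuous fun x : ℝ => jac n a b 1 (1 - x) := by
    unfold jac
    fun_prop
  have e : ∀ x : ℝ, (jac n a b 1 (1 - x) * jac m a b 1 (1 - x)) * (x ^ b * (1 - x) ^ a) =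
      ∑ j ∈ range (m + 1), P.coeff j *
        ((jac n a b 1 (1 - x) * x ^ j) * (x ^ b * (1 - x) ^ a)) := by
    intro x
    rw [hev, mul_sum, sum_mul]
    exact sum_congr rfl fun j _ => by ring
  simp only [e]
  rw [integral_finsetSum]
  · simp only [integral_const_mul, jacobi_moment ha hb]
    have h0 : ∀ j : ℕ, j < n → poch (j + 1 - n) n = 0 := by
      intro j hj
      have : (j : ℝ) + 1 - n = -((n - 1 - j : ℕ) : ℝ) := by
        rw [Nat.sub_sub, Nat.cast_sub (by omega)]; push_cast; ring
      rw [this]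
      exact poch_neg_natCast_eq_zero (by omega)
    split_ifs with hnm
    · subst hnm
      rw [sum_eq_single n]
      · have h1 : poch ((n : ℝ) + 1 - n) n = n.factorial := by
          have h := poch_neg_natCast (le_refl n)
          rw [poch_neg, show (n : ℝ) - n + 1 = n + 1 - n by ring] at h
          have hs : (-1 : ℝ) ^ n ≠ 0 := pow_ne_zero _ (by norm_num)
          have h' := mul_left_cancel₀ hs h
          simpa using h'
        have f1 := Nat.factorial_ne_zero n
        rw [hcoeff, h1, jacobiNorm, show a + b + (n : ℝ) + n + 2 = 2 * n + a + b + 2 by ring]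
        field_simp
      · intro j hj hjn
        rw [mem_range] at hj
        rw [h0 j (by omega)]
        ring
      · intro h
        exact absurd (mem_range.mpr (Nat.lt_succ_self n)) h
    · refine sum_eq_zero fun j hj => ?_
      rw [mem_range] at hj
      rw [h0 j (by omega)]
      ring
  · intro j _
    exact (integrableOn_mul_beta ha hb (by fun_prop)).const_mul _

theorem jacobi_orthogonal {a b : ℝ} (ha : -1 < a) (hb : -1 < b) (n m : ℕ) :
    ∫ x in Set.Ioo (0 : ℝ) 1, (jac n a b 1 (1 - x) * jac m a b 1 (1 - x)) *
      (x ^ b * (1 - x) ^ a) = if n = m then jacobiNorm n a b else 0 := by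
  rcases le_total m n with h | h
  · exact jacobi_orthogonal_of_le ha hb h
  · simp only [mul_comm (jac n a b _ _)]
    rw [jacobi_orthogonal_of_le ha hb h]
    by_cases hnm : n = m
    · rw [if_pos hnm, if_pos hnm.symm, hnm]
    · rw [if_neg hnm, if_neg (Ne.symm hnm)]

/-! ### Integration over a cone -/

/-- Fubini along the first coordinate: the slice at height `t` is the base scaled by `1 - t`, which
contributes `(1 - t)^d`. The endpoints are negligible, so nothing is assumed there about the product
form. -/
theorem integral_cone {d : ℕ} {F : (Fin (d + 1) → ℝ) → ℝ} (hF : Measurable F) {φ : ℝ → ℝ}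
    {ψ : (Fin d → ℝ) → ℝ}
    (h1 : ∀ t ∈ Set.Ioo (0 : ℝ) 1, ∀ y, F (Fin.cons t ((1 - t) • y)) = φ t * ψ y)
    (h0 : ∀ t, t ∉ Set.Icc (0 : ℝ) 1 → ∀ z, F (Fin.cons t z) = 0)
    (hφ : IntegrableOn (fun t => φ t * (1 - t) ^ d) (Set.Ioo 0 1)) (hψ : Integrable ψ) :
    Integrable F ∧ ∫ x, F x = (∫ t in Set.Ioo (0 : ℝ) 1, φ t * (1 - t) ^ d) * ∫ y, ψ y := by
  set e := MeasurableEquiv.piFinSuccAbove (fun _ : Fin (d + 1) => ℝ) 0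
  have he : MeasurePreserving e.symm (volume.prod volume) volume :=
    (volume_preserving_piFinSuccAbove (fun _ : Fin (d + 1) => ℝ) 0).symm
  have hes : ∀ p : ℝ × (Fin d → ℝ), e.symm p = Fin.cons p.1 p.2 := fun p => by
    simp [e, MeasurableEquiv.piFinSuccAbove]
    rfl
  set G : ℝ × (Fin d → ℝ) → ℝ := fun p => F (Fin.cons p.1 p.2) with hG
  have hGe : G = F ∘ e.symm := by
    funext p
    simp only [hG, Function.comp, hes]
  have hGm : Measurable G := by rw [hGe]; exact hF.comp e.symm.measurable
  have hfib : ∀ t ∈ Set.Ioo (0 : ℝ) 1, ∀ z, F (Fin.cons t z) = φ t * ψ ((1 - t)⁻¹ • z) := by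
    intro t ht z
    have h : (1 - t) ≠ 0 := by linarith [ht.2]
    rw [← h1 t ht, smul_smul, mul_inv_cancel₀ h, one_smul]
  have hscale : ∀ t ∈ Set.Ioo (0 : ℝ) 1, ∀ g : (Fin d → ℝ) → ℝ,
      ∫ z, g ((1 - t)⁻¹ • z) = (1 - t) ^ d * ∫ y, g y := by
    intro t ht g
    have h : 0 < (1 - t) := by linarith [ht.2]
    rw [Measure.integral_comp_smul, Module.finrank_fin_fun, inv_pow, inv_inv,
      abs_of_pos (by positivity), smul_eq_mul]
  have hae : ∀ᵐ t : ℝ, t ∈ Set.Ioo (0 : ℝ) 1 ∨ t ∉ Set.Icc (0 : ℝ) 1 := by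
    have : ∀ᵐ t : ℝ, t ∉ ({0, 1} : Set ℝ) :=
      measure_eq_zero_iff_ae_notMem.mp ((Set.toFinite {(0 : ℝ), 1}).measure_zero volume)
    filter_upwards [this] with t ht
    simp only [Set.mem_insert_iff, Set.mem_singleton_iff, not_or] at ht
    by_cases h : t ∈ Set.Icc (0 : ℝ) 1
    · exact Or.inl ⟨lt_of_le_of_ne h.1 (Ne.symm ht.1), lt_of_le_of_ne h.2 ht.2⟩
    · exact Or.inr h
  have hGint : Integrable G (volume.prod volume) := by
    rw [integrable_prod_iff hGm.aestronglyMeasurable]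
    constructor
    · filter_upwards [hae] with t ht
      rcases ht with ht | ht
      · simp only [hG, hfib t ht]
        exact (hψ.comp_smul (inv_ne_zero (by linarith [ht.2]))).const_mul _
      · simp only [hG, h0 t ht]
        exact integrable_zero _ _ _
    · have h2 : Integrable (fun t => (Set.Ioo (0 : ℝ) 1).indicator
          (fun t => ‖φ t * (1 - t) ^ d‖ * ∫ y, ‖ψ y‖) t) :=
        (integrable_indicator_iff measurableSet_Ioo).mpr (hφ.norm.mul_const _)
      refine h2.congr ?_
      filter_upwards [hae] with t ht
      rcases ht with ht | ht
      · rw [Set.indicator_of_mem ht]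
        simp only [hG, hfib t ht, norm_mul]
        rw [integral_const_mul, hscale t ht (fun y => ‖ψ y‖), norm_pow,
          Real.norm_of_nonneg (by linarith [ht.2] : (0 : ℝ) ≤ 1 - t)]
        ring
      · rw [Set.indicator_of_notMem (fun h => ht (Set.Ioo_subset_Icc_self h))]
        simp [hG, h0 t ht]
  constructor
  · rw [hGe] at hGint
    exact (he.integrable_comp_emb e.symm.measurableEmbedding).mp hGint
  · rw [← he.integral_comp e.symm.measurableEmbedding]
    have : ∫ p, F (e.symm p) ∂(volume.prod volume) = ∫ p, G p ∂(volume.prod volume) := by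
      rw [hGe]; rfl
    rw [this, integral_prod _ hGint, ← integral_mul_const, ← integral_indicator measurableSet_Ioo]
    refine integral_congr_ae ?_
    filter_upwards [hae] with t ht
    rcases ht with ht | ht
    · rw [Set.indicator_of_mem ht]
      simp only [hG, hfib t ht]
      rw [integral_const_mul, hscale t ht ψ]
      ring
    · rw [Set.indicator_of_notMem (fun h => ht (Set.Ioo_subset_Icc_self h))]
      simp [hG, h0 t ht]

end SimplexJacobi

end

noncomputable section

namespace SimplexJacobi

open Finset MeasureTheory

/-! ### Orthogonality on the simplex -/

theorem simplexJac_smul {d : ℕ} (κ : Fin (d + 1) → ℝ) (ν : Fin d → ℕ) (c s : ℝ)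
    (x : Fin d → ℝ) :
    simplexJac κ ν (c * s) (c • x) = c ^ (∑ i, ν i) * simplexJac κ ν s x := by
  rw [simplexJac, simplexJac, ← prod_pow_eq_pow_sum, ← prod_mul_distrib]
  refine prod_congr rfl fun i _ => ?_
  have hh : headSum (c • x) i = c * headSum x i := by
    rw [headSum, headSum, mul_sum]
    refine sum_congr rfl fun j _ => ?_
    split_ifs <;> simp
  rw [hh, Pi.smul_apply, smul_eq_mul]
  have e1 : c * s - c * headSum x i = c * (s - headSum x i) := by ring
  rw [e1]
  unfold jacobiHom
  rw [mul_left_comm, mul_sum (a := c ^ ν i)]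
  congr 1
  refine sum_congr rfl fun k hk => ?_
  have hk' : k ≤ ν i := Nat.lt_succ_iff.mp (mem_range.mp hk)
  have h2 : c ^ ν i = c ^ k * c ^ (ν i - k) := by rw [← pow_add, Nat.add_sub_cancel' hk']
  rw [← mul_sub, mul_pow, mul_pow, h2]
  ring

theorem continuous_jacobiHom (n : ℕ) (a b : ℝ) :
    Continuous fun p : ℝ × ℝ => jacobiHom n a b p.1 p.2 := by
  unfold jacobiHom
  fun_prop

theorem continuous_simplexJacobi {d : ℕ} (κ : Fin (d + 1) → ℝ) (ν : Fin d → ℕ) :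
    Continuous (simplexJacobi κ ν) := by
  unfold simplexJacobi
  refine continuous_finsetProd _ fun i _ => ?_
  have hh : Continuous fun x : Fin d → ℝ => headSum x i := by
    unfold headSum
    refine continuous_finsetSum _ fun j _ => ?_
    split_ifs
    · exact continuous_apply j
    · exact continuous_const
  exact (continuous_jacobiHom _ _ _).comp
    ((continuous_const.sub hh).prodMk (continuous_apply i))

theorem measurable_jacobiWeight {d : ℕ} (κ : Fin (d + 1) → ℝ) : Measurable (jacobiWeight κ) := by
  unfold jacobiWeight
  refine (Finset.measurable_fun_prod _ fun i _ => ?_).mul ?_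
  · exact (measurable_pi_apply i).pow_const _
  · exact (measurable_const.sub (Finset.measurable_fun_sum _ fun i _ => measurable_pi_apply i)).pow_const _

theorem measurableSet_simplex (d : ℕ) : MeasurableSet (simplex d) := by
  have : simplex d = (⋂ i, {x | 0 ≤ x i}) ∩ {x | ∑ i, x i ≤ 1} := by
    ext x
    simp [simplex]
  rw [this]
  refine (MeasurableSet.iInter fun i => measurableSet_le measurable_const
    (measurable_pi_apply i)).inter (measurableSet_le
      (Finset.measurable_fun_sum _ fun i _ => measurable_pi_apply i) measurable_const)

/-- The integrand of the inner product of two Jacobi polynomials, extended by zero. -/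
def jacobiIntegrand {d : ℕ} (κ : Fin (d + 1) → ℝ) (ν μ : Fin d → ℕ) : (Fin d → ℝ) → ℝ :=
  (simplex d).indicator fun x => simplexJacobi κ ν x * simplexJacobi κ μ x * jacobiWeight κ x

theorem measurable_jacobiIntegrand {d : ℕ} (κ : Fin (d + 1) → ℝ) (ν μ : Fin d → ℕ) :
    Measurable (jacobiIntegrand κ ν μ) :=
  (((continuous_simplexJacobi κ ν).measurable.mul (continuous_simplexJacobi κ μ).measurable).mul
    (measurable_jacobiWeight κ)).indicator (measurableSet_simplex d)

theorem jacobiWeight_cons {d : ℕ} (κ : Fin (d + 1 + 1) → ℝ) {t : ℝ} (ht : t ∈ Set.Ioo (0 : ℝ) 1)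
    {y : Fin d → ℝ} (hy : y ∈ simplex d) :
    jacobiWeight κ (Fin.cons t ((1 - t) • y)) =
      t ^ κ 0 * (1 - t) ^ (∑ i, Fin.tail κ i) * jacobiWeight (Fin.tail κ) y := by
  have h : 0 < 1 - t := by linarith [ht.2]
  have hlast : 1 - ∑ i, (Fin.cons t ((1 - t) • y) : Fin (d + 1) → ℝ) i =
      (1 - t) * (1 - ∑ i, y i) := by
    rw [Fin.sum_univ_succ]
    simp only [Fin.cons_zero, Fin.cons_succ, Pi.smul_apply, smul_eq_mul, ← mul_sum]
    ring
  rw [jacobiWeight, hlast, Fin.prod_univ_succ, jacobiWeight, Real.mul_rpow h.le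
    (by linarith [hy.2]), Fin.sum_univ_castSucc, Real.rpow_add h]
  simp only [Fin.cons_zero, Fin.cons_succ, Pi.smul_apply, smul_eq_mul]
  have hp : ∏ i : Fin d, ((1 - t) * y i) ^ κ i.succ.castSucc =
      (1 - t) ^ (∑ i : Fin d, Fin.tail κ i.castSucc) * ∏ i, y i ^ Fin.tail κ i.castSucc := by
    rw [Real.rpow_sum_of_pos h, ← prod_mul_distrib]
    exact prod_congr rfl fun i _ => Real.mul_rpow h.le (hy.1 i)
  rw [hp]
  have e0 : κ (Fin.castSucc 0) = κ 0 := rfl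
  have e1 : κ (Fin.last (d + 1)) = Fin.tail κ (Fin.last d) := rfl
  rw [e0, e1]
  ring

theorem cons_mem_simplex {d : ℕ} {t : ℝ} (ht : t ∈ Set.Ioo (0 : ℝ) 1) {y : Fin d → ℝ} :
    (Fin.cons t ((1 - t) • y) : Fin (d + 1) → ℝ) ∈ simplex (d + 1) ↔ y ∈ simplex d := by
  have h : 0 < 1 - t := by linarith [ht.2]
  simp only [simplex, Set.mem_ofPred_eq, Fin.forall_fin_succ, Fin.sum_univ_succ, Fin.cons_zero,
    Fin.cons_succ, Pi.smul_apply, smul_eq_mul, ← mul_sum]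
  constructor
  · rintro ⟨⟨-, h1⟩, h2⟩
    refine ⟨fun i => nonneg_of_mul_nonneg_right (h1 i) h, ?_⟩
    by_contra! hc
    nlinarith
  · rintro ⟨h1, h2⟩
    refine ⟨⟨ht.1.le, fun i => mul_nonneg h.le (h1 i)⟩, ?_⟩
    nlinarith

theorem simplexJacobi_cons {d : ℕ} (κ : Fin (d + 1 + 1) → ℝ) (ν : Fin (d + 1) → ℕ) (t : ℝ)
    (y : Fin d → ℝ) :
    simplexJacobi κ ν (Fin.cons t ((1 - t) • y)) =
      jacobiHom (ν 0) (aParam κ ν 1) (κ 0) 1 t *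
        ((1 - t) ^ (∑ i, Fin.tail ν i) * simplexJacobi (Fin.tail κ) (Fin.tail ν) y) := by
  rw [← simplexJac_one, simplexJac_succ, Fin.cons_zero, Fin.tail_cons]
  have h := simplexJac_smul (Fin.tail κ) (Fin.tail ν) (1 - t) 1 y
  rw [mul_one] at h
  rw [h, simplexJac_one]

/-- Induction over the cone: in coordinates `(t, (1-t)y)` polynomials and weight split into a
function of `t` and the same data for `y` in one dimension less. -/
theorem jacobiIntegrand_orthogonal {d : ℕ} (κ : Fin (d + 1) → ℝ) (hκ : ∀ i, -1 < κ i)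
    (ν μ : Fin d → ℕ) :
    Integrable (jacobiIntegrand κ ν μ) ∧ ∫ x, jacobiIntegrand κ ν μ x =
      if ν = μ then ∏ i : Fin d, jacobiNorm (ν i) (aParam κ ν (i + 1)) (κ i.castSucc) else 0 := by
  induction d with
  | zero =>
    have h1 : jacobiIntegrand κ ν μ = fun _ => 1 := by
      funext x
      rw [jacobiIntegrand, Set.indicator_of_mem]
      · simp [simplexJacobi, jacobiWeight]
      · simp [simplex]
    have h2 : ν = μ := Subsingleton.elim _ _
    rw [h1, if_pos h2]
    have : (volume : Measure (Fin 0 → ℝ)) = Measure.dirac 0 := by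
      rw [volume_pi, Measure.pi_of_empty _ 0]
    constructor
    · rw [this]
      exact integrable_const _
    · rw [this]
      simp
  | succ d ih =>
    obtain ⟨hψ, hψi⟩ := ih (Fin.tail κ) (fun i => hκ i.succ) (Fin.tail ν) (Fin.tail μ)
    set N := ∑ i, Fin.tail ν i + ∑ i, Fin.tail μ i with hN
    set S := ∑ i, Fin.tail κ i with hS
    have hSd : -1 < S + d := by
      have := neg_card_lt_sum (Fin.tail κ) fun i => hκ i.succ
      linarith
    set φ : ℝ → ℝ := fun t => jacobiHom (ν 0) (aParam κ ν 1) (κ 0) 1 t *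
      jacobiHom (μ 0) (aParam κ μ 1) (κ 0) 1 t * (1 - t) ^ N * (t ^ κ 0 * (1 - t) ^ S) with hφ
    have hcont : ∀ (n : ℕ) (a b : ℝ), Continuous fun t : ℝ => jacobiHom n a b 1 t :=
      fun n a b => (continuous_jacobiHom n a b).comp (continuous_const.prodMk continuous_id)
    have hφd : Set.EqOn (fun t => φ t * (1 - t) ^ d)
        (fun t => (jacobiHom (ν 0) (aParam κ ν 1) (κ 0) 1 t *
          jacobiHom (μ 0) (aParam κ μ 1) (κ 0) 1 t * (1 - t) ^ N) *
            (t ^ κ 0 * (1 - t) ^ (S + d))) (Set.Ioo 0 1) := by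
      intro t ht
      have h : 0 < 1 - t := by linarith [ht.2]
      simp only [hφ]
      rw [Real.rpow_add h, Real.rpow_natCast]
      ring
    have hmain := integral_cone (measurable_jacobiIntegrand κ ν μ) (φ := φ)
      (ψ := jacobiIntegrand (Fin.tail κ) (Fin.tail ν) (Fin.tail μ)) ?_ ?_ ?_ hψ
    · refine ⟨hmain.1, ?_⟩
      rw [hmain.2, hψi]
      by_cases ht : Fin.tail ν = Fin.tail μ
      · rw [if_pos ht, setIntegral_congr_fun measurableSet_Ioo hφd]
        have ha : aParam κ μ 1 = aParam κ ν 1 := by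
          rw [aParam_one, aParam_one, ht]
        have ha0 := neg_one_lt_aParam κ hκ ν 0
        rw [Fin.val_zero, zero_add] at ha0
        have horth := jacobi_orthogonal ha0 (hκ 0) (ν 0) (μ 0)
        have hcongr : Set.EqOn (fun t : ℝ => (jacobiHom (ν 0) (aParam κ ν 1) (κ 0) 1 t *
          jacobiHom (μ 0) (aParam κ μ 1) (κ 0) 1 t * (1 - t) ^ N) *
            (t ^ κ 0 * (1 - t) ^ (S + d)))
            (fun t => (jac (ν 0) (aParam κ ν 1) (κ 0) 1 (1 - t) *
              jac (μ 0) (aParam κ ν 1) (κ 0) 1 (1 - t)) *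
              (t ^ κ 0 * (1 - t) ^ aParam κ ν 1)) (Set.Ioo 0 1) := by
          intro t htt
          have h : 0 < 1 - t := by linarith [htt.2]
          -- The powers of `1 - t` from the weight, the Jacobian and the two homogeneous tails add
          -- up to the first parameter of the outer Jacobi polynomial, so one-variable orthogonality
          -- applies.
          have e : aParam κ ν 1 = S + d + N := by
            rw [aParam_one, hN, ht, ← hS]
            push_cast
            ring
          have er : (1 - t) ^ aParam κ ν 1 = (1 - t) ^ (S + d) * (1 - t) ^ N := by
            rw [e, Real.rpow_add h (S + d), Real.rpow_natCast]
          simp only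
          rw [ha, jacobiHom_eq_jac _ ha0, jacobiHom_eq_jac _ ha0, er]
          ring
        rw [setIntegral_congr_fun measurableSet_Ioo hcongr, horth]
        by_cases h0 : ν 0 = μ 0
        · have hνμ : ν = μ := by
            rw [← Fin.cons_self_tail ν, ← Fin.cons_self_tail μ, h0, ht]
          rw [if_pos h0, if_pos hνμ, Fin.prod_univ_succ]
          congr 1
          refine prod_congr rfl fun i _ => ?_
          rw [Fin.val_succ, aParam_add_two]
          rfl
        · rw [if_neg h0, if_neg (fun h => h0 (by rw [h])), zero_mul]
      · rw [if_neg ht, if_neg (fun h => ht (by rw [h])), mul_zero]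
    · intro t ht y
      by_cases hy : y ∈ simplex d
      · rw [jacobiIntegrand, jacobiIntegrand, Set.indicator_of_mem ((cons_mem_simplex ht).mpr hy),
          Set.indicator_of_mem hy, jacobiWeight_cons κ ht hy, simplexJacobi_cons,
          simplexJacobi_cons]
        simp only [hφ, hN, pow_add]
        ring
      · rw [jacobiIntegrand, jacobiIntegrand,
          Set.indicator_of_notMem (fun h => hy ((cons_mem_simplex ht).mp h)),
          Set.indicator_of_notMem hy, mul_zero]
    · intro t ht z
      rw [jacobiIntegrand, Set.indicator_of_notMem]
      rintro ⟨h1, h2⟩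
      refine ht ⟨by simpa using h1 0, ?_⟩
      rw [Fin.sum_univ_succ] at h2
      have h3 : 0 ≤ ∑ i : Fin d, (Fin.cons t z : Fin (d + 1) → ℝ) i.succ :=
        sum_nonneg fun i _ => h1 i.succ
      rw [Fin.cons_zero] at h2
      linarith
    · exact (integrableOn_congr_fun hφd measurableSet_Ioo).mpr
        (integrableOn_mul_beta hSd (hκ 0)
          (((hcont _ _ _).mul (hcont _ _ _)).mul (by fun_prop)))

/-- The normalizing constant of the inner product. -/
def normConst {d : ℕ} (κ : Fin (d + 1) → ℝ) : ℝ :=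
  Real.Gamma ((∑ i, κ i) + d + 1) / ∏ i, Real.Gamma (κ i + 1)

theorem normConst_pos {d : ℕ} (κ : Fin (d + 1) → ℝ) (hκ : ∀ i, -1 < κ i) : 0 < normConst κ := by
  have h := neg_card_lt_sum κ hκ
  exact div_pos (Real.Gamma_pos_of_pos (by linarith))
    (prod_pos fun i _ => Real.Gamma_pos_of_pos (by linarith [hκ i]))

theorem jacobiInner_simplexJacobi {d : ℕ} (κ : Fin (d + 1) → ℝ) (hκ : ∀ i, -1 < κ i)
    (ν μ : Fin d → ℕ) :
    jacobiInner κ (simplexJacobi κ ν) (simplexJacobi κ μ) = normConst κ *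
      if ν = μ then ∏ i : Fin d, jacobiNorm (ν i) (aParam κ ν (i + 1)) (κ i.castSucc) else 0 := by
  rw [← (jacobiIntegrand_orthogonal κ hκ ν μ).2, jacobiInner, normConst,
    ← integral_indicator (measurableSet_simplex d)]
  rfl

theorem normSq_eq {d : ℕ} (κ : Fin (d + 1) → ℝ) (hκ : ∀ i, -1 < κ i) (ν : Fin d → ℕ) :
    normSq κ ν = normConst κ *
      ∏ i : Fin d, jacobiNorm (ν i) (aParam κ ν (i + 1)) (κ i.castSucc) := by
  rw [normSq, jacobiInner_simplexJacobi κ hκ, if_pos rfl]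

theorem jacobiInner_eq_ite {d : ℕ} (κ : Fin (d + 1) → ℝ) (hκ : ∀ i, -1 < κ i)
    (ν μ : Fin d → ℕ) :
    jacobiInner κ (simplexJacobi κ ν) (simplexJacobi κ μ) = if ν = μ then normSq κ ν else 0 := by
  rw [jacobiInner_simplexJacobi κ hκ, normSq_eq κ hκ]
  split_ifs <;> simp

theorem jacobiNorm_pos {n : ℕ} {a b : ℝ} (ha : -1 < a) (hb : -1 < b) : 0 < jacobiNorm n a b := by
  have hn : (0 : ℝ) ≤ n := Nat.cast_nonneg n
  have h1 : 0 < poch (n + a + b + 1) n := by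
    rcases n with _ | n
    · rw [poch_zero]; exact one_pos
    · have : (0 : ℝ) ≤ n := Nat.cast_nonneg n
      exact poch_pos (by push_cast; linarith) _
  exact div_pos (mul_pos (mul_pos h1 (Real.Gamma_pos_of_pos (by linarith)))
    (Real.Gamma_pos_of_pos (by linarith)))
    (mul_pos (by positivity) (Real.Gamma_pos_of_pos (by linarith)))

theorem normSq_pos {d : ℕ} (κ : Fin (d + 1) → ℝ) (hκ : ∀ i, -1 < κ i) (ν : Fin d → ℕ) :
    0 < normSq κ ν := by
  rw [normSq_eq κ hκ]
  exact mul_pos (normConst_pos κ hκ)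
    (prod_pos fun i _ => jacobiNorm_pos (neg_one_lt_aParam κ hκ ν i) (hκ _))

/-- The inner product of two linear combinations of Jacobi polynomials. -/
theorem jacobiInner_sum {d : ℕ} (κ : Fin (d + 1) → ℝ) (hκ : ∀ i, -1 < κ i)
    (s : Finset (Fin d → ℕ)) (c c' : (Fin d → ℕ) → ℝ) :
    jacobiInner κ (fun x => ∑ μ ∈ s, c μ * simplexJacobi κ μ x)
      (fun x => ∑ μ ∈ s, c' μ * simplexJacobi κ μ x) = ∑ μ ∈ s, c μ * c' μ * normSq κ μ := by
  have e : ∀ x, (simplex d).indicator (fun x => (∑ μ ∈ s, c μ * simplexJacobi κ μ x) *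
      (∑ μ ∈ s, c' μ * simplexJacobi κ μ x) * jacobiWeight κ x) x =
      ∑ μ ∈ s, ∑ μ' ∈ s, c μ * c' μ' * jacobiIntegrand κ μ μ' x := by
    intro x
    by_cases hx : x ∈ simplex d
    · rw [Set.indicator_of_mem hx, sum_mul_sum, sum_mul]
      refine sum_congr rfl fun μ _ => ?_
      rw [sum_mul]
      refine sum_congr rfl fun μ' _ => ?_
      rw [jacobiIntegrand, Set.indicator_of_mem hx]
      ring
    · rw [Set.indicator_of_notMem hx]
      symm
      refine sum_eq_zero fun μ _ => sum_eq_zero fun μ' _ => ?_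
      rw [jacobiIntegrand, Set.indicator_of_notMem hx, mul_zero]
  rw [jacobiInner, ← integral_indicator (measurableSet_simplex d)]
  simp only [e]
  have hint := fun μ μ' => (jacobiIntegrand_orthogonal κ hκ μ μ').1
  rw [integral_finsetSum _ fun μ _ => integrable_finsetSum _ fun μ' _ =>
    (hint μ μ').const_mul _, mul_sum]
  refine sum_congr rfl fun μ hμ => ?_
  rw [integral_finsetSum _ fun μ' _ => (hint μ μ').const_mul _]
  simp only [integral_const_mul, (jacobiIntegrand_orthogonal κ hκ _ _).2, mul_ite, mul_zero]
  rw [sum_ite_eq, if_pos hμ, normSq_eq κ hκ, normConst]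
  ring

end SimplexJacobi

end

noncomputable section

namespace SimplexJacobi

open Finset

/-! ### The norms and the Racah weights -/

theorem aParam_last {d : ℕ} (κ : Fin (d + 1) → ℝ) (ν : Fin d → ℕ) :
    aParam κ ν d = κ (Fin.last d) := by
  have h := tailSum_eq_add κ (Fin.last d)
  rw [Fin.val_last, tailSum_eq_zero κ (j := d + 2) (by omega), add_zero] at h
  rw [aParam, h, tailSum_eq_zero ν (by omega)]
  simp

theorem aParam_zero {d : ℕ} (κ : Fin (d + 1) → ℝ) (ν : Fin d → ℕ) :
    aParam κ ν 0 = ∑ i, κ i + 2 * ((∑ i, ν i : ℕ) : ℝ) + d := by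
  rw [aParam, tailSum_one, tailSum_one]
  simp

theorem neg_one_lt_aParam_of_le {d : ℕ} (κ : Fin (d + 1) → ℝ) (hκ : ∀ i, -1 < κ i)
    (ν : Fin d → ℕ) {j : ℕ} (hj : j ≤ d) : -1 < aParam κ ν j := by
  rcases j with _ | j
  · rw [aParam_zero]
    have h := neg_card_lt_sum κ hκ
    have : (0 : ℝ) ≤ ((∑ i, ν i : ℕ) : ℝ) := Nat.cast_nonneg _
    linarith
  · exact neg_one_lt_aParam κ hκ ν ⟨j, hj⟩

/-- By `aParam_eq_add` the denominator Gamma of each one-variable norm belongs to the preceding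
parameter; the quotients telescope down to the last parameter, `κ_{d+1}`. -/
theorem normSq_formula {d : ℕ} (κ : Fin (d + 1) → ℝ) (hκ : ∀ i, -1 < κ i) (ν : Fin d → ℕ) :
    normSq κ ν = Real.Gamma (∑ i, κ i + d + 1) / Real.Gamma (aParam κ ν 0 + 1) *
      ((∏ i, poch (κ i.castSucc + 1) (ν i) / (ν i).factorial) *
        (∏ i : Fin d, poch (aParam κ ν (i + 1) + 1) (ν i)) *
        ∏ i : Fin d, poch (ν i + aParam κ ν (i + 1) + κ i.castSucc + 1) (ν i)) := by
  have hG : ∀ j ≤ d, Real.Gamma (aParam κ ν j + 1) ≠ 0 := fun j hj =>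
    (Real.Gamma_pos_of_pos (by linarith [neg_one_lt_aParam_of_le κ hκ ν hj])).ne'
  have hK : ∀ i, Real.Gamma (κ i + 1) ≠ 0 := fun i =>
    (Real.Gamma_pos_of_pos (by linarith [hκ i])).ne'
  have hterm : ∀ i : Fin d, jacobiNorm (ν i) (aParam κ ν (i + 1)) (κ i.castSucc) =
      (Real.Gamma (aParam κ ν (i + 1) + 1) / Real.Gamma (aParam κ ν i + 1)) *
        Real.Gamma (κ i.castSucc + 1) *
        ((poch (κ i.castSucc + 1) (ν i) / (ν i).factorial) *
          poch (aParam κ ν (i + 1) + 1) (ν i) *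
          poch (ν i + aParam κ ν (i + 1) + κ i.castSucc + 1) (ν i)) := by
    intro i
    have e := aParam_eq_add κ ν i.2
    simp only [Fin.eta] at e
    rw [jacobiNorm, show aParam κ ν (i + 1) + (ν i : ℝ) + 1 = aParam κ ν (i + 1) + 1 + ν i by ring,
      show κ i.castSucc + (ν i : ℝ) + 1 = κ i.castSucc + 1 + ν i by ring,
      Gamma_add_natCast (by linarith [neg_one_lt_aParam κ hκ ν i]),
      Gamma_add_natCast (by linarith [hκ i.castSucc]),
      show 2 * (ν i : ℝ) + aParam κ ν (i + 1) + κ i.castSucc + 2 = aParam κ ν i + 1 by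
        rw [e]; ring]
    have := hG i i.2.le
    have f1 := Nat.factorial_ne_zero (ν i)
    field_simp
  have htel : (∏ i : Fin d, Real.Gamma (aParam κ ν (i + 1) + 1) / Real.Gamma (aParam κ ν i + 1)) =
      Real.Gamma (κ (Fin.last d) + 1) / Real.Gamma (aParam κ ν 0 + 1) := by
    have h1 := prod_range_succ (fun j => Real.Gamma (aParam κ ν j + 1)) d
    rw [prod_range_succ', prod_range, prod_range, aParam_last] at h1
    have hne : ∏ i : Fin d, Real.Gamma (aParam κ ν i + 1) ≠ 0 :=
      prod_ne_zero_iff.mpr fun i _ => hG i i.2.le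
    rw [prod_div_distrib, div_eq_div_iff hne (hG 0 (Nat.zero_le d)), h1, mul_comm]
  rw [normSq_eq κ hκ, prod_congr rfl fun i _ => hterm i, prod_mul_distrib, prod_mul_distrib,
    htel, prod_mul_distrib, prod_mul_distrib, normConst,
    Fin.prod_univ_castSucc (fun i => Real.Gamma (κ i + 1))]
  have h1 : ∏ i : Fin d, Real.Gamma (κ i.castSucc + 1) ≠ 0 :=
    prod_ne_zero_iff.mpr fun i _ => hK _
  have h2 := hK (Fin.last d)
  have h3 := hG 0 (Nat.zero_le d)
  field_simp

theorem poch_norm_pos {d : ℕ} (κ : Fin (d + 1) → ℝ) (hκ : ∀ i, -1 < κ i) (ν : Fin d → ℕ)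
    (i : Fin d) : 0 < poch (ν i + aParam κ ν (i + 1) + κ i.castSucc + 1) (ν i) := by
  have h1 := neg_one_lt_aParam κ hκ ν i
  have h2 := hκ i.castSucc
  rcases ν i with _ | k
  · rw [poch_zero]; exact one_pos
  · have : (0 : ℝ) ≤ k := Nat.cast_nonneg k
    exact poch_pos (by push_cast; linarith) _

theorem permParam_cyclicPerm_castSucc {m : ℕ} (κ : Fin (m + 1 + 1) → ℝ) (i : Fin m) :
    permParam (cyclicPerm m) κ i.castSucc.castSucc = κ i.succ.castSucc := by
  rw [permParam, cyclicPerm_castSucc_castSucc]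

theorem neg_one_lt_permParam {m : ℕ} (τ : Equiv.Perm (Fin (m + 1))) {κ : Fin (m + 1) → ℝ}
    (hκ : ∀ i, -1 < κ i) (i : Fin (m + 1)) : -1 < permParam τ κ i := hκ _

theorem tailSum_permParam {m : ℕ} (κ : Fin (m + 1 + 1) → ℝ) (i : Fin m) :
    tailSum (permParam (cyclicPerm m) κ) (i + 2) = κ 0 + tailSum κ (i + 3) := by
  rw [show (i : ℕ) + 3 = i + 1 + 2 by ring, tailSum_add_two κ (i + 1)]
  unfold tailSum
  rw [Fin.sum_univ_castSucc, Fin.sum_univ_castSucc, Fin.sum_univ_castSucc (n := m)]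
  have hi := i.2
  simp only [permParam, cyclicPerm_castSucc_castSucc, cyclicPerm_castSucc_last, cyclicPerm_last,
    Fin.val_castSucc, Fin.val_last, Fin.tail, Fin.succ_last, Fin.succ_castSucc]
  rw [if_pos (show (i : ℕ) + 2 ≤ m + 1 by omega), if_pos (show (i : ℕ) + 2 ≤ m + 1 + 1 by omega),
    if_pos (show (i : ℕ) + 1 + 1 ≤ m + 1 by omega)]
  ring

theorem tailSum_sub {m : ℕ} (ν : Fin m → ℕ) (i : Fin m) :
    tailSum ν (i + 1) - tailSum ν (i + 2) = ν i := by
  rw [tailSum_eq_add, Nat.add_sub_cancel]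

/-- On this grid the successive differences are the entries of `ν`, so the Pochhammer symbols of the
weight become those in the norm for the permuted parameters. -/
theorem racahWeight_revSums {m : ℕ} (κ : Fin (m + 1 + 1) → ℝ) (ν : Fin (m + 1) → ℕ) :
    racahWeight m (betaParam m κ) (∑ i, ν i) (revSums ν) =
      rowFactor κ ν * (poch (∑ i, κ i + m + 1) (∑ i, ν i + tailSum ν 2) /
        poch (κ 0 + 1) (ν (Fin.last m))) *
      ∏ i : Fin m, (poch (ν i.succ + aParam (permParam (cyclicPerm m) κ) ν (i + 2) +
          permParam (cyclicPerm m) κ i.succ.castSucc + 1) (ν i.succ) *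
        poch (aParam (permParam (cyclicPerm m) κ) ν (i + 1) + 1) (ν i.castSucc))⁻¹ := by
  have hl : tailSum ν (m + 1) = ν (Fin.last m) := by
    have h := tailSum_eq_add ν (Fin.last m)
    rwa [Fin.val_last, tailSum_eq_zero ν (j := m + 2) (by omega), add_zero] at h
  have b0 : betaParam m κ 0 = κ 0 := by
    rw [betaParam, tailSum_eq_zero κ (by omega)]; simp
  have bl : betaParam m κ (m + 1) = ∑ i, κ i + m + 1 := by
    have h1 := tailSum_eq_add κ 0
    rw [Fin.val_zero, zero_add, zero_add, tailSum_one] at h1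
    rw [betaParam, show m + 1 + 2 - (m + 1) = 2 by omega, h1]
    push_cast
    ring
  unfold racahWeight
  rw [b0, bl, prod_range, prod_range, ← Equiv.prod_comp Fin.revPerm,
    ← Equiv.prod_comp (Fin.revPerm (n := m)), rowFactor, padded_revSums ν (by omega),
    padded_revSums ν (by omega), show m + 2 - m = 2 by omega, show m + 2 - 1 = m + 1 by omega, hl]
  congr 1
  · congr 1
    refine prod_congr rfl fun i _ => ?_
    have hi := i.2
    have v : ((Fin.revPerm i : Fin (m + 1)) : ℕ) = m - i := by
      simp only [Fin.revPerm_apply, Fin.val_rev]; omega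
    have hb := tailSum_eq_add κ i.succ
    rw [Fin.val_succ] at hb
    rw [v, padded_revSums ν (by omega), padded_revSums ν (by omega),
      show m + 2 - (m - (i : ℕ) + 1) = i + 1 by omega, show m + 2 - (m - (i : ℕ)) = i + 2 by omega,
      tailSum_sub, betaParam, betaParam, show m + 1 + 2 - (m - (i : ℕ) + 1) = i + 1 + 1 by omega,
      show m + 1 + 2 - (m - (i : ℕ)) = i + 1 + 2 by omega, hb]
    push_cast
    ring_nf
  · refine prod_congr rfl fun i _ => ?_
    have hi := i.2
    have v : ((Fin.revPerm i : Fin m) : ℕ) = m - (i + 1) := by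
      simp only [Fin.revPerm_apply, Fin.val_rev]
    have s1 := tailSum_sub ν i.castSucc
    have s2 := tailSum_sub ν i.succ
    have s2' := tailSum_eq_add ν i.succ
    rw [Fin.val_castSucc] at s1
    rw [Fin.val_succ, show (i : ℕ) + 1 + 1 = i + 2 by ring, show (i : ℕ) + 1 + 2 = i + 3 by ring]
      at s2 s2'
    rw [v, padded_revSums ν (by omega), padded_revSums ν (by omega), padded_revSums ν (by omega),
      show m + 2 - (m - ((i : ℕ) + 1) + 1) = i + 2 by omega,
      show m + 2 - (m - ((i : ℕ) + 1)) = i + 3 by omega,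
      show m + 2 - (m - ((i : ℕ) + 1) + 2) = i + 1 by omega, s1, s2]
    have b1 : betaParam m κ (m - (i + 1) + 1) = κ 0 + tailSum κ (i + 3) + (m - i) := by
      rw [betaParam, show m + 1 + 2 - (m - (i + 1) + 1) = (i : ℕ) + 3 by omega,
        show m - (i + 1) + 1 = m - (i : ℕ) by omega, Nat.cast_sub (by omega)]
    have a1 : aParam (permParam (cyclicPerm m) κ) ν (i + 1) =
        κ 0 + tailSum κ (i + 3) + 2 * (tailSum ν (i + 2) : ℕ) + m - i := by
      rw [aParam, tailSum_permParam]
      push_cast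
      ring
    have a2 := aParam_eq_add (permParam (cyclicPerm m) κ) ν (j := i + 1) (by omega)
    have z1 : (⟨(i : ℕ) + 1, by omega⟩ : Fin (m + 1)) = i.succ := rfl
    rw [z1] at a2
    have a3 : (ν i.succ : ℝ) + aParam (permParam (cyclicPerm m) κ) ν (i + 2) +
        permParam (cyclicPerm m) κ i.succ.castSucc + 1 =
        betaParam m κ (m - (i + 1) + 1) + (tailSum ν (i + 3) : ℕ) + (tailSum ν (i + 2) : ℕ) := by
      rw [b1, s2']
      rw [a1, s2'] at a2
      push_cast at a2 ⊢
      linarith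
    rw [a3, a1, b1]
    congr 3
    ring

/-- Apart from `rowFactor κ ν ^ 2` the right side depends on `ν` only through the degree. Its Gamma
quotient is positive, so its sign is that of `(|κ| + d)_{2n}`, the only place where the sign of `|κ|
+ d` matters. -/
theorem racahWeight_mul_normSq {m : ℕ} (κ : Fin (m + 1 + 1) → ℝ) (hκ : ∀ i, -1 < κ i)
    (ν : Fin (m + 1) → ℕ) :
    racahWeight m (betaParam m κ) (∑ i, ν i) (revSums ν) *
        normSq (permParam (cyclicPerm m) κ) ν =
      poch (∑ i, κ i + m + 1) (2 * ∑ i, ν i) * (Real.Gamma (∑ i, κ i + m + 1 + 1) /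
        Real.Gamma (∑ i, κ i + m + 1 + 1 + (2 * ∑ i, ν i : ℕ))) * rowFactor κ ν ^ 2 := by
  have hκ' := neg_one_lt_permParam (cyclicPerm m) hκ
  rw [racahWeight_revSums, normSq_formula _ hκ', sum_permParam]
  set κ' := permParam (cyclicPerm m) κ with hκ'_def
  have hA : ∏ i : Fin (m + 1), poch (aParam κ' ν (i + 1) + 1) (ν i) =
      (∏ i : Fin m, poch (aParam κ' ν (i + 1) + 1) (ν i.castSucc)) *
        poch (κ (Fin.last (m + 1)) + 1) (ν (Fin.last m)) := by
    rw [Fin.prod_univ_castSucc, Fin.val_last, aParam_last, hκ'_def, permParam, cyclicPerm_last]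
    rfl
  have hB := Fin.prod_univ_succ fun i : Fin (m + 1) =>
    poch (ν i + aParam κ' ν (i + 1) + κ' i.castSucc + 1) (ν i)
  simp only [Fin.val_zero, zero_add, Fin.val_succ] at hB
  have hC : (∏ i, poch (κ' i.castSucc + 1) (ν i) / (ν i).factorial) *
      (poch (κ (Fin.last (m + 1)) + 1) (ν (Fin.last m)) / poch (κ 0 + 1) (ν (Fin.last m))) =
      rowFactor κ ν := by
    rw [Fin.prod_univ_castSucc, rowFactor, Fin.prod_univ_castSucc, hκ'_def]
    simp only [permParam_cyclicPerm_castSucc]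
    rw [permParam, cyclicPerm_castSucc_last, Fin.succ_last]
    have n1 : poch (κ 0 + 1) (ν (Fin.last m)) ≠ 0 := poch_ne_zero (by linarith [hκ 0]) _
    simp only [Fin.succ_castSucc]
    field_simp
  have hD : poch (∑ i, κ i + m + 1) (∑ i, ν i + tailSum ν 2) *
      poch (ν 0 + aParam κ' ν 1 + κ' (Fin.castSucc 0) + 1) (ν 0) =
      poch (∑ i, κ i + m + 1) (2 * ∑ i, ν i) := by
    have t := tailSum_eq_add ν 0
    rw [Fin.val_zero, zero_add, zero_add, tailSum_one] at t
    have a0 := aParam_eq_add κ' ν (j := 0) (by omega)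
    rw [aParam_zero, sum_permParam] at a0
    have z1 : (⟨0, by omega⟩ : Fin (m + 1)) = 0 := rfl
    rw [z1, zero_add] at a0
    have e : (ν 0 : ℝ) + aParam κ' ν 1 + κ' (Fin.castSucc 0) + 1 =
        ∑ i, κ i + m + 1 + ((∑ i, ν i + tailSum ν 2 : ℕ) : ℝ) := by
      rw [t] at a0 ⊢
      push_cast at a0 ⊢
      linarith
    rw [e, ← poch_add]
    congr 1
    omega
  have hE : aParam κ' ν 0 + 1 = ∑ i, κ i + m + 1 + 1 + (2 * ∑ i, ν i : ℕ) := by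
    rw [aParam_zero, sum_permParam]
    push_cast
    ring
  have p1 : ∏ i : Fin m, poch (aParam κ' ν (i + 1) + 1) (ν i.castSucc) ≠ 0 :=
    prod_ne_zero_iff.mpr fun i _ => poch_ne_zero (by
      have := neg_one_lt_aParam κ' hκ' ν i.castSucc
      rw [Fin.val_castSucc] at this
      linarith) _
  have p2 : ∏ i : Fin m, poch (ν i.succ + aParam κ' ν (i + 1 + 1) + κ' i.succ.castSucc + 1)
      (ν i.succ) ≠ 0 :=
    prod_ne_zero_iff.mpr fun i _ => (poch_norm_pos κ' hκ' ν i.succ).ne'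
  rw [hA, hB, hE, prod_inv_distrib, prod_mul_distrib, ← hD, pow_two]
  nth_rewrite 3 [← hC]
  simp only [show ∀ i : Fin m, (i : ℕ) + 1 + 1 = i + 2 from fun i => by ring] at p2 ⊢
  generalize (∏ i : Fin m, poch (aParam κ' ν (i + 1) + 1) (ν i.castSucc)) = Y₁ at p1 ⊢
  generalize (∏ i : Fin m, poch (ν i.succ + aParam κ' ν (i + 2) + κ' i.succ.castSucc + 1)
      (ν i.succ)) = Y₂ at p2 ⊢
  generalize (∏ i, poch (κ' i.castSucc + 1) (ν i) / ((ν i).factorial : ℝ)) = Y₃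
  push_cast
  rw [← add_assoc]
  field_simp

end SimplexJacobi

end

/-! ### The weight with the dual parameters -/

noncomputable section

namespace SimplexJacobi

open Finset

theorem racahWeight_initSums {m : ℕ} (κ : Fin (m + 1 + 1) → ℝ) (hκ : ∀ i, -1 < κ i)
    (μ : Fin (m + 1) → ℕ) :
    racahWeight m (betaDual m κ (∑ i, μ i)) (∑ i, μ i) (initSums μ) =
      poch (μ 0 + aParam κ μ 1 + κ 0 + 1) (μ 0) / (μ 0).factorial *
        (∏ i : Fin m, poch (κ i.succ.castSucc + 1) (μ i.succ) / (μ i.succ).factorial) *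
        (poch (κ (Fin.last (m + 1)) + 1) (2 * ∑ i, μ i) /
          poch (κ (Fin.last (m + 1)) + 1) (μ (Fin.last m)) / poch (κ 0 + 1) (μ 0)) *
      ∏ i : Fin m, (poch (aParam κ μ (i + 1) + 1) (μ i.castSucc) *
        poch (μ i.succ + aParam κ μ (i + 2) + κ i.succ.castSucc + 1) (μ i.succ))⁻¹ := by
  set n := ∑ i, μ i with hn
  have hdiff : ∀ i : Fin (m + 1), headSum μ (i + 1) - headSum μ i = μ i := by
    intro i
    have h1 := headSum_add_tailSum μ i
    have h2 := headSum_add_tailSum μ (i + 1)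
    have h3 := tailSum_eq_add μ i
    rw [show (i : ℕ) + 1 + 1 = i + 2 by ring] at h2
    omega
  have b0 : betaDual m κ n 0 = κ 0 := by rw [betaDual, if_pos rfl]
  have ba : ∀ j, betaDual m κ n (j + 1) = -aParam κ μ (j + 1) - 2 * (headSum μ (j + 1) : ℕ) := by
    intro j
    rw [betaDual, if_neg (by omega), headSum_eq_sub, aParam, ← hn]
    push_cast
    ring
  have e0 : poch (betaDual m κ n 1 - betaDual m κ n 0) (μ 0) =
      (-1) ^ μ 0 * poch (μ 0 + aParam κ μ 1 + κ 0 + 1) (μ 0) := by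
    have h := headSum_add_tailSum μ 1
    have h' := tailSum_eq_add μ 0
    rw [Fin.val_zero, zero_add, zero_add, tailSum_one] at h'
    rw [show 1 + 1 = 2 from rfl] at h
    have h1 : headSum μ 1 = μ 0 := by omega
    have := ba 0
    rw [zero_add] at this
    rw [this, h1, b0, show -aParam κ μ 1 - 2 * (μ 0 : ℝ) - κ 0 =
      -(aParam κ μ 1 + 2 * (μ 0 : ℝ) + κ 0) by ring, poch_neg]
    congr 2
    ring
  have e1 : ∀ i : Fin m, betaDual m κ n (i + 1 + 1) - betaDual m κ n (i + 1) =
      κ i.succ.castSucc + 1 := by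
    intro i
    have h := tailSum_castSucc κ i
    rw [betaDual, betaDual, if_neg (by omega), if_neg (by omega),
      show (i : ℕ) + 1 + 1 + 1 = i + 3 by ring, show (i : ℕ) + 1 + 1 = i + 2 by ring, h]
    push_cast
    ring
  have hle : μ (Fin.last m) ≤ 2 * n := by
    have := single_le_sum (f := μ) (fun i _ => Nat.zero_le _) (mem_univ (Fin.last m))
    omega
  have hm : n + headSum μ m = 2 * n - μ (Fin.last m) := by
    have h1 := headSum_add_tailSum μ m
    have h2 := tailSum_eq_add μ (Fin.last m)
    rw [Fin.val_last, tailSum_eq_zero μ (j := m + 2) (by omega)] at h2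
    omega
  have e2 : poch (betaDual m κ n (m + 1)) (n + headSum μ m) =
      (-1) ^ (n + headSum μ m) * (poch (κ (Fin.last (m + 1)) + 1) (2 * n) /
        poch (κ (Fin.last (m + 1)) + 1) (μ (Fin.last m))) := by
    have hne := poch_ne_zero (a := κ (Fin.last (m + 1)) + 1) (by linarith [hκ (Fin.last (m + 1))])
      (μ (Fin.last m))
    have hh := headSum_add_tailSum μ (m + 1)
    rw [tailSum_eq_zero μ (by omega), add_zero] at hh
    rw [ba, aParam_last, hh, show -κ (Fin.last (m + 1)) - 2 * ((∑ i, μ i : ℕ) : ℝ) =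
      -(κ (Fin.last (m + 1)) + 2 * (n : ℕ)) by rw [hn]; ring, poch_neg, poch_split _ hle,
      mul_div_cancel_left₀ _ hne, hm, Nat.cast_sub hle]
    congr 2
    push_cast
    ring
  have e3 : ∀ i : Fin m, poch (betaDual m κ n (i + 1) + headSum μ i + headSum μ (i + 1))
      (μ i.castSucc) = (-1) ^ μ i.castSucc * poch (aParam κ μ (i + 1) + 1) (μ i.castSucc) := by
    intro i
    have h := hdiff i.castSucc
    rw [Fin.val_castSucc] at h
    have h' : headSum μ (i + 1) = headSum μ i + μ i.castSucc := by
      have h1 := headSum_add_tailSum μ i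
      have h2 := headSum_add_tailSum μ (i + 1)
      have h3 := tailSum_eq_add μ i.castSucc
      rw [Fin.val_castSucc] at h3
      rw [show (i : ℕ) + 1 + 1 = i + 2 by ring] at h2
      omega
    rw [ba, h', show -aParam κ μ (i + 1) - 2 * ((headSum μ i + μ i.castSucc : ℕ) : ℝ) + headSum μ i +
      ((headSum μ i + μ i.castSucc : ℕ) : ℝ) = -(aParam κ μ (i + 1) + μ i.castSucc) by
        push_cast; ring, poch_neg]
    congr 2
    ring
  have e4 : ∀ i : Fin m, poch (betaDual m κ n (i + 1) + 2 * headSum μ (i + 1) + 1) (μ i.succ) =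
      (-1) ^ μ i.succ *
        poch (μ i.succ + aParam κ μ (i + 2) + κ i.succ.castSucc + 1) (μ i.succ) := by
    intro i
    have a2 := aParam_eq_add κ μ (j := i + 1) (by omega)
    have z1 : (⟨(i : ℕ) + 1, by omega⟩ : Fin (m + 1)) = i.succ := rfl
    rw [z1] at a2
    rw [ba, show -aParam κ μ (i + 1) - 2 * ((headSum μ (i + 1) : ℕ) : ℝ) +
      2 * ((headSum μ (i + 1) : ℕ) : ℝ) + 1 = -(aParam κ μ (i + 1) - 1) by ring, poch_neg, a2]
    congr 2
    ring
  -- Reflecting the Pochhammer symbols at negative arguments produces signs; with `n = |μ|` their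
  -- exponents add up to `4n - 2μ_d`.
  have hsign : (-1 : ℝ) ^ μ 0 * (-1) ^ (n + headSum μ m) *
      ∏ i : Fin m, ((-1 : ℝ) ^ μ i.castSucc * (-1) ^ μ i.succ)⁻¹ = 1 := by
    have s1 : ∑ i, μ i = ∑ i : Fin m, μ i.castSucc + μ (Fin.last m) := Fin.sum_univ_castSucc _
    have s2 : ∑ i, μ i = μ 0 + ∑ i : Fin m, μ i.succ := Fin.sum_univ_succ _
    rw [prod_inv_distrib, prod_mul_distrib, prod_pow_eq_pow_sum, prod_pow_eq_pow_sum, ← pow_add,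
      ← pow_add, ← inv_pow, inv_neg, inv_one, ← pow_add]
    refine Even.neg_one_pow ⟨2 * n - μ (Fin.last m), ?_⟩
    omega
  unfold racahWeight
  rw [prod_range, prod_range, Fin.prod_univ_succ]
  have p1 : ∀ j ≤ m + 1, padded n (initSums μ) j = headSum μ j := fun j hj =>
    padded_initSums μ hj
  have q1 : ∀ i : Fin m, poch (betaDual m κ n ((i.succ : ℕ) + 1) - betaDual m κ n (i.succ : ℕ))
      (padded n (initSums μ) ((i.succ : ℕ) + 1) - padded n (initSums μ) (i.succ : ℕ)) /
      ((padded n (initSums μ) ((i.succ : ℕ) + 1) - padded n (initSums μ) (i.succ : ℕ)).factorial : ℝ)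
      = poch (κ i.succ.castSucc + 1) (μ i.succ) / (μ i.succ).factorial := by
    intro i
    rw [p1 _ (by omega), p1 _ (by omega), hdiff, Fin.val_succ, e1]
  have q2 : ∀ i : Fin m, (poch (betaDual m κ n ((i : ℕ) + 1) + padded n (initSums μ) (i : ℕ) +
        padded n (initSums μ) (i + 1)) (padded n (initSums μ) (i + 1) - padded n (initSums μ) i) *
      poch (betaDual m κ n ((i : ℕ) + 1) + 2 * padded n (initSums μ) (i + 1) + 1)
        (padded n (initSums μ) (i + 2) - padded n (initSums μ) (i + 1)))⁻¹ =
      ((-1 : ℝ) ^ μ i.castSucc * (-1) ^ μ i.succ)⁻¹ *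
      (poch (aParam κ μ (i + 1) + 1) (μ i.castSucc) *
        poch (μ i.succ + aParam κ μ (i + 2) + κ i.succ.castSucc + 1) (μ i.succ))⁻¹ := by
    intro i
    have d1 := hdiff i.castSucc
    have d2 := hdiff i.succ
    rw [Fin.val_castSucc] at d1
    rw [Fin.val_succ] at d2
    rw [p1 _ (by omega), p1 _ (by omega), p1 _ (by omega), d1, d2, e3, e4, ← mul_inv]
    congr 1
    ring
  have d0 := hdiff 0
  rw [Fin.val_zero, zero_add] at d0
  rw [prod_congr rfl fun i _ => q1 i, prod_congr rfl fun i _ => q2 i, Fin.val_zero, zero_add,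
    p1 _ (by omega), p1 _ (by omega), p1 _ (by omega), d0, e0, e2, b0, prod_mul_distrib]
  have h1 : headSum μ 1 = μ 0 := by rw [← d0, headSum_zero, tsub_zero]
  rw [h1]
  linear_combination (poch (μ 0 + aParam κ μ 1 + κ 0 + 1) (μ 0) / (μ 0).factorial *
        (∏ i : Fin m, poch (κ i.succ.castSucc + 1) (μ i.succ) / (μ i.succ).factorial) *
        (poch (κ (Fin.last (m + 1)) + 1) (2 * n) /
          poch (κ (Fin.last (m + 1)) + 1) (μ (Fin.last m)) / poch (κ 0 + 1) (μ 0)) *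
      ∏ i : Fin m, (poch (aParam κ μ (i + 1) + 1) (μ i.castSucc) *
        poch (μ i.succ + aParam κ μ (i + 2) + κ i.succ.castSucc + 1) (μ i.succ))⁻¹) * hsign

/-- The dual analogue of `racahWeight_mul_normSq`. Its constant is always positive because `κ_{d+1}
> -1`, so (ii) needs no distinction of cases. -/
theorem racahWeight_initSums_eq {m : ℕ} (κ : Fin (m + 1 + 1) → ℝ) (hκ : ∀ i, -1 < κ i)
    (μ : Fin (m + 1) → ℕ) :
    racahWeight m (betaDual m κ (∑ i, μ i)) (∑ i, μ i) (initSums μ) =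
      poch (κ (Fin.last (m + 1)) + 1) (2 * ∑ i, μ i) *
        (Real.Gamma (∑ i, κ i + m + 1 + 1 + (2 * ∑ i, μ i : ℕ)) /
          Real.Gamma (∑ i, κ i + m + 1 + 1)) * (colDual κ μ ^ 2 * normSq κ μ) := by
  have hs : 0 < ∑ i, κ i + m + 1 + 1 := by
    have := neg_card_lt_sum κ hκ
    push_cast at this
    linarith
  have g1 := (Real.Gamma_pos_of_pos hs).ne'
  have g2 := (Real.Gamma_pos_of_pos (show 0 < ∑ i, κ i + m + 1 + 1 + (2 * ∑ i, μ i : ℕ) by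
    have : (0 : ℝ) ≤ (2 * ∑ i, μ i : ℕ) := Nat.cast_nonneg _
    linarith)).ne'
  have hE : aParam κ μ 0 + 1 = ∑ i, κ i + m + 1 + 1 + (2 * ∑ i, μ i : ℕ) := by
    rw [aParam_zero]
    push_cast
    ring
  rw [racahWeight_initSums κ hκ, normSq_formula κ hκ, hE, colDual]
  have hA := Fin.prod_univ_succ fun i : Fin (m + 1) => poch (aParam κ μ (i + 1) + 1) (μ i)
  have hA' : ∏ i : Fin (m + 1), poch (aParam κ μ (i + 1) + 1) (μ i) =
      (∏ i : Fin m, poch (aParam κ μ (i + 1) + 1) (μ i.castSucc)) *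
        poch (κ (Fin.last (m + 1)) + 1) (μ (Fin.last m)) := by
    rw [Fin.prod_univ_castSucc, Fin.val_last, aParam_last]
    rfl
  have hB := Fin.prod_univ_succ fun i : Fin (m + 1) =>
    poch (μ i + aParam κ μ (i + 1) + κ i.castSucc + 1) (μ i)
  have hC := Fin.prod_univ_succ fun i : Fin (m + 1) =>
    poch (κ i.castSucc + 1) (μ i) / ((μ i).factorial : ℝ)
  simp only [Fin.val_zero, zero_add, Fin.val_succ, Fin.castSucc_zero,
    show ∀ i : Fin m, (i : ℕ) + 1 + 1 = i + 2 from fun i => by ring] at hA hB hC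
  have n0 : poch (κ 0 + 1) (μ 0) ≠ 0 := poch_ne_zero (by linarith [hκ 0]) _
  have n1 : ∏ i : Fin (m + 1), poch (aParam κ μ (i + 1) + 1) (μ i) ≠ 0 :=
    prod_ne_zero_iff.mpr fun i _ => poch_ne_zero (by linarith [neg_one_lt_aParam κ hκ μ i]) _
  have n2 : ∏ i : Fin m, poch (μ i.succ + aParam κ μ (i + 2) + κ i.succ.castSucc + 1)
      (μ i.succ) ≠ 0 :=
    prod_ne_zero_iff.mpr fun i _ => (poch_norm_pos κ hκ μ i.succ).ne'
  have n3 : poch (κ (Fin.last (m + 1)) + 1) (μ (Fin.last m)) ≠ 0 :=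
    poch_ne_zero (by linarith [hκ (Fin.last (m + 1))]) _
  have hcomm : ∀ i : Fin m, aParam κ μ (i + 2) + κ i.succ.castSucc + 1 + (μ i.succ : ℝ) =
      μ i.succ + aParam κ μ (i + 2) + κ i.succ.castSucc + 1 := fun i => by ring
  simp only [hcomm]
  rw [prod_inv_distrib, prod_mul_distrib, prod_inv_distrib, prod_mul_distrib, hB, hC]
  rw [hA] at n1 hA'
  rw [hA]
  have n4 := left_ne_zero_of_mul n1
  have n5 := right_ne_zero_of_mul n1
  have n6 : ∏ i : Fin m, poch (aParam κ μ (i + 1) + 1) (μ i.castSucc) ≠ 0 :=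
    left_ne_zero_of_mul (hA' ▸ n1)
  generalize (∏ i : Fin m, poch (aParam κ μ (i + 1) + 1) (μ i.castSucc)) = Y₁ at *
  generalize (∏ i : Fin m, poch (μ i.succ + aParam κ μ (i + 2) + κ i.succ.castSucc + 1)
      (μ i.succ)) = Y₂ at *
  generalize (∏ i : Fin m, poch (κ i.succ.castSucc + 1) (μ i.succ) /
    ((μ i.succ).factorial : ℝ)) = Y₃ at *
  generalize (∏ i : Fin m, poch (aParam κ μ (i + 2) + 1) (μ i.succ)) = Y₄ at *
  generalize poch (aParam κ μ 1 + 1) (μ 0) = Y₅ at *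
  generalize poch (κ (Fin.last (m + 1)) + 1) (μ (Fin.last m)) = Y₆ at *
  have f1 : ((μ 0).factorial : ℝ) ≠ 0 := Nat.cast_ne_zero.mpr (Nat.factorial_ne_zero _)
  push_cast at g1 g2 ⊢
  have hY : Y₁ = Y₅ * Y₄ / Y₆ := by rw [hA', mul_div_cancel_right₀ _ n3]
  rw [hY, ← add_assoc]
  field_simp

theorem rowFactor_pos {m : ℕ} (κ : Fin (m + 1 + 1) → ℝ) (hκ : ∀ i, -1 < κ i)
    (ν : Fin (m + 1) → ℕ) : 0 < rowFactor κ ν :=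
  prod_pos fun i _ => div_pos (poch_pos (by linarith [hκ i.succ]) _)
    (Nat.cast_pos.mpr (Nat.factorial_pos _))

theorem poch_norm_pos' {m : ℕ} (κ : Fin (m + 1 + 1) → ℝ) (hκ : ∀ i, -1 < κ i)
    (μ : Fin (m + 1) → ℕ) (i : Fin m) : 0 < poch (aParam κ μ (i + 2) + 1) (μ i.succ) *
      poch (aParam κ μ (i + 2) + κ i.succ.castSucc + 1 + μ i.succ) (μ i.succ) := by
  have h1 := neg_one_lt_aParam κ hκ μ i.succ
  have h2 := poch_norm_pos κ hκ μ i.succ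
  rw [Fin.val_succ, show (i : ℕ) + 1 + 1 = i + 2 by ring] at h1 h2
  refine mul_pos (poch_pos (by linarith) _) ?_
  rwa [show aParam κ μ (i + 2) + κ i.succ.castSucc + 1 + (μ i.succ : ℝ) =
    μ i.succ + aParam κ μ (i + 2) + κ i.succ.castSucc + 1 by ring]

theorem colFactor_pos {m : ℕ} (κ : Fin (m + 1 + 1) → ℝ) (hκ : ∀ i, -1 < κ i)
    (μ : Fin (m + 1) → ℕ) : 0 < colFactor κ μ := by
  have h := neg_one_lt_aParam κ hκ μ 0
  rw [Fin.val_zero, zero_add] at h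
  exact mul_pos (div_pos (Nat.cast_pos.mpr (Nat.factorial_pos _)) (poch_pos (by linarith) _))
    (prod_pos fun i _ => inv_pos.mpr (mul_pos (poch_pos (by linarith [hκ i.succ.castSucc]) _)
      (poch_norm_pos' κ hκ μ i)))

theorem colDual_pos {m : ℕ} (κ : Fin (m + 1 + 1) → ℝ) (hκ : ∀ i, -1 < κ i)
    (μ : Fin (m + 1) → ℕ) : 0 < colDual κ μ := by
  have h := neg_one_lt_aParam κ hκ μ 0
  rw [Fin.val_zero, zero_add] at h
  exact mul_pos (inv_pos.mpr (mul_pos (poch_pos (by linarith [hκ 0]) _)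
    (poch_pos (by linarith) _))) (prod_pos fun i _ => inv_pos.mpr (poch_norm_pos' κ hκ μ i))

theorem rowDual_pos {m : ℕ} (κ : Fin (m + 1 + 1) → ℝ) (hκ : ∀ i, -1 < κ i)
    (ν : Fin (m + 1) → ℕ) : 0 < rowDual κ ν :=
  mul_pos (mul_pos (poch_pos (by linarith [hκ 0]) _)
    (poch_pos (by linarith [hκ (Fin.last (m + 1))]) _))
    (prod_pos fun i _ => inv_pos.mpr (Nat.cast_pos.mpr (Nat.factorial_pos _)))

end SimplexJacobi

end

noncomputable section

namespace SimplexJacobi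

open Finset MeasureTheory

/-! ### Invariance of the inner product under the cyclic rotation -/

theorem rot_eq_finRotate {m : ℕ} (x : Fin (m + 1) → ℝ) (i : Fin (m + 1)) :
    rot x i = x (finRotate (m + 1) i) := by
  refine Fin.lastCases ?_ (fun i => ?_) i
  · rw [rot, Fin.snoc_last, finRotate_last]
  · rw [rot, Fin.snoc_castSucc, Fin.tail, finRotate_apply, Fin.coeSucc_eq_succ]

theorem sum_rot {m : ℕ} (x : Fin (m + 1) → ℝ) : ∑ i, rot x i = ∑ i, x i := by
  simp only [rot_eq_finRotate]
  exact Equiv.sum_comp (finRotate (m + 1)) x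

/-- The rotation of the coordinates as a measurable equivalence. -/
def rotEquiv (m : ℕ) : (Fin (m + 1) → ℝ) ≃ᵐ (Fin (m + 1) → ℝ) :=
  MeasurableEquiv.piCongrLeft (fun _ => ℝ) (finRotate (m + 1)).symm

theorem rotEquiv_apply {m : ℕ} (x : Fin (m + 1) → ℝ) : rotEquiv m x = rot x := by
  funext i
  rw [rot_eq_finRotate]
  have h := Equiv.piCongrLeft_apply_apply (fun _ : Fin (m + 1) => ℝ) (finRotate (m + 1)).symm x
    (finRotate (m + 1) i)
  rw [Equiv.symm_apply_apply] at h
  exact h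

theorem rot_mem_simplex {m : ℕ} (x : Fin (m + 1) → ℝ) :
    rot x ∈ simplex (m + 1) ↔ x ∈ simplex (m + 1) := by
  have h : (∀ i, 0 ≤ rot x i) ↔ ∀ i, 0 ≤ x i := by
    simp only [rot_eq_finRotate]
    exact (finRotate (m + 1)).forall_congr_left.trans (by simp)
  simp only [simplex, Set.mem_ofPred_eq, sum_rot, h]

theorem jacobiWeight_rot {m : ℕ} (κ : Fin (m + 1 + 1) → ℝ) (x : Fin (m + 1) → ℝ) :
    jacobiWeight (permParam (cyclicPerm m) κ) (rot x) = jacobiWeight κ x := by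
  have e : ∀ i : Fin (m + 1), permParam (cyclicPerm m) κ i.castSucc =
      κ (finRotate (m + 1) i).castSucc := by
    intro i
    rw [permParam_cyclicPerm, Fin.snoc_castSucc, rot_eq_finRotate, Fin.init]
  unfold jacobiWeight
  rw [sum_rot]
  simp only [e, rot_eq_finRotate]
  rw [Equiv.prod_comp (finRotate (m + 1)) fun i => x i ^ κ i.castSucc, permParam, cyclicPerm_last]

/-- The rotation permutes coordinates: it preserves volume and simplex, and carries one weight to
the other. -/
theorem jacobiInner_rot {m : ℕ} (κ : Fin (m + 1 + 1) → ℝ) (f g : (Fin (m + 1) → ℝ) → ℝ) :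
    jacobiInner (permParam (cyclicPerm m) κ) f g =
      jacobiInner κ (fun x => f (rot x)) (fun x => g (rot x)) := by
  have hmp : MeasurePreserving (rotEquiv m) volume volume :=
    volume_measurePreserving_piCongrLeft (fun _ => ℝ) (finRotate (m + 1)).symm
  have h := hmp.setIntegral_preimage_emb (rotEquiv m).measurableEmbedding
    (fun x => f x * g x * jacobiWeight (permParam (cyclicPerm m) κ) x) (simplex (m + 1))
  have hs : rotEquiv m ⁻¹' simplex (m + 1) = simplex (m + 1) := by
    ext x
    rw [Set.mem_preimage, rotEquiv_apply, rot_mem_simplex]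
  simp only [hs, rotEquiv_apply, jacobiWeight_rot] at h
  have hg : ∏ i, Real.Gamma (permParam (cyclicPerm m) κ i + 1) = ∏ i, Real.Gamma (κ i + 1) :=
    Equiv.prod_comp (cyclicPerm m) fun i => Real.Gamma (κ i + 1)
  rw [jacobiInner, sum_permParam, hg, ← h, jacobiInner]

/-! ### Orthogonality of the connection coefficients -/

theorem isConnectionCoeff_cycCoef (m n : ℕ) (κ : Fin (m + 1 + 1) → ℝ) (hκ : ∀ i, -1 < κ i) :
    IsConnectionCoeff (cyclicPerm m) κ n (cycCoef m κ) := by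
  intro ν hν x
  rw [mem_multiIdx] at hν
  have h := simplexJac_rot m κ hκ ν 1 x
  simp only [simplexJac_one, hν] at h
  rw [permPoint_cyclicPerm, h]

/-- The difference of two expansions is the zero function, and its squared norm is a sum of squares
with positive weights. -/
theorem IsConnectionCoeff.unique {m n : ℕ} {κ : Fin (m + 1 + 1) → ℝ} (hκ : ∀ i, -1 < κ i)
    {c c' : (Fin (m + 1) → ℕ) → (Fin (m + 1) → ℕ) → ℝ}
    (hc : IsConnectionCoeff (cyclicPerm m) κ n c) (hc' : IsConnectionCoeff (cyclicPerm m) κ n c')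
    {ν : Fin (m + 1) → ℕ} (hν : ν ∈ multiIdx (m + 1) n) {μ : Fin (m + 1) → ℕ}
    (hμ : μ ∈ multiIdx (m + 1) n) : c' ν μ = c ν μ := by
  have h0 : ∀ x, ∑ μ ∈ multiIdx (m + 1) n, (c' ν μ - c ν μ) * simplexJacobi κ μ x = 0 := fun x => by
    simp only [sub_mul, sum_sub_distrib]
    rw [← hc ν hν x, ← hc' ν hν x, sub_self]
  have h := jacobiInner_sum κ hκ (multiIdx (m + 1) n) (fun μ => c' ν μ - c ν μ)
    (fun μ => c' ν μ - c ν μ)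
  simp only [h0] at h
  have hz : jacobiInner κ (fun _ => 0) (fun _ => 0) = 0 := by simp [jacobiInner]
  rw [hz, eq_comm, sum_eq_zero_iff_of_nonneg fun μ _ =>
    mul_nonneg (mul_self_nonneg _) (normSq_pos κ hκ μ).le] at h
  have := h μ hμ
  simpa [(normSq_pos κ hκ μ).ne', sub_eq_zero] using this

/-- The inner product of two rotated polynomials computed in two ways: by invariance, and from their
expansions. -/
theorem IsConnectionCoeff.sum_mul {m n : ℕ} {κ : Fin (m + 1 + 1) → ℝ} (hκ : ∀ i, -1 < κ i)
    {c : (Fin (m + 1) → ℕ) → (Fin (m + 1) → ℕ) → ℝ}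
    (hc : IsConnectionCoeff (cyclicPerm m) κ n c) {ν ν' : Fin (m + 1) → ℕ}
    (hν : ν ∈ multiIdx (m + 1) n) (hν' : ν' ∈ multiIdx (m + 1) n) :
    ∑ μ ∈ multiIdx (m + 1) n, c ν μ * c ν' μ * normSq κ μ =
      if ν = ν' then normSq (permParam (cyclicPerm m) κ) ν else 0 := by
  rw [← jacobiInner_sum κ hκ, ← jacobiInner_eq_ite _ (neg_one_lt_permParam _ hκ), jacobiInner_rot]
  simp only [← hc ν hν, ← hc ν' hν', permPoint_cyclicPerm]

theorem IsConnectionCoeff.sum_normalized_mul {m n : ℕ} {κ : Fin (m + 1 + 1) → ℝ}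
    (hκ : ∀ i, -1 < κ i) {c : (Fin (m + 1) → ℕ) → (Fin (m + 1) → ℕ) → ℝ}
    (hc : IsConnectionCoeff (cyclicPerm m) κ n c) {ν ν' : Fin (m + 1) → ℕ}
    (hν : ν ∈ multiIdx (m + 1) n) (hν' : ν' ∈ multiIdx (m + 1) n) :
    ∑ μ ∈ multiIdx (m + 1) n, normalizedCoeff (cyclicPerm m) κ c ν μ *
      normalizedCoeff (cyclicPerm m) κ c ν' μ = if ν = ν' then 1 else 0 := by
  have hκ' := neg_one_lt_permParam (cyclicPerm m) hκ
  have hB := fun ν => normSq_pos _ hκ' ν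
  have hA := fun μ => normSq_pos _ hκ μ
  have h : ∀ μ, normalizedCoeff (cyclicPerm m) κ c ν μ * normalizedCoeff (cyclicPerm m) κ c ν' μ =
      (√(normSq (permParam (cyclicPerm m) κ) ν))⁻¹ * (√(normSq (permParam (cyclicPerm m) κ) ν'))⁻¹ *
        (c ν μ * c ν' μ * normSq κ μ) := by
    intro μ
    rw [normalizedCoeff, normalizedCoeff, Real.sqrt_div (hA μ).le, Real.sqrt_div (hA μ).le]
    linear_combination (√(normSq (permParam (cyclicPerm m) κ) ν))⁻¹ *
      (√(normSq (permParam (cyclicPerm m) κ) ν'))⁻¹ * c ν μ * c ν' μ *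
        Real.mul_self_sqrt (hA μ).le
  rw [sum_congr rfl fun μ _ => h μ, ← mul_sum, hc.sum_mul hκ hν hν']
  split_ifs with e
  · rw [← e, ← mul_inv, Real.mul_self_sqrt (hB ν).le, inv_mul_cancel₀ (hB ν).ne']
  · rw [mul_zero]

/-- For a square matrix, orthonormal rows force orthonormal columns. Part (i) normalizes over `ν`,
hence needs the columns. -/
theorem IsConnectionCoeff.sum_normalized_sq_left {m n : ℕ} {κ : Fin (m + 1 + 1) → ℝ}
    (hκ : ∀ i, -1 < κ i) {c : (Fin (m + 1) → ℕ) → (Fin (m + 1) → ℕ) → ℝ}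
    (hc : IsConnectionCoeff (cyclicPerm m) κ n c) {μ : Fin (m + 1) → ℕ}
    (hμ : μ ∈ multiIdx (m + 1) n) :
    ∑ ν ∈ multiIdx (m + 1) n, normalizedCoeff (cyclicPerm m) κ c ν μ ^ 2 = 1 := by
  let M : Matrix (multiIdx (m + 1) n) (multiIdx (m + 1) n) ℝ := fun ν μ =>
    normalizedCoeff (cyclicPerm m) κ c ν μ
  have h : M * M.transpose = 1 := by
    ext ν ν'
    rw [Matrix.mul_apply, Matrix.one_apply]
    have := hc.sum_normalized_mul hκ ν.2 ν'.2
    rw [← sum_coe_sort] at this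
    simp only [Subtype.ext_iff]
    exact this
  have h' : (M.transpose * M) ⟨μ, hμ⟩ ⟨μ, hμ⟩ = 1 := by
    rw [mul_eq_one_comm.mp h, Matrix.one_apply_eq]
  rw [Matrix.mul_apply] at h'
  rw [← sum_coe_sort, ← h']
  exact sum_congr rfl fun ν _ => pow_two _

/-- If the entries of a unit vector are `± a r` with `a²` proportional to `w`, the proportionality
constant must be the reciprocal of the `w`-norm of `r` squared. Hence the constants need not be
evaluated. -/
theorem eq_sqrt_mul_normalized {ι : Type*} {s : Finset ι} {e ε a w r : ι → ℝ} {T : ℝ} (hT : 0 < T)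
    (hε : ∀ i, ε i ^ 2 = 1) (ha : ∀ i ∈ s, 0 < a i) (hw : ∀ i ∈ s, w i * T = a i ^ 2)
    (he : ∀ i ∈ s, e i = ε i * (a i * r i)) (h1 : ∑ i ∈ s, e i ^ 2 = 1) {i : ι} (hi : i ∈ s) :
    e i = ε i * √(w i) * (r i / √(∑ j ∈ s, w j * r j ^ 2)) := by
  have hS : (∑ j ∈ s, w j * r j ^ 2) * T = 1 := by
    rw [← h1, sum_mul]
    refine sum_congr rfl fun j hj => ?_
    rw [he j hj, mul_pow, hε, mul_pow, ← hw j hj]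
    ring
  have hS' : √(∑ j ∈ s, w j * r j ^ 2) = (√T)⁻¹ := by
    rw [eq_inv_of_mul_eq_one_left hS, Real.sqrt_inv]
  have hsw : √(w i) = a i / √T := by
    rw [eq_div_of_mul_eq hT.ne' (hw i hi), Real.sqrt_div' _ hT.le, Real.sqrt_sq (ha i hi).le]
  have := (Real.sqrt_pos.mpr hT).ne'
  rw [hS', hsw, he i hi]
  field_simp

/-! ### The connection coefficients as Racah polynomials -/

/-- The scalar `σ` makes the weight positive on the grid; it will be `1` or `-1`. Here `μ` is fixed
and the unit vector is a column of the normalized matrix. -/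
theorem normalizedCoeff_eq_racahHat {m n : ℕ} {κ : Fin (m + 1 + 1) → ℝ} (hκ : ∀ i, -1 < κ i)
    {σ : ℝ} (hσ : 0 < σ * poch (∑ i, κ i + m + 1) (2 * n)) {ν μ : Fin (m + 1) → ℕ}
    (hν : ν ∈ multiIdx (m + 1) n) (hμ : μ ∈ multiIdx (m + 1) n) :
    normalizedCoeff (cyclicPerm m) κ (cycCoef m κ) ν μ = (-1) ^ (n + ν (Fin.last m)) *
      √(σ * racahWeight m (betaParam m κ) n (revSums ν)) *
        racahHat m (betaParam m κ) n (fun y => σ * racahWeight m (betaParam m κ) n y)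
          (revIdx μ) (revSums ν) := by
  have hκ' := neg_one_lt_permParam (cyclicPerm m) hκ
  have hA := normSq_pos _ hκ μ
  have hc := colFactor_pos κ hκ μ
  have hs : 0 < ∑ i, κ i + m + 1 + 1 := by
    have := neg_card_lt_sum κ hκ
    push_cast at this
    linarith
  have hG : 0 < Real.Gamma (∑ i, κ i + m + 1 + 1) /
      Real.Gamma (∑ i, κ i + m + 1 + 1 + (2 * n : ℕ)) :=
    div_pos (Real.Gamma_pos_of_pos hs) (Real.Gamma_pos_of_pos (by positivity))
  set K := σ * poch (∑ i, κ i + m + 1) (2 * n) * (Real.Gamma (∑ i, κ i + m + 1 + 1) /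
    Real.Gamma (∑ i, κ i + m + 1 + 1 + (2 * n : ℕ))) with hK_def
  have hK : 0 < K := mul_pos hσ hG
  rw [racahHat, ← sum_revSums fun y => σ * racahWeight m (betaParam m κ) n y *
    racahPoly m (betaParam m κ) n (revIdx μ) y ^ 2]
  refine eq_sqrt_mul_normalized (s := multiIdx (m + 1) n)
    (e := fun ν => normalizedCoeff (cyclicPerm m) κ (cycCoef m κ) ν μ)
    (ε := fun ν => (-1) ^ (n + ν (Fin.last m)))
    (a := fun ν => √(normSq κ μ / normSq (permParam (cyclicPerm m) κ) ν) *
      (rowFactor κ ν * colFactor κ μ))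
    (w := fun ν => σ * racahWeight m (betaParam m κ) n (revSums ν))
    (r := fun ν => racahPoly m (betaParam m κ) n (revIdx μ) (revSums ν))
    -- Determined by `w T = a²`: the factors of `a²` depending on `ν` form `w / K`, and the rest
    -- depends on `μ` alone.
    (T := normSq κ μ * colFactor κ μ ^ 2 / K)
    (by positivity) (fun ν => by rw [← pow_mul, mul_comm, pow_mul]; simp) ?_ ?_ ?_
    ((isConnectionCoeff_cycCoef m n κ hκ).sum_normalized_sq_left hκ hμ) hν
  · intro ν _
    have := normSq_pos _ hκ' ν
    have := rowFactor_pos κ hκ ν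
    positivity
  · intro ν hν
    rw [mem_multiIdx] at hν
    have hB := normSq_pos _ hκ' ν
    have h := racahWeight_mul_normSq κ hκ ν
    rw [hν] at h
    have h' : σ * racahWeight m (betaParam m κ) n (revSums ν) =
        K * rowFactor κ ν ^ 2 / normSq (permParam (cyclicPerm m) κ) ν := by
      rw [eq_div_iff hB.ne', mul_assoc, h, hK_def]
      ring
    rw [h', mul_pow, Real.sq_sqrt (by positivity)]
    field_simp
  · intro ν hν
    rw [mem_multiIdx] at hν hμ
    rw [normalizedCoeff, cycCoef_eq κ hκ ν μ (hν.trans hμ.symm), ← racahPoly_rev, hν]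
    ring

/-- Here `ν` is fixed and the unit vector is a row of the normalized matrix, with `μ` running over
the grid. -/
theorem normalizedCoeff_eq_racahHat_dual {m n : ℕ} {κ : Fin (m + 1 + 1) → ℝ} (hκ : ∀ i, -1 < κ i)
    {ν μ : Fin (m + 1) → ℕ} (hν : ν ∈ multiIdx (m + 1) n) (hμ : μ ∈ multiIdx (m + 1) n) :
    normalizedCoeff (cyclicPerm m) κ (cycCoef m κ) ν μ = (-1) ^ (n + ν (Fin.last m)) *
      √(racahWeight m (betaDual m κ n) n (initSums μ)) *
        racahHat m (betaDual m κ n) n (racahWeight m (betaDual m κ n) n)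
          (initIdx ν) (initSums μ) := by
  have hκ' := neg_one_lt_permParam (cyclicPerm m) hκ
  have hB := normSq_pos _ hκ' ν
  have hr := rowDual_pos κ hκ ν
  have hs : 0 < ∑ i, κ i + m + 1 + 1 := by
    have := neg_card_lt_sum κ hκ
    push_cast at this
    linarith
  set K := poch (κ (Fin.last (m + 1)) + 1) (2 * n) *
    (Real.Gamma (∑ i, κ i + m + 1 + 1 + (2 * n : ℕ)) / Real.Gamma (∑ i, κ i + m + 1 + 1)) with hK_def
  have hK : 0 < K := mul_pos (poch_pos (by linarith [hκ (Fin.last (m + 1))]) _)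
    (div_pos (Real.Gamma_pos_of_pos (by positivity)) (Real.Gamma_pos_of_pos hs))
  rw [racahHat, ← sum_initSums fun y => racahWeight m (betaDual m κ n) n y *
    racahPoly m (betaDual m κ n) n (initIdx ν) y ^ 2]
  refine eq_sqrt_mul_normalized (s := multiIdx (m + 1) n)
    (e := fun μ => normalizedCoeff (cyclicPerm m) κ (cycCoef m κ) ν μ)
    (ε := fun _ => (-1) ^ (n + ν (Fin.last m)))
    (a := fun μ => √(normSq κ μ / normSq (permParam (cyclicPerm m) κ) ν) *
      (rowDual κ ν * colDual κ μ))
    (w := fun μ => racahWeight m (betaDual m κ n) n (initSums μ))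
    (r := fun μ => racahPoly m (betaDual m κ n) n (initIdx ν) (initSums μ))
    (T := rowDual κ ν ^ 2 / (normSq (permParam (cyclicPerm m) κ) ν * K))
    (by positivity) (fun _ => by rw [← pow_mul, mul_comm, pow_mul]; simp) ?_ ?_ ?_ ?_ hμ
  · intro μ _
    have := normSq_pos _ hκ μ
    have := colDual_pos κ hκ μ
    positivity
  · intro μ hμ
    rw [mem_multiIdx] at hμ
    have hA := normSq_pos _ hκ μ
    have h := racahWeight_initSums_eq κ hκ μ
    rw [hμ, ← hK_def] at h
    rw [h, mul_pow, Real.sq_sqrt (by positivity)]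
    field_simp
  · intro μ hμ
    rw [mem_multiIdx] at hν hμ
    have h := hν.trans hμ.symm
    have hp := racahPoly_init κ ν μ h
    rw [hμ] at hp
    rw [normalizedCoeff, cycCoef_eq_dual κ hκ ν μ h, hν, hp]
    ring
  · have h := (isConnectionCoeff_cycCoef m n κ hκ).sum_normalized_mul hκ hν hν
    rw [if_pos rfl] at h
    simpa only [pow_two] using h

end SimplexJacobi

end

theorem mainTheorem1 (m n : ℕ) (κ : Fin (m + 1 + 1) → ℝ) (hκ : ∀ i, -1 < κ i) :
    ∃ c : (Fin (m + 1) → ℕ) → (Fin (m + 1) → ℕ) → ℝ,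
      SimplexJacobi.IsConnectionCoeff (SimplexJacobi.cyclicPerm m) κ n c ∧
      (∀ c' : (Fin (m + 1) → ℕ) → (Fin (m + 1) → ℕ) → ℝ,
        SimplexJacobi.IsConnectionCoeff (SimplexJacobi.cyclicPerm m) κ n c' →
        ∀ ν ∈ SimplexJacobi.multiIdx (m + 1) n, ∀ μ ∈ SimplexJacobi.multiIdx (m + 1) n,
          c' ν μ = c ν μ) ∧
      ∀ ν ∈ SimplexJacobi.multiIdx (m + 1) n, ∀ μ ∈ SimplexJacobi.multiIdx (m + 1) n,
        ((0 < (∑ i, κ i) + (m + 1 : ℕ) ∨ n = 0) →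
          SimplexJacobi.normalizedCoeff (SimplexJacobi.cyclicPerm m) κ c ν μ =
            (-1) ^ (n + ν (Fin.last m)) *
              √(SimplexJacobi.racahWeight m (SimplexJacobi.betaParam m κ) n
                  (SimplexJacobi.revSums ν)) *
              SimplexJacobi.racahHat m (SimplexJacobi.betaParam m κ) n
                (SimplexJacobi.racahWeight m (SimplexJacobi.betaParam m κ) n)
                (SimplexJacobi.revIdx μ) (SimplexJacobi.revSums ν)) ∧
        (((∑ i, κ i) + (m + 1 : ℕ) < 0 ∧ 1 ≤ n) →
          SimplexJacobi.normalizedCoeff (SimplexJacobi.cyclicPerm m) κ c ν μ =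
            (-1) ^ (n + ν (Fin.last m)) *
              √(-SimplexJacobi.racahWeight m (SimplexJacobi.betaParam m κ) n
                  (SimplexJacobi.revSums ν)) *
              SimplexJacobi.racahHat m (SimplexJacobi.betaParam m κ) n
                (fun y => -SimplexJacobi.racahWeight m (SimplexJacobi.betaParam m κ) n y)
                (SimplexJacobi.revIdx μ) (SimplexJacobi.revSums ν)) ∧
        SimplexJacobi.normalizedCoeff (SimplexJacobi.cyclicPerm m) κ c ν μ =
          (-1) ^ (n + ν (Fin.last m)) *
            √(SimplexJacobi.racahWeight m (SimplexJacobi.betaDual m κ n) n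
                (SimplexJacobi.initSums μ)) *
            SimplexJacobi.racahHat m (SimplexJacobi.betaDual m κ n) n
              (SimplexJacobi.racahWeight m (SimplexJacobi.betaDual m κ n) n)
              (SimplexJacobi.initIdx ν) (SimplexJacobi.initSums μ) := by
  have hc := SimplexJacobi.isConnectionCoeff_cycCoef m n κ hκ
  refine ⟨SimplexJacobi.cycCoef m κ, hc, fun c' hc' ν hν μ hμ => hc.unique hκ hc' hν hμ,
    fun ν hν μ hμ => ⟨fun h => ?_, fun h => ?_, ?_⟩⟩
  · have hp : 0 < 1 * SimplexJacobi.poch (∑ i, κ i + m + 1) (2 * n) := by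
      rw [one_mul]
      rcases h with h | rfl
      · push_cast at h
        exact SimplexJacobi.poch_pos (by linarith) _
      · rw [mul_zero, SimplexJacobi.poch_zero]
        exact one_pos
    simpa only [one_mul] using SimplexJacobi.normalizedCoeff_eq_racahHat hκ hp hν hμ
  · have hp : 0 < -1 * SimplexJacobi.poch (∑ i, κ i + m + 1) (2 * n) := by
      obtain ⟨h, hn⟩ := h
      have hs := SimplexJacobi.neg_card_lt_sum κ hκ
      push_cast at h hs
      -- All `κ_i > -1` give `|κ| + d + 1 > 0`, so only the first factor of `(|κ| + d)_{2n}` is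
      -- negative; `n ≥ 1` ensures that this factor is present.
      rw [show 2 * n = 2 * n - 1 + 1 by omega, SimplexJacobi.poch_succ_left, ← mul_assoc]
      exact mul_pos (by linarith) (SimplexJacobi.poch_pos (by linarith) _)
    simpa only [neg_one_mul] using SimplexJacobi.normalizedCoeff_eq_racahHat hκ hp hν hμ
  · exact SimplexJacobi.normalizedCoeff_eq_racahHat_dual hκ hν hμ
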